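/- Let $E=(E^0,E^1,r,s)$ be an arbitrary directed graph, $K$ a field, and $L=L_K(E)$ the Leavitt path algebra: the (not necessarily unital) $K$-algebra generated by pairwise orthogonal idempotents $v\in E^0$ and elements $e,e^*$ ($e\in E^1$) with relations $s(e)e=e=er(e)$, $r(e)e^*=e^*=e^*s(e)$, $e^*e=r(e)$, $e^*f=0$ for $e\ne f$, and $v=\sum_{s(e)=v}ee^*$ for every vertex $v$ emitting a nonempty finite set of edges. It is $\mathbb Z$-graded by $L_n=\operatorname{span}_K\{\alpha\beta^*: \alpha,\beta \text{ finite paths with a common end},\ |\alpha|-|\beta|=n\}$ (vertices are paths of length $0$). Conventions. $T(v)$ is the set of all vertices $w$ such that there is a path from $v$ to $w$. A bifurcation is a vertex emitting more than one edge. A cycle is a closed path of positive length that does not pass through any of its vertices twice; an exit of a path is an edge $f$ with $s(f)=s(e)$, $f\neq e$ for some edge $e$ of the path. A vertex $v$ is a line point if no vertex of $T(v)$ is a bifurcation or lies on a cycle. Two infinite paths are tail-equivalent if they coincide after deleting suitable finite initial segments. $L$ is graded left (right) self-injective if it is an injective object in the category of unital $\mathbb Z$-graded left (right) $L$-modules $M$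 (unital means $LM=M$, respectively $ML=M$) with degree-preserving homomorphisms. For a graded ring $A$, a set $I$ and $\delta\in\mathbb Z^I$, $M_I(A)(\delta)$ is the ring of $I\times I$ matrices over $A$ with finitely many nonzero entries, graded by $\deg e_{ij}(a)=\deg a+\delta_i-\delta_j$. $K$ is concentrated in degree $0$, and $K[x^t,x^{-t}]\subseteq K[x,x^{-1}]$ has the grading with $\deg x=1$. Call line points $u,v$ equivalent if $T(u)\cap T(v)\ne\emptyset$, and let $X$ be any set of representatives of the equivalence classes of line points. For $v\in X$ let $\Lambda_v$ be the set of all finite paths $p$ that end in $T(v)$ and have no vertex in $T(v)$ other than the last one, with $\delta_v(p)=|p|-d(v,r(p))$, where $d(v,w)$ is the length of the unique path from $v$ to $w\in T(v)$ (if $v$ is a sink, $\Lambda_v$ is the set of all paths ending at $v$ and $\delta_v(p)=|p|$). Let $Y$ be the set of all distinct cycles (one cycle, with a chosen base vertex, for each class of cycles up to rotation). For $c\in Y$ let $\Upsilon_c$ be the set of all finite paths $q$ that end at the base vertex of $c$ and do not include all the edges of $c$, with $\varepsilon_c(q)=|q|$. Theorem. The following are equivalent: (1) $L$ is graded left self-injective;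 (1') $L$ is graded right self-injective; (2) $E$ is row-finite (no vertex emits infinitely many edges), no cycle in $E$ has an exit, and every infinite path in $E$ is tail-equivalent either to an infinite straight line segment (an infinite path none of whose vertices is a bifurcation) containing a line point, or to $ccc\cdots$ for some cycle $c$; (3) there is an isomorphism of graded $K$-algebras $$L\cong_{gr}\bigoplus_{v\in X}M_{\Lambda_v}(K)(\delta_v)\ \oplus\ \bigoplus_{c\in Y}M_{\Upsilon_c}(K[x^{|c|},x^{-|c|}])(\varepsilon_c);$$ (3') there are families of sets $(\Lambda_i)_{i\in I}$, $(\Upsilon_j)_{j\in J}$, positive integers $t_j$ and shifts $\delta_i\in\mathbb Z^{\Lambda_i}$, $\varepsilon_j\in\mathbb Z^{\Upsilon_j}$ with an isomorphism of graded $K$-algebras $$L\cong_{gr}\bigoplus_{i\in I}M_{\Lambda_i}(K)(\delta_i)\ \oplus\ \bigoplus_{j\in J}M_{\Upsilon_j}(K[x^{t_j},x^{-t_j}])(\varepsilon_j);$$ (4) $L$ is graded semisimple, i.e. a direct sum of minimal graded left ideals. -/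

import Mathlib

open scoped LaurentPolynomial

universe u v w

/-! ## Directed graphs -/

/-- A directed graph with vertex set `V`, edge set `E`, source map `src` and range map `rng`
(no restriction on the number of vertices, or of edges emitted by a vertex). -/
structure DirGraph (V : Type u) (E : Type v) where
  src : E → V
  rng : E → V

namespace DirGraph

variable {V : Type u} {E : Type v} (G : DirGraph V E)

/-- `G.IsPath a l b`: the list of edges `l` is a path from `a` to `b`; the empty list is the
path of length `0` at `a = b`. -/
def IsPath : V → List E → V → Prop
  | a, [], b => a = b
  | a, e :: l, b => G.src e = a ∧ IsPath (G.rng e) l b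

/-- The finite paths of `G`, including the vertices as paths of length `0`. -/
structure FinPath where
  start : V
  edges : List E
  finish : V
  isPath : G.IsPath start edges finish

/-- `T(a)`: the set of all vertices `b` such that there is a path from `a` to `b`. -/
def tree (a : V) : Set V := {b | ∃ l, G.IsPath a l b}

/-- `a` emits more than one edge. -/
def IsBifurcation (a : V) : Prop := ∃ e f : E, e ≠ f ∧ G.src e = a ∧ G.src f = a

/-- `c` is a cycle based at `a`: a closed path of positive length which does not pass through any
of its vertices twice. -/
def IsCycleAt (a : V) (c : List E) : Prop :=
  c ≠ [] ∧ G.IsPath a c a ∧ (c.map G.src).Nodup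

/-- `c` is a cycle (based at some vertex). -/
def IsCycle (c : List E) : Prop := ∃ a, G.IsCycleAt a c

/-- An exit for a path: an edge `f` with the same source as some edge `e` of the path, `f ≠ e`. -/
def HasExit (c : List E) : Prop := ∃ e ∈ c, ∃ f : E, G.src f = G.src e ∧ f ≠ e

/-- A line point: there is neither a bifurcation nor a cycle at any vertex of its tree. -/
def IsLinePoint (a : V) : Prop :=
  ∀ b ∈ G.tree a, ¬ G.IsBifurcation b ∧ ¬ ∃ c, G.IsCycleAt b c

/-- No vertex emits infinitely many edges. -/
def RowFinite : Prop := ∀ a : V, {e : E | G.src e = a}.Finite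

/-- `p 0, p 1, p 2, …` is an infinite path. -/
def IsInfPath (p : ℕ → E) : Prop := ∀ n, G.rng (p n) = G.src (p (n + 1))

/-- Two infinite paths are tail-equivalent if, after deleting initial segments of suitable positive
lengths `m` and `n`, they coincide. -/
def TailEquiv (p q : ℕ → E) : Prop :=
  ∃ m n : ℕ, 0 < m ∧ 0 < n ∧ ∀ k, p (m + k) = q (n + k)

/-- `q` is an infinite straight line segment: an infinite path no vertex of which is a
bifurcation. -/
def IsStraightLine (q : ℕ → E) : Prop :=
  G.IsInfPath q ∧ ∀ n, ¬ G.IsBifurcation (G.src (q n))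

/-- The infinite path `q` contains a line point. -/
def ContainsLinePoint (q : ℕ → E) : Prop := ∃ n, G.IsLinePoint (G.src (q n))

/-- `q` is the infinite path `ccc⋯`. -/
def IsInfPower (c : List E) (q : ℕ → E) : Prop :=
  ∀ n, (c)[n % c.length]? = some (q n)

/-- Two line points are equivalent if their trees meet; `X` is a set of representatives of the
equivalence classes of line points. -/
def IsLinePointReps (X : Set V) : Prop :=
  (∀ x ∈ X, G.IsLinePoint x) ∧
    ∀ a, G.IsLinePoint a → ∃! x, x ∈ X ∧ (G.tree a ∩ G.tree x).Nonempty

/-- `Y` is the set of all distinct cycles: each cycle is, up to the choice of its base vertex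
(that is, up to rotation of the list of its edges), exactly one member of `Y`. -/
def IsCycleReps (Y : Set (List E)) : Prop :=
  (∀ c ∈ Y, G.IsCycle c) ∧ ∀ c, G.IsCycle c → ∃! d, d ∈ Y ∧ c ~r d

/-- The length of a shortest path from `a` to `b` (if `a` is a line point and `b` lies in its
tree, there is only one path from `a` to `b`). -/
noncomputable def dist (a b : V) : ℕ := sInf {n | ∃ l, G.IsPath a l b ∧ l.length = n}

/-- The paths which end in the tree of `a` and have no vertex but the last one in it
(if `a` is a sink: all the paths ending at `a`). -/
def LinePaths (a : V) : Type max u v :=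
  {p : G.FinPath // p.finish ∈ G.tree a ∧ ∀ e ∈ p.edges, G.src e ∉ G.tree a}

/-- `|p|` minus the distance from `a` to the end of `p` (if `a` is a sink: just `|p|`). -/
noncomputable def lineShift (a : V) (p : G.LinePaths a) : ℤ :=
  (p.1.edges.length : ℤ) - (G.dist a p.1.finish : ℤ)

/-- The paths which end at the base vertex of the cycle `c` and do not include all the edges
of `c`. -/
def CyclePaths (c : List E) : Type max u v :=
  {p : G.FinPath // G.IsCycleAt p.finish c ∧ ¬ ∀ e ∈ c, e ∈ p.edges}

/-- The length of `p`. -/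
def cycleShift (c : List E) (p : G.CyclePaths c) : ℤ := (p.1.edges.length : ℤ)

end DirGraph

/-! ## Leavitt path algebras -/

/-- The generators of a Leavitt path algebra: vertices, edges and ghost edges. -/
inductive LeavittGen (V : Type u) (E : Type v) : Type max u v
  | vert : V → LeavittGen V E
  | edge : E → LeavittGen V E
  | ghost : E → LeavittGen V E

namespace Leavitt

variable (K : Type w) [Field K] {V : Type u} {E : Type v} (G : DirGraph V E)

/-- A vertex in the free algebra. -/
def fv (a : V) : FreeAlgebra K (LeavittGen V E) := FreeAlgebra.ι K (LeavittGen.vert a)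
/-- An edge in the free algebra. -/
def fe (e : E) : FreeAlgebra K (LeavittGen V E) := FreeAlgebra.ι K (LeavittGen.edge e)
/-- A ghost edge in the free algebra. -/
def fg (e : E) : FreeAlgebra K (LeavittGen V E) := FreeAlgebra.ι K (LeavittGen.ghost e)

/-- The defining relations: the vertices are pairwise orthogonal idempotents, acting
as units on the edges and ghost edges at the proper ends, and the
CK-1 relations and the CK-2 relations. -/
inductive Rel : FreeAlgebra K (LeavittGen V E) → FreeAlgebra K (LeavittGen V E) → Prop
  | idem (a : V) : Rel (fv K a * fv K a) (fv K a)
  | orth (a b : V) : a ≠ b → Rel (fv K a * fv K b) 0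
  | src_edge (e : E) : Rel (fv K (G.src e) * fe K e) (fe K e)
  | edge_rng (e : E) : Rel (fe K e * fv K (G.rng e)) (fe K e)
  | rng_ghost (e : E) : Rel (fv K (G.rng e) * fg K e) (fg K e)
  | ghost_src (e : E) : Rel (fg K e * fv K (G.src e)) (fg K e)
  | ck1_eq (e : E) : Rel (fg K e * fe K e) (fv K (G.rng e))
  | ck1_ne (e f : E) : e ≠ f → Rel (fg K e * fe K f) 0
  | ck2 (a : V) (hfin : {e : E | G.src e = a}.Finite) (hne : {e : E | G.src e = a}.Nonempty) :
      Rel (fv K a) (∑ e ∈ hfin.toFinset, fe K e * fg K e)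

/-- The unital algebra with these generators and relations. None of the relations has a constant
term, so this is the unitization (with a new unit adjoined) of the non-unital algebra with the
same generators and relations. -/
abbrev Unital : Type max u v w := RingQuot (Rel K G)

/-- The class of a generator. -/
def gen (x : LeavittGen V E) : Unital K G :=
  RingQuot.mkAlgHom K (Rel K G) (FreeAlgebra.ι K x)

/-- The Leavitt path algebra `L_K(E)`: the `K`-algebra, in general without unit, generated by the
vertices, edges and ghost edges subject to the defining relations. -/
abbrev algebra : NonUnitalSubalgebra K (Unital K G) :=
  NonUnitalAlgebra.adjoin K (Set.range (gen K G))

/-- The element given by a path `l` starting at `a`. -/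
def pathElt : V → List E → Unital K G
  | a, [] => gen K G (LeavittGen.vert a)
  | _, e :: l => gen K G (LeavittGen.edge e) * pathElt (G.rng e) l

/-- The element given by the ghost path of a path `l` starting at `a`. -/
def ghostElt : V → List E → Unital K G
  | a, [] => gen K G (LeavittGen.vert a)
  | _, e :: l => ghostElt (G.rng e) l * gen K G (LeavittGen.ghost e)

end Leavitt

/-- The Leavitt path algebra `L_K(E)` as a type. -/
def LeavittPathAlgebra (K : Type w) [Field K] {V : Type u} {E : Type v} (G : DirGraph V E) :
    Type max u v w :=
  Leavitt.algebra K G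

namespace LeavittPathAlgebra

variable (K : Type w) [Field K] {V : Type u} {E : Type v} (G : DirGraph V E)

noncomputable instance : NonUnitalRing (LeavittPathAlgebra K G) :=
  inferInstanceAs (NonUnitalRing (Leavitt.algebra K G))

noncomputable instance : Module K (LeavittPathAlgebra K G) :=
  inferInstanceAs (Module K (Leavitt.algebra K G))

instance : IsScalarTower K (LeavittPathAlgebra K G) (LeavittPathAlgebra K G) :=
  inferInstanceAs (IsScalarTower K (Leavitt.algebra K G) (Leavitt.algebra K G))

instance : SMulCommClass K (LeavittPathAlgebra K G) (LeavittPathAlgebra K G) :=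
  inferInstanceAs (SMulCommClass K (Leavitt.algebra K G) (Leavitt.algebra K G))

/-- The inclusion of `L_K(E)` in its unitization. -/
noncomputable def incl : LeavittPathAlgebra K G →ₙₐ[K] Leavitt.Unital K G :=
  NonUnitalSubalgebraClass.subtype (Leavitt.algebra K G)

/-- The homogeneous component of degree `n`: the span of all `α β*` for paths `α`, `β` with a
common end and `|α| - |β| = n`. -/
noncomputable def grading (n : ℤ) : Submodule K (LeavittPathAlgebra K G) :=
  (Submodule.span K
    {x : Leavitt.Unital K G | ∃ p q : G.FinPath, p.finish = q.finish ∧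
      (p.edges.length : ℤ) - (q.edges.length : ℤ) = n ∧
      x = Leavitt.pathElt K G p.start p.edges * Leavitt.ghostElt K G q.start q.edges}).comap
    (incl K G : LeavittPathAlgebra K G →ₗ[K] Leavitt.Unital K G)

end LeavittPathAlgebra

/-! ## Graded modules and graded injectivity for rings without unit -/

namespace GradedRingTheory

/-- A unital graded left module over a ring `R`, not necessarily with unit, graded by `𝒜`:
an abelian group `M` with an additive action of `R` (`act (a * b) = act a ∘ act b`),
`M = R M`, and a direct sum decomposition `M = ⨁ M_n` with `R_m M_n ⊆ M_{m+n}`. -/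
structure GradedModule {R : Type u} [NonUnitalRing R] (𝒜 : ℤ → AddSubgroup R)
    (M : Type v) [AddCommGroup M] where
  act : R →ₙ+* AddMonoid.End M
  unital : AddSubgroup.closure {y : M | ∃ (a : R) (x : M), y = act a x} = ⊤
  comp : ℤ → AddSubgroup M
  isInternal : DirectSum.IsInternal comp
  act_mem : ∀ {m n : ℤ} {a : R} {x : M}, a ∈ 𝒜 m → x ∈ comp n → act a x ∈ comp (m + n)

/-- The graded ring `R` is graded left self-injective: it is an injective object of the category
of unital graded left `R`-modules and graded homomorphisms of degree `0`, that is, each graded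
homomorphism `f : N → R` extends along each injective graded homomorphism `i : N → M`. -/
def IsLeftSelfInjective {R : Type u} [NonUnitalRing R] (𝒜 : ℤ → AddSubgroup R) : Prop :=
  ∀ (N M : Type u) [AddCommGroup N] [AddCommGroup M]
    (gN : GradedModule 𝒜 N) (gM : GradedModule 𝒜 M) (i : N →+ M) (f : N →+ R),
    Function.Injective i →
    (∀ a x, i (gN.act a x) = gM.act a (i x)) → (∀ n, ∀ x ∈ gN.comp n, i x ∈ gM.comp n) →
    (∀ a x, f (gN.act a x) = a * f x) → (∀ n, ∀ x ∈ gN.comp n, f x ∈ 𝒜 n) →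
    ∃ g : M →+ R, (∀ a y, g (gM.act a y) = a * g y) ∧ (∀ n, ∀ y ∈ gM.comp n, g y ∈ 𝒜 n) ∧
      ∀ x, g (i x) = f x

/-- The grading of the opposite ring. -/
def opGrading {R : Type u} [NonUnitalRing R] (𝒜 : ℤ → AddSubgroup R) (n : ℤ) :
    AddSubgroup Rᵐᵒᵖ :=
  (𝒜 n).map (MulOpposite.opAddEquiv : R ≃+ Rᵐᵒᵖ).toAddMonoidHom

/-- Graded right self-injectivity; right `R`-modules are left modules over the opposite ring. -/
def IsRightSelfInjective {R : Type u} [NonUnitalRing R] (𝒜 : ℤ → AddSubgroup R) : Prop :=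
  IsLeftSelfInjective (opGrading 𝒜)

/-- `I` is a graded left ideal: a left ideal which is the sum of its homogeneous parts. -/
def IsGradedLeftIdeal {R : Type u} [NonUnitalRing R] (𝒜 : ℤ → AddSubgroup R)
    (I : AddSubgroup R) : Prop :=
  (∀ a, ∀ x ∈ I, a * x ∈ I) ∧ I ≤ ⨆ n, I ⊓ 𝒜 n

/-- `I` is a minimal graded left ideal. -/
def IsMinimalGradedLeftIdeal {R : Type u} [NonUnitalRing R] (𝒜 : ℤ → AddSubgroup R)
    (I : AddSubgroup R) : Prop :=
  IsGradedLeftIdeal 𝒜 I ∧ I ≠ ⊥ ∧ ∀ J, IsGradedLeftIdeal 𝒜 J → J ≤ I → J = ⊥ ∨ J = I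

/-- `R` is graded semisimple: it is the direct sum of a set of minimal graded left ideals. -/
def IsGradedSemisimple {R : Type u} [NonUnitalRing R] (𝒜 : ℤ → AddSubgroup R) : Prop :=
  ∃ S : Set (AddSubgroup R), (∀ I ∈ S, IsMinimalGradedLeftIdeal 𝒜 I) ∧ sSupIndep S ∧ sSup S = ⊤

end GradedRingTheory

/-! ## Graded matrix rings of arbitrary size and direct sums -/

/-- The `I × I` matrices over `A` with only finitely many non-zero entries. -/
def FinMat (I : Type u) (A : Type v) [Zero A] : Type max u v := (I × I) →₀ A

namespace FinMat

variable {I : Type u} {A : Type v}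

noncomputable instance [AddCommGroup A] : AddCommGroup (FinMat I A) :=
  inferInstanceAs (AddCommGroup ((I × I) →₀ A))

noncomputable instance {K : Type w} [Semiring K] [AddCommGroup A] [Module K A] :
    Module K (FinMat I A) :=
  inferInstanceAs (Module K ((I × I) →₀ A))

/-- The entry of a matrix in position `(i, j)`. -/
def entry [Zero A] (M : FinMat I A) (i j : I) : A := Finsupp.toFun M (i, j)

open Classical in
/-- Matrix multiplication, `e_ij(a) e_kl(b) = e_il(a b)` if `j = k` and `0` otherwise. -/
noncomputable def mulAux [Ring A] (M N : (I × I) →₀ A) : (I × I) →₀ A :=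
  M.sum fun p a => N.sum fun q b => if p.2 = q.1 then Finsupp.single (p.1, q.2) (a * b) else 0

section ring
variable [Ring A]

theorem mulAux_add_left (M M' N : (I × I) →₀ A) :
    mulAux (M + M') N = mulAux M N + mulAux M' N := by
  classical
  refine Finsupp.sum_add_index' (fun p => ?_) (fun p a b => ?_)
  · simp
  · rw [← Finsupp.sum_add]
    refine Finsupp.sum_congr fun q _ => ?_
    split_ifs <;> simp [add_mul]

theorem mulAux_add_right (M N N' : (I × I) →₀ A) :
    mulAux M (N + N') = mulAux M N + mulAux M N' := by
  classical
  refine Eq.trans (Finsupp.sum_congr fun p _ => ?_) Finsupp.sum_add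
  refine Finsupp.sum_add_index' (fun q => ?_) (fun q a b => ?_)
  · simp
  · split_ifs <;> simp [mul_add]

theorem mulAux_zero_left (N : (I × I) →₀ A) : mulAux 0 N = 0 := by simp [mulAux]

theorem mulAux_zero_right (M : (I × I) →₀ A) : mulAux M 0 = 0 := by simp [mulAux]

open Classical in
theorem mulAux_single (p q : I × I) (a b : A) :
    mulAux (Finsupp.single p a) (Finsupp.single q b) =
      if p.2 = q.1 then Finsupp.single (p.1, q.2) (a * b) else 0 := by
  rw [mulAux, Finsupp.sum_single_index, Finsupp.sum_single_index] <;> simp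

theorem mulAux_assoc (M N P : (I × I) →₀ A) :
    mulAux (mulAux M N) P = mulAux M (mulAux N P) := by
  classical
  induction M using Finsupp.induction_linear with
  | zero => simp only [mulAux_zero_left]
  | add M M' h h' => simp only [mulAux_add_left, h, h']
  | single p a =>
    induction N using Finsupp.induction_linear with
    | zero => simp only [mulAux_zero_left, mulAux_zero_right]
    | add N N' h h' => simp only [mulAux_add_left, mulAux_add_right, h, h']
    | single q b =>
      induction P using Finsupp.induction_linear with
      | zero => simp only [mulAux_zero_right]
      | add P P' h h' => simp only [mulAux_add_right, h, h']
      | single r c =>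
        simp only [mulAux_single]
        split_ifs <;>
          simp_all only [mulAux_single, mulAux_zero_left, mulAux_zero_right, mul_assoc, if_true,
            if_false]

noncomputable instance : NonUnitalRing (FinMat I A) where
  mul := mulAux
  left_distrib := mulAux_add_right
  right_distrib := mulAux_add_left
  zero_mul := mulAux_zero_left
  mul_zero := mulAux_zero_right
  mul_assoc := mulAux_assoc

end ring

/-- The grading of `M_I(A)(δ)`, where `A` is graded by `𝒜`: a matrix is homogeneous of degree `n`
if its `(i, j)` entry has degree `n + δ_j - δ_i`, so that `deg e_ij(a) = deg a + δ_i - δ_j`. -/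
def grading {K : Type w} [Field K] [Ring A] [Algebra K A] (𝒜 : ℤ → Submodule K A) (δ : I → ℤ)
    (n : ℤ) : Submodule K (FinMat I A) where
  carrier := {M | ∀ i j, M.entry i j ∈ 𝒜 (n + δ j - δ i)}
  zero_mem' := fun _ _ => Submodule.zero_mem _
  add_mem' := fun hM hN i j => Submodule.add_mem _ (hM i j) (hN i j)
  smul_mem' := fun k _ hM i j => Submodule.smul_mem _ k (hM i j)

end FinMat

/-- The direct sum of a family of rings, with componentwise multiplication: the families in the
product with only finitely many non-zero components. -/
def ringDirectSum (K : Type w) [Field K] {ι : Type u} (R : ι → Type v)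
    [∀ i, NonUnitalRing (R i)] [∀ i, Module K (R i)] : NonUnitalSubalgebra K (∀ i, R i) where
  carrier := {f | {i | f i ≠ 0}.Finite}
  zero_mem' := by simp
  add_mem' := fun {f g} hf hg => (hf.union hg).subset fun i hi => by
    by_contra h
    simp only [Set.mem_union, Set.mem_ofPred_eq, not_or, not_not] at h
    exact hi (by simp [h.1, h.2])
  mul_mem' := fun {f g} hf _ => hf.subset fun i hi h => hi (by simp [h])
  smul_mem' := fun k f hf => hf.subset fun i hi h => hi (by simp [h])

/-- The direct sum of a family of rings, as a type. -/
def RingDirectSum (K : Type w) [Field K] {ι : Type u} (R : ι → Type v)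
    [∀ i, NonUnitalRing (R i)] [∀ i, Module K (R i)] : Type max u v := ringDirectSum K R

namespace RingDirectSum

variable (K : Type w) [Field K] {ι : Type u} (R : ι → Type v)
  [∀ i, NonUnitalRing (R i)] [∀ i, Module K (R i)]

instance : NonUnitalRing (RingDirectSum K R) := inferInstanceAs (NonUnitalRing (ringDirectSum K R))

instance : Module K (RingDirectSum K R) := inferInstanceAs (Module K (ringDirectSum K R))

/-- The component of index `i`. -/
def component (f : RingDirectSum K R) (i : ι) : R i := Subtype.val f i

/-- The grading of a direct sum: an element is homogeneous of degree `n` if all its components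
are. -/
def grading (𝒢 : ∀ i, ℤ → Submodule K (R i)) (n : ℤ) : Submodule K (RingDirectSum K R) where
  carrier := {f | ∀ i, component K R f i ∈ 𝒢 i n}
  zero_mem' := fun _ => Submodule.zero_mem _
  add_mem' := fun hf hg i => Submodule.add_mem _ (hf i) (hg i)
  smul_mem' := fun k _ hf i => Submodule.smul_mem _ k (hf i)

end RingDirectSum

section Decomposition

variable (K : Type w) [Field K]

/-- The grading of the field `K`, concentrated in degree `0`. -/
def fieldGrading (n : ℤ) : Submodule K K := if n = 0 then ⊤ else ⊥

/-- The subring `K[x^t, x^{-t}]` of `K[x, x⁻¹]`. -/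
noncomputable def laurentSub (t : ℕ) : Subalgebra K K[T;T⁻¹] :=
  Algebra.adjoin K {LaurentPolynomial.T (t : ℤ), LaurentPolynomial.T (-(t : ℤ))}

/-- The ring `K[x^t, x^{-t}]`, as a type. -/
def LaurentRing (t : ℕ) : Type w := laurentSub K t

noncomputable instance (t : ℕ) : CommRing (LaurentRing K t) :=
  inferInstanceAs (CommRing (laurentSub K t))

noncomputable instance (t : ℕ) : Algebra K (LaurentRing K t) :=
  inferInstanceAs (Algebra K (laurentSub K t))

/-- The inclusion of `K[x^t, x^{-t}]` in `K[x, x⁻¹]`. -/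
noncomputable def LaurentRing.incl (t : ℕ) : LaurentRing K t →ₐ[K] K[T;T⁻¹] := (laurentSub K t).val

/-- The grading of `K[x^t, x^{-t}]` induced by the grading of `K[x, x⁻¹]` with `deg x = 1`. -/
noncomputable def laurentGrading (t : ℕ) (n : ℤ) : Submodule K (LaurentRing K t) :=
  (AddMonoidAlgebra.grade K n).comap (LaurentRing.incl K t).toLinearMap

/-- `⨁_i M_{Λ i}(K) ⊕ ⨁_j M_{Υ j}(K[x^{t j}, x^{-t j}])`. -/
abbrev MatrixSum {I : Type u} {J : Type v} (Λ : I → Type (max u v)) (Υ : J → Type (max u v))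
    (t : J → ℕ) : Type max u v w :=
  RingDirectSum K (fun i => FinMat (Λ i) K) ×
    RingDirectSum K (fun j => FinMat (Υ j) (LaurentRing K (t j)))

/-- The grading of
`⨁_i M_{Λ i}(K)(δ i) ⊕ ⨁_j M_{Υ j}(K[x^{t j}, x^{-t j}])(ε j)`. -/
noncomputable def MatrixSum.grading {I : Type u} {J : Type v} (Λ : I → Type (max u v))
    (Υ : J → Type (max u v)) (t : J → ℕ) (δ : ∀ i, Λ i → ℤ) (ε : ∀ j, Υ j → ℤ) (n : ℤ) :
    Submodule K (MatrixSum K Λ Υ t) :=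
  (RingDirectSum.grading K (fun i => FinMat (Λ i) K)
      (fun i => FinMat.grading (fieldGrading K) (δ i)) n).prod
    (RingDirectSum.grading K (fun j => FinMat (Υ j) (LaurentRing K (t j)))
      (fun j => FinMat.grading (laurentGrading K (t j)) (ε j)) n)

end Decomposition

/-- `A` and `B` are isomorphic as graded `K`-algebras. -/
def GradedIso (K : Type w) [Field K] (A : Type u) (B : Type v) [NonUnitalRing A] [NonUnitalRing B]
    [Module K A] [Module K B] (𝒜 : ℤ → Submodule K A) (ℬ : ℤ → Submodule K B) : Prop :=
  ∃ φ : A →ₙₐ[K] B, Function.Bijective φ ∧ ∀ n a, a ∈ 𝒜 n ↔ φ a ∈ ℬ n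

/-! The conditions are proved equivalent in the circle (1) ⇒ (2) ⇒ (3) ⇒ (3') ⇒ (4) ⇒ (1), with (1)
⇔ (1') by symmetry: the involution `e ↔ e*` is an isomorphism onto the opposite ring which negates
degrees (`isRightSelfInjective_iff`).

Self-injectivity forces finiteness (`not_isLeftSelfInjective`). Let `u d` be infinitely many
orthogonal idempotents of degree 0 with `u d * v = u d`, and `S` an infinite set of indices with
infinite complement. The map on the left ideal `∑ R (u d)` which is the identity on `R (u d)` for `d
∈ S` and zero for the other `d` can only extend to `R` if `u d * b * u d` is `u d` for `d ∈ S` and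
`0` otherwise, where `b` is the image of `v`, of degree 0. In a Leavitt path algebra take `u d = ω
ω*` for pairwise incomparable paths `ω` from one vertex. A monomial `αβ*` of degree 0 then acts on
almost all `u d` by one and the same scalar, so no such `b` exists, provided each path is a prefix
of almost all `ω` or incomparable with almost all of them. The edges at an infinite emitter, and the
paths which leave an infinite path at its infinitely many bifurcations, are such families. Thus the
graph is row-finite and each infinite path has finitely many bifurcations. Applied to `ccc⋯` this
excludes exits of cycles; in general the tail of an infinite path is straight, and it either winds
around a cycle or consists of line points.

For the decomposition (`gradedIso_of_graph_conditions`), the paths in `Λ_v` and `Υ_c` are pairwise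
incomparable, so that they give orthogonal systems of graded matrix units. Multiplying by a column
on the left and a row on the right recovers each matrix entry, whence injectivity and the statement
on degrees. For surjectivity call a vertex covered if all `αβ*` meeting there lie in the image
(`Covers`). By CK-2 a vertex is covered as soon as the ends of all its finitely many edges are. An
uncovered vertex would therefore start an infinite path of uncovered vertices, but every infinite
path reaches a line point or a cycle, where the vertices are covered.

The coefficient rings `K` and `K[x^t, x^{-t}]` are graded fields, so a diagonal matrix unit
generates a minimal graded left ideal, and (3') gives (4). If `R` is a sum of minimal graded left
ideals, each unital graded module is a sum of simple images of these; hence all graded submodules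
have complements and all homomorphisms extend. Here graded modules are regarded as modules over a
free ring which acts by `R` and by the projections to the components, so that the theory of
semisimple modules applies.

Two facts about the algebra support all this: the degree is recorded by a coaction into the group
ring of `ℤ`, which makes the sum of the components direct, and vertices are non-zero (`vt_ne_zero`),
by an explicit representation. -/

namespace GradedRingTheory

/-! ## Gradings of abelian groups and their projections -/

section Projections

variable {M : Type*} [AddCommGroup M] {comp : ℤ → AddSubgroup M}

/-- The maps `π m` read the components off a finite sum, so that the sum is direct. This is how all
gradings below are shown to be direct sums. -/
theorem isInternal_of_projections (π : ℤ → M →+ M)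
    (same : ∀ n, ∀ x ∈ comp n, π n x = x) (ne : ∀ m n, m ≠ n → ∀ x ∈ comp n, π m x = 0)
    (top : ⨆ n, comp n = ⊤) : DirectSum.IsInternal comp := by
  classical
  have key : ∀ (m : ℤ) (x : DirectSum ℤ fun n => comp n),
      π m (DirectSum.coeAddMonoidHom comp x) = x m := by
    intro m x
    induction x using DirectSum.induction_on with
    | zero => simp
    | of n x =>
      rw [DirectSum.coeAddMonoidHom_of]
      by_cases h : m = n
      · subst h; rw [same m _ x.2, DirectSum.of_eq_same]
      · rw [ne m n h _ x.2, DirectSum.of_eq_of_ne _ _ _ h]; rfl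
    | add x y hx hy => rw [map_add, map_add, hx, hy]; rfl
  constructor
  · intro x y hxy
    refine DFinsupp.ext fun m => Subtype.ext ?_
    rw [← key m x, ← key m y, hxy]
  · intro y
    have hy : y ∈ ⨆ n, comp n := top ▸ AddSubgroup.mem_top y
    induction hy using AddSubgroup.iSup_induction' with
    | hp n x hx => exact ⟨DirectSum.of (fun n => comp n) n ⟨x, hx⟩, by simp⟩
    | h1 => exact ⟨0, map_zero _⟩
    | hadd x y _ _ hx hy =>
      obtain ⟨a, rfl⟩ := hx
      obtain ⟨b, rfl⟩ := hy
      exact ⟨a + b, map_add _ _ _⟩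

/-- The projection to the homogeneous component of degree `n`. -/
noncomputable def proj (h : DirectSum.IsInternal comp) (n : ℤ) : M →+ M :=
  ((comp n).subtype.comp (DirectSum.component ℤ ℤ (fun n => comp n) n).toAddMonoidHom).comp
    (AddEquiv.ofBijective _ h).symm.toAddMonoidHom

variable (h : DirectSum.IsInternal comp)

theorem proj_coeAddMonoidHom (n : ℤ) (y : DirectSum ℤ fun n => comp n) :
    proj h n (DirectSum.coeAddMonoidHom comp y) = y n := by
  have : (AddEquiv.ofBijective _ h).symm (DirectSum.coeAddMonoidHom comp y) = y :=
    (AddEquiv.symm_apply_eq _).2 rfl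
  exact congrArg (fun z : DirectSum ℤ fun n => comp n => ((z n : comp n) : M)) this

theorem proj_mem (n : ℤ) (x : M) : proj h n x ∈ comp n := by
  obtain ⟨y, rfl⟩ := h.2 x
  rw [proj_coeAddMonoidHom]
  exact (y n).2

theorem proj_coe {n : ℤ} {x : M} (hx : x ∈ comp n) (m : ℤ) :
    proj h m x = if m = n then x else 0 := by
  have : x = DirectSum.coeAddMonoidHom comp (DirectSum.of (fun n => comp n) n ⟨x, hx⟩) := by simp
  conv_lhs => rw [this]
  rw [proj_coeAddMonoidHom]
  split_ifs with hm
  · subst hm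
    rw [DirectSum.of_eq_same]
  · rw [DirectSum.of_eq_of_ne _ _ _ hm]; rfl

theorem proj_same {n : ℤ} {x : M} (hx : x ∈ comp n) : proj h n x = x := by
  rw [proj_coe h hx, if_pos rfl]

theorem eq_zero_of_proj {x : M} (hx : ∀ n, proj h n x = 0) : x = 0 := by
  obtain ⟨y, rfl⟩ := h.2 x
  have : y = 0 := DFinsupp.ext fun n => Subtype.ext (by
    rw [← proj_coeAddMonoidHom h n y, hx n]; rfl)
  rw [this, map_zero]

theorem iSup_comp_eq_top (h : DirectSum.IsInternal comp) : ⨆ n, comp n = ⊤ := by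
  rw [eq_top_iff]
  intro x _
  obtain ⟨y, rfl⟩ := h.2 x
  induction y using DirectSum.induction_on with
  | zero => simp
  | of n x => simpa using AddSubgroup.mem_iSup_of_mem n x.2
  | add x y hx hy =>
    rw [map_add]; exact add_mem (hx trivial) (hy trivial)

/-- A property holds for all elements if it holds for the homogeneous ones and is additive. -/
theorem homogeneous_induction (h : DirectSum.IsInternal comp) {p : M → Prop} (x : M)
    (hom : ∀ n, ∀ x ∈ comp n, p x) (zero : p 0) (add : ∀ x y, p x → p y → p (x + y)) : p x := by
  have hx : x ∈ ⨆ n, comp n := iSup_comp_eq_top h ▸ AddSubgroup.mem_top x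
  exact AddSubgroup.iSup_induction comp (C := p) hx hom zero add

/-- A subgroup is the sum of its homogeneous parts exactly if it is closed under projections. -/
theorem le_iSup_inf_iff (I : AddSubgroup M) :
    I ≤ ⨆ n, I ⊓ comp n ↔ ∀ n, ∀ x ∈ I, proj h n x ∈ I := by
  classical
  constructor
  · intro hI n x hx
    refine AddSubgroup.iSup_induction _ (C := fun x => proj h n x ∈ I) (hI hx) ?_ ?_ ?_
    · rintro m y ⟨hy, hy'⟩
      rw [proj_coe h hy']
      split_ifs
      exacts [hy, I.zero_mem]
    · simp
    · intro a b ha hb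
      rw [map_add]; exact add_mem ha hb
  · intro hI x hx
    have hsum : x ∈ AddSubgroup.closure (Set.range fun n => proj h n x) := by
      obtain ⟨y, hy⟩ := h.2 x
      have hsupp := DirectSum.sum_support_of y
      have hx' : x = ∑ n ∈ DFinsupp.support y, proj h n x := by
        conv_lhs => rw [← hy, ← hsupp, map_sum]
        refine Finset.sum_congr rfl fun n _ => ?_
        rw [DirectSum.coeAddMonoidHom_of, ← proj_coeAddMonoidHom h n y, hy]
      rw [hx']
      exact sum_mem fun n _ => AddSubgroup.subset_closure ⟨n, by rw [← hx']⟩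
    refine (AddSubgroup.closure_le _).2 ?_ hsum
    rintro _ ⟨n, rfl⟩
    exact AddSubgroup.mem_iSup_of_mem n ⟨hI n x hx, proj_mem h n x⟩

end Projections

/-! ## Graded modules as modules over a free ring -/

section AsModule

variable {R : Type u} [NonUnitalRing R] {𝒜 : ℤ → AddSubgroup R}

/-- A free ring acting on graded modules by the action of `R` and the projections, so that its
submodules are the graded submodules and its linear maps are the graded homomorphisms. -/
abbrev ActionRing (R : Type u) : Type u := FreeAlgebra ℤ (R ⊕ ℤ)

namespace GradedModule

variable {M : Type v} [AddCommGroup M] (g : GradedModule 𝒜 M)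

/-- The action of the free ring on a graded module. -/
noncomputable def actionHom : ActionRing R →+* AddMonoid.End M :=
  (FreeAlgebra.lift ℤ (Sum.elim (fun a => g.act a) fun n => proj g.isInternal n) :
    ActionRing R →ₐ[ℤ] AddMonoid.End M).toRingHom

/-- The module over the free ring given by a graded module. -/
@[reducible]
noncomputable def asModule : Module (ActionRing R) M := Module.compHom M g.actionHom

end GradedModule

end AsModule

section Linear

variable {R : Type u} [NonUnitalRing R] {𝒜 : ℤ → AddSubgroup R}
variable {M : Type v} [AddCommGroup M] (g : GradedModule 𝒜 M)

theorem GradedModule.smul_inl (a : R) (x : M) :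
    letI := g.asModule
    (FreeAlgebra.ι ℤ (Sum.inl a) : ActionRing R) • x = g.act a x := by
  change g.actionHom (FreeAlgebra.ι ℤ (Sum.inl a)) x = _
  have h := FreeAlgebra.lift_ι_apply (R := ℤ) (A := AddMonoid.End M)
    (Sum.elim (fun a => g.act a) fun n => proj g.isInternal n) (Sum.inl a)
  exact DFunLike.congr_fun h x

theorem GradedModule.smul_inr (n : ℤ) (x : M) :
    letI := g.asModule
    (FreeAlgebra.ι ℤ (Sum.inr n) : ActionRing R) • x = proj g.isInternal n x := by
  change g.actionHom (FreeAlgebra.ι ℤ (Sum.inr n)) x = _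
  have h := FreeAlgebra.lift_ι_apply (R := ℤ) (A := AddMonoid.End M)
    (Sum.elim (fun a => g.act a) fun n => proj g.isInternal n) (Sum.inr n)
  exact DFunLike.congr_fun h x

/-- A graded subgroup closed under the action is a submodule over the free ring. -/
def GradedModule.toSubmodule (I : AddSubgroup M) (hact : ∀ a, ∀ x ∈ I, g.act a x ∈ I)
    (hproj : ∀ n, ∀ x ∈ I, proj g.isInternal n x ∈ I) :
    letI := g.asModule
    Submodule (ActionRing R) M :=
  letI := g.asModule
  { I with
    smul_mem' := by
      intro c
      induction c using FreeAlgebra.induction with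
      | grade0 r =>
        intro x hx
        change g.actionHom (algebraMap ℤ _ r) x ∈ I
        rw [eq_intCast, map_intCast]
        exact I.zsmul_mem hx r
      | grade1 s =>
        intro x hx
        rcases s with a | n
        · rw [g.smul_inl]; exact hact a x hx
        · rw [g.smul_inr]; exact hproj n x hx
      | mul a b ha hb =>
        intro x hx
        rw [mul_smul]; exact ha (hb hx)
      | add a b ha hb =>
        intro x hx
        rw [add_smul]; exact I.add_mem (ha hx) (hb hx) }

variable {N : Type w} [AddCommGroup N] (gN : GradedModule 𝒜 N)

/-- A graded homomorphism is linear over the free ring. -/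
def GradedModule.toLinearMap (f : N →+ M) (hact : ∀ a x, f (gN.act a x) = g.act a (f x))
    (hcomp : ∀ n, ∀ x ∈ gN.comp n, f x ∈ g.comp n) :
    letI := g.asModule
    letI := gN.asModule
    N →ₗ[ActionRing R] M :=
  letI := g.asModule
  letI := gN.asModule
  { f with
    map_smul' := by
      intro c
      change ∀ x, f (c • x) = c • f x
      induction c using FreeAlgebra.induction with
      | grade0 r =>
        intro x
        rw [eq_intCast, Int.cast_smul_eq_zsmul, Int.cast_smul_eq_zsmul, map_zsmul]
      | grade1 s =>
        intro x
        rcases s with a | n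
        · rw [g.smul_inl, gN.smul_inl, hact]
        · rw [g.smul_inr, gN.smul_inr]
          refine homogeneous_induction gN.isInternal
            (p := fun x => f (proj gN.isInternal n x) = proj g.isInternal n (f x)) x ?_ ?_ ?_
          · intro k x hx
            rw [proj_coe _ hx, proj_coe _ (hcomp k x hx)]
            split_ifs <;> simp
          · simp
          · intro x y hx hy
            simp only [map_add, hx, hy]
      | mul a b ha hb =>
        intro x
        rw [mul_smul, mul_smul, ha, hb]
      | add a b ha hb =>
        intro x
        rw [add_smul, add_smul, map_add, ha, hb] }

end Linear

end GradedRingTheory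

/-! ### Graded semisimplicity and injectivity -/

namespace GradedRingTheory

section Semisimple

variable {R : Type u} [NonUnitalRing R] {𝒜 : ℤ → AddSubgroup R}

/-- A graded ring with enough idempotents, viewed as a graded left module over itself. -/
def regular (hint : DirectSum.IsInternal 𝒜)
    (hmul : ∀ {m n : ℤ} {a x : R}, a ∈ 𝒜 m → x ∈ 𝒜 n → a * x ∈ 𝒜 (m + n))
    (hun : AddSubgroup.closure {y : R | ∃ a x : R, y = a * x} = ⊤) : GradedModule 𝒜 R where
  act :=
    { toFun := fun a => AddMonoidHom.mulLeft a
      map_mul' := fun a b => by ext x; exact mul_assoc a b x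
      map_zero' := by ext x; exact zero_mul x
      map_add' := fun a b => by ext x; exact add_mul a b x }
  unital := hun
  comp := 𝒜
  isInternal := hint
  act_mem := hmul

/-- Each unital graded module over a ring which is a sum of minimal graded left ideals is
semisimple. -/
theorem GradedModule.isSemisimpleModule (hint : DirectSum.IsInternal 𝒜)
    {S : Set (AddSubgroup R)} (hS : ∀ I ∈ S, IsMinimalGradedLeftIdeal 𝒜 I) (htop : sSup S = ⊤)
    {M : Type v} [AddCommGroup M] (g : GradedModule 𝒜 M) :
    letI := g.asModule
    IsSemisimpleModule (ActionRing R) M := by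
  let := g.asModule
  let orbit : M → R →+ M := fun m =>
    { toFun := fun a => g.act a m
      map_zero' := by rw [map_zero]; rfl
      map_add' := fun a b => by rw [map_add]; rfl }
  have orbit_apply : ∀ m a, orbit m a = g.act a m := fun _ _ => rfl
  -- The module is the sum of the subgroups `I m` for minimal ideals `I` and homogeneous `m`.
  -- Homogeneity of `m` makes `a ↦ a m` shift degrees by a constant, so that `I m` is graded.
  let ι := {t : AddSubgroup R × M × ℤ // t.1 ∈ S ∧ t.2.1 ∈ g.comp t.2.2}
  have hproj : ∀ t : ι, ∀ (n : ℤ) (a : R),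
      proj g.isInternal n (g.act a t.1.2.1) = g.act (proj hint (n - t.1.2.2) a) t.1.2.1 := by
    intro t n a
    refine homogeneous_induction hint (p := fun a => proj g.isInternal n (g.act a t.1.2.1) =
      g.act (proj hint (n - t.1.2.2) a) t.1.2.1) a ?_ ?_ ?_
    · intro k a ha
      rw [proj_coe _ (g.act_mem ha t.2.2), proj_coe _ ha]
      by_cases h : n = k + t.1.2.2
      · rw [if_pos h, if_pos (by omega)]
      · rw [if_neg h, if_neg (by omega), map_zero]; rfl
    · simp
    · intro a b ha hb
      simp only [map_add] at ha hb ⊢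
      change proj g.isInternal n (g.act a t.1.2.1 + g.act b t.1.2.1) = _
      rw [map_add, ha, hb]; rfl
  have hgraded : ∀ t : ι, ∀ n, ∀ a ∈ t.1.1, proj hint n a ∈ t.1.1 := fun t n a ha =>
    (le_iSup_inf_iff hint _).1 (hS _ t.2.1).1.2 n a ha
  let p : ι → Submodule (ActionRing R) M := fun t =>
    g.toSubmodule (t.1.1.map (orbit t.1.2.1))
      (by
        rintro a _ ⟨b, hb, rfl⟩
        refine ⟨a * b, (hS _ t.2.1).1.1 a b hb, ?_⟩
        rw [orbit_apply, orbit_apply, map_mul]; rfl)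
      (by
        rintro n _ ⟨b, hb, rfl⟩
        rw [orbit_apply, hproj]
        exact ⟨_, hgraded t _ b hb, rfl⟩)
  have hp : ∀ t, ∀ y, y ∈ p t ↔ ∃ a ∈ t.1.1, g.act a t.1.2.1 = y := fun t y => Iff.rfl
  refine isSemisimpleModule_of_isSemisimpleModule_submodule' (p := p) ?_ ?_
  · intro t
    by_cases hbot : p t = ⊥
    · rw [hbot]
      have : Subsingleton (Submodule (ActionRing R) (⊥ : Submodule (ActionRing R) M)) :=
        ⟨fun a b => by ext x; simp [Subsingleton.elim x 0]⟩
      exact (isSemisimpleModule_iff _ _).2 Subsingleton.instComplementedLattice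
    have : IsSimpleModule (ActionRing R) (p t) := by
      rw [isSimpleModule_iff_isAtom]
      refine ⟨hbot, fun q hq => ?_⟩
      -- The preimage in `I` of a submodule of `I m` is a graded left ideal. By minimality it is `0`
      -- or `I`, so the submodule is `0` or `I m`.
      let J : AddSubgroup R := t.1.1 ⊓ (q.toAddSubgroup.comap (orbit t.1.2.1))
      have hJ : IsGradedLeftIdeal 𝒜 J := by
        constructor
        · rintro a x ⟨hx, hx'⟩
          refine ⟨(hS _ t.2.1).1.1 a x hx, ?_⟩
          have := q.smul_mem (FreeAlgebra.ι ℤ (Sum.inl a)) hx'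
          rw [g.smul_inl] at this
          change orbit _ (a * x) ∈ q
          rw [orbit_apply, map_mul]; exact this
        · rw [le_iSup_inf_iff hint]
          rintro n x ⟨hx, hx'⟩
          refine ⟨hgraded t n x hx, ?_⟩
          have := q.smul_mem (FreeAlgebra.ι ℤ (Sum.inr (n + t.1.2.2))) hx'
          rw [g.smul_inr, orbit_apply, hproj, add_sub_cancel_right] at this
          exact this
      rcases (hS _ t.2.1).2.2 J hJ inf_le_left with h | h
      · rw [eq_bot_iff]
        intro y hy
        obtain ⟨a, ha, rfl⟩ := (hp t y).1 (hq.le hy)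
        have haJ : a ∈ J := ⟨ha, hy⟩
        rw [h, AddSubgroup.mem_bot] at haJ
        rw [haJ, map_zero]; exact zero_mem _
      · exfalso
        refine hq.not_ge fun y hy => ?_
        obtain ⟨a, ha, rfl⟩ := (hp t y).1 hy
        rw [← h] at ha
        exact ha.2
    infer_instance
  · rw [eq_top_iff]
    intro y _
    suffices h : ∀ (a : R) (x : M), g.act a x ∈ ⨆ t, p t by
      have hy : y ∈ AddSubgroup.closure {y : M | ∃ (a : R) (x : M), y = g.act a x} := by
        rw [g.unital]; trivial
      refine (AddSubgroup.closure_le (⨆ t, p t).toAddSubgroup).2 ?_ hy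
      rintro _ ⟨a, x, rfl⟩
      exact h a x
    intro a x
    refine homogeneous_induction g.isInternal (p := fun x => g.act a x ∈ ⨆ t, p t) x ?_ ?_ ?_
    · intro n x hx
      have ha : a ∈ ⨆ I : S, (I : AddSubgroup R) := by
        rw [← sSup_eq_iSup', htop]; trivial
      refine AddSubgroup.iSup_induction _ (C := fun a => g.act a x ∈ ⨆ t, p t) ha ?_ ?_ ?_
      · intro I b hb
        exact Submodule.mem_iSup_of_mem (⟨(I, x, n), I.2, hx⟩ : ι) ⟨b, hb, rfl⟩
      · rw [map_zero]; exact zero_mem _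
      · intro b c hb hc
        rw [map_add]; exact add_mem hb hc
    · rw [map_zero]; exact zero_mem _
    · intro b c hb hc
      rw [map_add]; exact add_mem hb hc

/-- Over the free ring the larger module is semisimple, so a linear map on a submodule extends.
Linearity with respect to the two kinds of generators then gives `R`-linearity and preservation of
degrees. -/
theorem IsGradedSemisimple.isLeftSelfInjective (hint : DirectSum.IsInternal 𝒜)
    (hmul : ∀ {m n : ℤ} {a x : R}, a ∈ 𝒜 m → x ∈ 𝒜 n → a * x ∈ 𝒜 (m + n))
    (hun : AddSubgroup.closure {y : R | ∃ a x : R, y = a * x} = ⊤)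
    (hss : IsGradedSemisimple 𝒜) : IsLeftSelfInjective 𝒜 := by
  obtain ⟨S, hS, -, htop⟩ := hss
  intro N M _ _ gN gM i f hinj hi hi' hf hf'
  let gR := regular hint hmul hun
  let := gN.asModule
  let := gM.asModule
  let := gR.asModule
  have := gM.isSemisimpleModule hint hS htop
  let i' : N →ₗ[ActionRing R] M := gM.toLinearMap gN i hi hi'
  let f' : N →ₗ[ActionRing R] R := gR.toLinearMap gN f hf hf'
  obtain ⟨h, hh⟩ := IsSemisimpleModule.extension_property i' hinj f'
  refine ⟨h.toAddMonoidHom, fun a y => ?_, fun n y hy => ?_, fun x => DFunLike.congr_fun hh x⟩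
  · have := h.map_smul (FreeAlgebra.ι ℤ (Sum.inl a)) y
    rw [gM.smul_inl, gR.smul_inl] at this
    exact this
  · have := h.map_smul (FreeAlgebra.ι ℤ (Sum.inr n)) y
    rw [gM.smul_inr, gR.smul_inr, proj_same _ hy] at this
    change h y ∈ 𝒜 n
    rw [this]
    exact proj_mem gR.isInternal n (h y)

/-- The ring is the sum of left ideals `R u` for idempotents `u` of degree `0`, such that each
non-zero homogeneous element of `R u` generates `R u`. -/
def HasPrimitiveIdempotents (𝒜 : ℤ → AddSubgroup R) : Prop :=
  ∃ U : Set R, (∀ u ∈ U, u ∈ 𝒜 0 ∧ u * u = u ∧ u ≠ 0) ∧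
    AddSubgroup.closure {y | ∃ a, ∃ u ∈ U, y = a * u} = ⊤ ∧
    ∀ u ∈ U, ∀ n, ∀ x ∈ 𝒜 n, x * u = x → x ≠ 0 → ∃ y, y * x = u

/-- A non-zero graded submodule of `R u` contains a non-zero homogeneous `x`, and `u` is a multiple
of `x`; hence `R u` is simple. A sum of simple modules is the direct sum of a set of simple
submodules, which here are the minimal graded left ideals. -/
theorem HasPrimitiveIdempotents.isGradedSemisimple (hint : DirectSum.IsInternal 𝒜)
    (hmul : ∀ {m n : ℤ} {a x : R}, a ∈ 𝒜 m → x ∈ 𝒜 n → a * x ∈ 𝒜 (m + n))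
    (h : HasPrimitiveIdempotents 𝒜) : IsGradedSemisimple 𝒜 := by
  obtain ⟨U, hU, htop, hmin⟩ := h
  have hun : AddSubgroup.closure {y : R | ∃ a x : R, y = a * x} = ⊤ := by
    rw [eq_top_iff, ← htop]
    refine AddSubgroup.closure_mono ?_
    rintro _ ⟨a, u, -, rfl⟩
    exact ⟨a, u, rfl⟩
  let gR := regular hint hmul hun
  let := gR.asModule
  have smul_inl : ∀ a x : R, (FreeAlgebra.ι ℤ (Sum.inl a) : ActionRing R) • x = a * x :=
    gR.smul_inl
  have smul_inr : ∀ n (x : R), (FreeAlgebra.ι ℤ (Sum.inr n) : ActionRing R) • x = proj hint n x :=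
    gR.smul_inr
  have ideal : ∀ P : Submodule (ActionRing R) R, IsGradedLeftIdeal 𝒜 P.toAddSubgroup := by
    intro P
    refine ⟨fun a x hx => ?_, (le_iSup_inf_iff hint _).2 fun n x hx => ?_⟩
    · rw [← smul_inl]; exact P.smul_mem _ hx
    · rw [← smul_inr]; exact P.smul_mem _ hx
  have ofIdeal : ∀ J, IsGradedLeftIdeal 𝒜 J → ∃ P : Submodule (ActionRing R) R,
      P.toAddSubgroup = J := fun J hJ =>
    ⟨gR.toSubmodule J hJ.1 ((le_iSup_inf_iff hint _).1 hJ.2), rfl⟩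
  -- Right multiplication by an element of degree 0 preserves degrees, which makes `R u` graded.
  have hproj : ∀ u ∈ U, ∀ n a, proj hint n (a * u) = proj hint n a * u := by
    intro u hu n a
    refine homogeneous_induction hint (p := fun a => proj hint n (a * u) = proj hint n a * u)
      a ?_ ?_ ?_
    · intro k a ha
      have := hmul ha (hU u hu).1
      rw [add_zero] at this
      rw [proj_coe _ this, proj_coe _ ha]
      split_ifs <;> simp
    · simp
    · intro a b ha hb
      simp only [add_mul, map_add, ha, hb]
  let p : U → Submodule (ActionRing R) R := fun u =>
    gR.toSubmodule ((⊤ : AddSubgroup R).map (AddMonoidHom.mulRight u.1))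
      (by
        rintro a _ ⟨b, -, rfl⟩
        exact ⟨a * b, trivial, mul_assoc _ _ _⟩)
      (by
        rintro n _ ⟨b, -, rfl⟩
        exact ⟨proj hint n b, trivial, (hproj u u.2 n b).symm⟩)
  have hp : ∀ (u : U) (y : R), y ∈ p u ↔ ∃ a, a * u.1 = y := by
    intro u y
    constructor
    · rintro ⟨a, -, h⟩
      exact ⟨a, h⟩
    · rintro ⟨a, h⟩
      exact ⟨a, trivial, h⟩
  have simple : ∀ u, IsSimpleModule (ActionRing R) (p u) := by
    intro u
    rw [isSimpleModule_iff_isAtom]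
    have hu := hU u u.2
    have hupu : u.1 ∈ p u := (hp _ _).2 ⟨u.1, hu.2.1⟩
    refine ⟨fun h => hu.2.2 ?_, fun q hq => ?_⟩
    · rw [h, Submodule.mem_bot] at hupu
      exact hupu
    · by_contra hne
      obtain ⟨x, hxq, hx0⟩ := (Submodule.ne_bot_iff _).1 hne
      have : ∃ n, proj hint n x ≠ 0 := by
        by_contra hall
        push Not at hall
        apply hx0
        exact eq_zero_of_proj hint hall
      obtain ⟨n, hn⟩ := this
      have hyq : proj hint n x ∈ q := by
        rw [← smul_inr]; exact q.smul_mem _ hxq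
      obtain ⟨a, ha⟩ := (hp _ _).1 (hq.le hyq)
      obtain ⟨y, hy⟩ := hmin u u.2 n _ (proj_mem hint n x)
        (by rw [← ha, mul_assoc, hu.2.1]) hn
      refine hq.not_ge fun z hz => ?_
      obtain ⟨b, rfl⟩ := (hp _ _).1 hz
      rw [← hy, ← mul_assoc, ← smul_inl]
      exact q.smul_mem _ hyq
  have htop' : ⨆ u, p u = ⊤ := by
    rw [eq_top_iff]
    intro y _
    have hy : y ∈ AddSubgroup.closure {y | ∃ a, ∃ u ∈ U, y = a * u} := by rw [htop]; trivial
    refine (AddSubgroup.closure_le (⨆ t, p t).toAddSubgroup).2 ?_ hy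
    rintro _ ⟨a, u, hu, rfl⟩
    exact Submodule.mem_iSup_of_mem ⟨u, hu⟩ ((hp _ _).2 ⟨a, rfl⟩)
  have hss : IsSemisimpleModule (ActionRing R) R :=
    isSemisimpleModule_of_isSemisimpleModule_submodule' (p := p)
      (fun u => have := simple u; inferInstance) htop'
  obtain ⟨s, hind, hsup, hsimple⟩ :=
    IsSemisimpleModule.exists_sSupIndep_sSup_simples_eq_top (ActionRing R) R
  -- A sum of graded left ideals is again one, so suprema may be formed among submodules or among
  -- subgroups. This carries the independence over.
  have sup_eq : ∀ t : Set (Submodule (ActionRing R) R),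
      sSup (Submodule.toAddSubgroup '' t) = (sSup t).toAddSubgroup := by
    intro t
    refine le_antisymm (sSup_le ?_) ?_
    · rintro _ ⟨P, hP, rfl⟩
      exact Submodule.toAddSubgroup_mono (le_sSup hP)
    · obtain ⟨Q, hQ⟩ := ofIdeal (sSup (Submodule.toAddSubgroup '' t)) (by
        constructor
        · intro a x hx
          rw [sSup_eq_iSup'] at hx ⊢
          refine AddSubgroup.iSup_induction _
            (C := fun x => a * x ∈ ⨆ P : Submodule.toAddSubgroup '' t, (P : AddSubgroup R))
            hx ?_ ?_ ?_
          · rintro ⟨_, P, hP, rfl⟩ x hx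
            exact AddSubgroup.mem_iSup_of_mem ⟨_, P, hP, rfl⟩ ((ideal P).1 a x hx)
          · rw [mul_zero]; exact zero_mem _
          · intro x y hx hy
            rw [mul_add]; exact add_mem hx hy
        · refine sSup_le ?_
          rintro _ ⟨P, hP, rfl⟩
          refine (ideal P).2.trans (iSup_mono fun n => inf_le_inf_right _ (le_sSup ⟨P, hP, rfl⟩)))
      rw [← hQ]
      refine Submodule.toAddSubgroup_mono (sSup_le fun P hP => ?_)
      have : P.toAddSubgroup ≤ Q.toAddSubgroup := hQ ▸ le_sSup ⟨P, hP, rfl⟩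
      exact this
  refine ⟨Submodule.toAddSubgroup '' s, ?_, ?_, ?_⟩
  · rintro _ ⟨P, hP, rfl⟩
    have hatom : IsAtom P := isSimpleModule_iff_isAtom.1 (hsimple P hP)
    refine ⟨ideal P, fun h => hatom.1 ?_, fun J hJ hJP => ?_⟩
    · rw [eq_bot_iff]
      intro x hx
      have : x ∈ P.toAddSubgroup := hx
      rw [h] at this
      exact this
    · obtain ⟨Q, rfl⟩ := ofIdeal J hJ
      rcases hatom.le_iff.1 (show Q ≤ P from hJP) with h | h
      · left; rw [h]; rfl
      · right; rw [h]
  · rintro _ ⟨P, hP, rfl⟩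
    have : Submodule.toAddSubgroup '' s \ {P.toAddSubgroup} =
        Submodule.toAddSubgroup '' (s \ {P}) := by
      rw [Set.image_sdiff Submodule.toAddSubgroup_injective, Set.image_singleton]
    rw [this, sup_eq, disjoint_iff, eq_bot_iff]
    rintro x ⟨hx, hx'⟩
    have := (hind hP).le_bot (⟨hx, hx'⟩ : x ∈ P ⊓ sSup (s \ {P}))
    exact this
  · rw [sup_eq, hsup]; rfl

/-- The criterion is invariant under graded isomorphisms. -/
theorem HasPrimitiveIdempotents.of_equiv {S : Type v} [NonUnitalRing S] {ℬ : ℤ → AddSubgroup S}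
    (φ : R →ₙ+* S) (hφ : Function.Bijective φ) (hdeg : ∀ n a, a ∈ 𝒜 n ↔ φ a ∈ ℬ n)
    (h : HasPrimitiveIdempotents ℬ) : HasPrimitiveIdempotents 𝒜 := by
  obtain ⟨U, hU, htop, hmin⟩ := h
  refine ⟨φ ⁻¹' U, fun u hu => ⟨(hdeg _ _).2 (hU _ hu).1, hφ.1 ?_, fun h => ?_⟩, ?_, ?_⟩
  · rw [map_mul, (hU _ hu).2.1]
  · exact (hU _ hu).2.2 (by rw [h, map_zero])
  · rw [eq_top_iff]
    intro x _
    have hx : φ x ∈ AddSubgroup.closure {y | ∃ a, ∃ u ∈ U, y = a * u} := by rw [htop]; trivial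
    have : AddSubgroup.closure {y | ∃ a, ∃ u ∈ U, y = a * u} ≤
        (AddSubgroup.closure {y | ∃ a, ∃ u ∈ φ ⁻¹' U, y = a * u}).map (φ : R →+ S) := by
      refine (AddSubgroup.closure_le _).2 ?_
      rintro _ ⟨a, u, hu, rfl⟩
      obtain ⟨a, rfl⟩ := hφ.2 a
      obtain ⟨u, rfl⟩ := hφ.2 u
      exact ⟨a * u, AddSubgroup.subset_closure ⟨a, u, hu, rfl⟩, map_mul φ a u⟩
    obtain ⟨y, hy, hyx⟩ := this hx
    rwa [← hφ.1 hyx]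
  · intro u hu n x hx hxu hx0
    obtain ⟨y, hy⟩ := hmin _ hu n _ ((hdeg _ _).1 hx) (by rw [← map_mul, hxu])
      (fun h => hx0 (hφ.1 (by rw [h, map_zero])))
    obtain ⟨y, rfl⟩ := hφ.2 y
    exact ⟨y, hφ.1 (by rw [map_mul, hy])⟩

end Semisimple

end GradedRingTheory

/-! ### Transfer along isomorphisms which negate degrees -/

namespace GradedRingTheory

section Transfer

/-- The module over `R` obtained from a module over `S` along an isomorphism `R ≃ S` which
reverses degrees. -/
noncomputable def GradedModule.antiComap {R : Type u} {S : Type v} [NonUnitalRing R]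
    [NonUnitalRing S] {𝒜 : ℤ → AddSubgroup R} {ℬ : ℤ → AddSubgroup S} (σ : R ≃+* S)
    (hσ : ∀ n a, a ∈ 𝒜 n ↔ σ a ∈ ℬ (-n)) {M : Type w} [AddCommGroup M] (g : GradedModule ℬ M) :
    GradedModule 𝒜 M where
  act := g.act.comp (σ : R →ₙ+* S)
  unital := by
    rw [eq_top_iff, ← g.unital]
    refine AddSubgroup.closure_mono ?_
    rintro _ ⟨a, x, rfl⟩
    exact ⟨σ.symm a, x, by simp⟩
  comp n := g.comp (-n)
  isInternal := by
    refine isInternal_of_projections (fun n => proj g.isInternal (-n)) ?_ ?_ ?_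
    · intro n x hx
      exact proj_same _ hx
    · intro m n hmn x hx
      rw [proj_coe _ hx, if_neg (by omega)]
    · rw [← iSup_comp_eq_top g.isInternal]
      exact (Equiv.neg ℤ).iSup_comp (g := fun n => g.comp n)
  act_mem {m n a x} ha hx := by
    rw [neg_add]
    exact g.act_mem ((hσ _ _).1 ha) hx

/-- An extension problem over `S` becomes one over `R` on the same groups, with the action pulled
back along `σ` and the components renumbered by `n ↦ -n`; composing the solution with `σ` undoes the
change. -/
theorem IsLeftSelfInjective.of_antigraded {R S : Type u} [NonUnitalRing R] [NonUnitalRing S]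
    {𝒜 : ℤ → AddSubgroup R} {ℬ : ℤ → AddSubgroup S} (σ : R ≃+* S)
    (hσ : ∀ n a, a ∈ 𝒜 n ↔ σ a ∈ ℬ (-n)) (h : IsLeftSelfInjective 𝒜) : IsLeftSelfInjective ℬ := by
  intro N M _ _ gN gM i f hinj hi hi' hf hf'
  have hσ' : ∀ n b, b ∈ ℬ n → σ.symm b ∈ 𝒜 (-n) := by
    intro n b hb
    rw [hσ, neg_neg, RingEquiv.apply_symm_apply]
    exact hb
  obtain ⟨g, hg, hg', hgi⟩ := h N M (gN.antiComap σ hσ) (gM.antiComap σ hσ) i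
    ((σ.symm : S →+ R).comp f) hinj (fun a x => hi (σ a) x) (fun n x hx => hi' (-n) x hx)
    (fun a x => by
      change σ.symm (f (gN.act (σ a) x)) = a * σ.symm (f x)
      rw [hf, map_mul, RingEquiv.symm_apply_apply])
    (fun n x hx => by
      have := hσ' _ _ (hf' (-n) x hx)
      rwa [neg_neg] at this)
  refine ⟨(σ : R →+ S).comp g, fun a y => ?_, fun n y hy => ?_, fun x => ?_⟩
  · have := hg (σ.symm a) y
    change g (gM.act (σ (σ.symm a)) y) = _ at this
    rw [RingEquiv.apply_symm_apply] at this
    change σ (g (gM.act a y)) = a * σ (g y)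
    rw [this, map_mul, RingEquiv.apply_symm_apply]
  · have := (hσ _ _).1 (hg' (-n) y (by change y ∈ gM.comp (- -n); rwa [neg_neg]))
    rwa [neg_neg] at this
  · change σ (g (i x)) = f x
    rw [hgi]
    exact σ.apply_symm_apply (f x)

end Transfer

/-! ### An obstruction to graded self-injectivity -/

section NonInjective

variable {R : Type u} [NonUnitalRing R] {𝒜 : ℤ → AddSubgroup R}

/-- A graded left ideal `I` with `R I = I` as a graded module. -/
noncomputable def idealModule (hint : DirectSum.IsInternal 𝒜)
    (hmul : ∀ {m n : ℤ} {a x : R}, a ∈ 𝒜 m → x ∈ 𝒜 n → a * x ∈ 𝒜 (m + n))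
    (I : AddSubgroup R) (hI : IsGradedLeftIdeal 𝒜 I)
    (hun : ∀ x ∈ I, x ∈ AddSubgroup.closure {y : R | ∃ a, ∃ x ∈ I, y = a * x}) :
    GradedModule 𝒜 I where
  act :=
    { toFun := fun a => (AddMonoidHom.mulLeft a).restrict
        (show Set.MapsTo _ (I : Set R) (I : Set R) from fun x hx => hI.1 a x hx)
      map_mul' := fun a b => by ext x; exact mul_assoc a b x
      map_zero' := by ext x; exact zero_mul (x : R)
      map_add' := fun a b => by ext x; exact add_mul a b (x : R) }
  unital := by
    rw [eq_top_iff]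
    rintro ⟨x, hx⟩ -
    have key : ∀ y ∈ AddSubgroup.closure {y : R | ∃ a, ∃ x ∈ I, y = a * x}, ∃ hy : y ∈ I,
        (⟨y, hy⟩ : I) ∈ AddSubgroup.closure {y : I | ∃ (a : R) (x : I),
          y = ⟨a * x, hI.1 a x x.2⟩} := by
      intro y hy
      induction hy using AddSubgroup.closure_induction with
      | mem y hy =>
        obtain ⟨a, x, hx, rfl⟩ := hy
        exact ⟨hI.1 a x hx, AddSubgroup.subset_closure ⟨a, ⟨x, hx⟩, rfl⟩⟩
      | zero => exact ⟨zero_mem _, zero_mem _⟩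
      | add y z _ _ hy hz =>
        obtain ⟨hy, hy'⟩ := hy
        obtain ⟨hz, hz'⟩ := hz
        exact ⟨add_mem hy hz, add_mem hy' hz'⟩
      | neg y _ hy =>
        obtain ⟨hy, hy'⟩ := hy
        exact ⟨neg_mem hy, neg_mem hy'⟩
    exact (key x (hun x hx)).2
  comp n := (𝒜 n).comap I.subtype
  isInternal := by
    have hproj := (le_iSup_inf_iff hint I).1 hI.2
    refine isInternal_of_projections
      (fun n => (proj hint n).restrict
        (show Set.MapsTo _ (I : Set R) (I : Set R) from fun x hx => hproj n x hx)) ?_ ?_ ?_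
    · intro n x hx
      exact Subtype.ext (proj_same hint hx)
    · intro m n hmn x hx
      refine Subtype.ext ?_
      exact (proj_coe hint (x := (x : R)) hx m).trans (if_neg hmn)
    · rw [eq_top_iff]
      rintro ⟨x, hx⟩ -
      have key : ∀ y ∈ ⨆ n, I ⊓ 𝒜 n, ∃ hy : y ∈ I,
          (⟨y, hy⟩ : I) ∈ ⨆ n, (𝒜 n).comap I.subtype := by
        intro y hy
        refine AddSubgroup.iSup_induction _ (C := fun y => ∃ hy : y ∈ I,
          (⟨y, hy⟩ : I) ∈ ⨆ n, (𝒜 n).comap I.subtype) hy ?_ ?_ ?_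
        · rintro n y ⟨hy, hy'⟩
          exact ⟨hy, AddSubgroup.mem_iSup_of_mem n hy'⟩
        · exact ⟨zero_mem _, zero_mem _⟩
        · rintro y z ⟨hy, hy'⟩ ⟨hz, hz'⟩
          exact ⟨add_mem hy hz, add_mem hy' hz'⟩
      exact (key x (hI.2 hx)).2
  act_mem ha hx := hmul ha hx

/-- A graded left self-injective algebra does not contain an infinite family of orthogonal
homogeneous idempotents below an idempotent, such that for each element `b` of degree `0` almost
all the elements `u b u` are the same multiple of `u`. -/
theorem not_isLeftSelfInjective {K : Type w} [Field K] [Module K R]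
    (hint : DirectSum.IsInternal 𝒜)
    (hmul : ∀ {m n : ℤ} {a x : R}, a ∈ 𝒜 m → x ∈ 𝒜 n → a * x ∈ 𝒜 (m + n))
    (hun : AddSubgroup.closure {y : R | ∃ a x : R, y = a * x} = ⊤)
    {D : Type*} [Infinite D] (u : D → R) (hu : ∀ d, u d ∈ 𝒜 0) (idem : ∀ d, u d * u d = u d)
    (orth : ∀ d d', d ≠ d' → u d * u d' = 0) (hne : ∀ d, u d ≠ 0) (v : R) (hv : v ∈ 𝒜 0)
    (huv : ∀ d, u d * v = u d)
    (hb : ∀ b ∈ 𝒜 0, ∃ k : K, ∀ᶠ d in Filter.cofinite, u d * b * u d = k • u d) :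
    ¬ IsLeftSelfInjective 𝒜 := by
  classical
  intro h
  -- The even and the odd terms of a sequence of distinct indices.
  obtain ⟨S, hS, hS'⟩ : ∃ S : Set D, S.Infinite ∧ Sᶜ.Infinite := by
    let φ := Infinite.natEmbedding D
    refine ⟨Set.range fun n => φ (2 * n), Set.infinite_range_of_injective ?_,
      (Set.infinite_range_of_injective (f := fun n => φ (2 * n + 1)) ?_).mono ?_⟩
    · intro m n hmn
      have := φ.injective hmn
      omega
    · intro m n hmn
      have := φ.injective hmn
      omega
    · rintro _ ⟨n, rfl⟩ ⟨m, hm⟩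
      have := φ.injective hm
      omega
  -- The map to be extended is `x ↦ ∑ x * e d`. It is the identity on `R (u d)` for `d ∈ S` and zero
  -- on the other `R (u d)`.
  let e : D → R := fun d => if d ∈ S then u d else 0
  have he : ∀ d, e d ∈ 𝒜 0 := by
    intro d
    by_cases hd : d ∈ S
    · simpa [e, hd] using hu d
    · simp [e, hd]
  have hue : ∀ d d', d ≠ d' → u d * e d' = 0 := by
    intro d d' hd
    by_cases hd' : d' ∈ S
    · simpa [e, hd'] using orth d d' hd
    · simp [e, hd']
  have hue' : ∀ d, u d * e d = e d := by
    intro d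
    by_cases hd : d ∈ S
    · simpa [e, hd] using idem d
    · simp [e, hd]
  let I : AddSubgroup R := AddSubgroup.closure {y | ∃ a d, y = a * u d}
  have huI : ∀ d, u d ∈ I := fun d => AddSubgroup.subset_closure ⟨u d, d, (idem d).symm⟩
  have hI : IsGradedLeftIdeal 𝒜 I := by
    constructor
    · intro a x hx
      induction hx using AddSubgroup.closure_induction with
      | mem y hy =>
        obtain ⟨b, d, rfl⟩ := hy
        exact AddSubgroup.subset_closure ⟨a * b, d, (mul_assoc _ _ _).symm⟩
      | zero => rw [mul_zero]; exact zero_mem _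
      | add y z _ _ hy hz => rw [mul_add]; exact add_mem hy hz
      | neg y _ hy => rw [mul_neg]; exact neg_mem hy
    · refine (AddSubgroup.closure_le _).2 ?_
      rintro _ ⟨a, d, rfl⟩
      refine homogeneous_induction hint (p := fun a => a * u d ∈ ⨆ n, I ⊓ 𝒜 n) a ?_ ?_ ?_
      · intro n a ha
        refine AddSubgroup.mem_iSup_of_mem (n + 0) ⟨?_, hmul ha (hu d)⟩
        exact AddSubgroup.subset_closure ⟨a, d, rfl⟩
      · rw [zero_mul]; exact zero_mem _
      · intro a b ha hb
        rw [add_mul]; exact add_mem ha hb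
  have hfin : ∀ x ∈ I, (Function.support fun d => x * e d).Finite := by
    intro x hx
    induction hx using AddSubgroup.closure_induction with
    | mem y hy =>
      obtain ⟨b, d, rfl⟩ := hy
      refine (Set.finite_singleton d).subset fun d' hd' => ?_
      by_contra hne
      exact hd' (by change b * u d * e d' = 0; rw [mul_assoc, hue _ _ (Ne.symm hne), mul_zero])
    | zero => simp
    | add y z _ _ hy hz =>
      simp only [add_mul]
      exact (hy.union hz).subset (Function.support_add _ _)
    | neg y _ hy =>
      simp only [neg_mul]
      rwa [Function.support_fun_neg]
  let f : I →+ R :=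
    { toFun := fun x => ∑ᶠ d, (x : R) * e d
      map_zero' := by simp
      map_add' := fun x y => by
        rw [← finsum_add_distrib (hfin x x.2) (hfin y y.2)]
        simp only [AddSubgroup.coe_add, add_mul] }
  let gI := idealModule hint hmul I hI fun x hx => by
    refine AddSubgroup.closure_mono ?_ hx
    rintro _ ⟨a, d, rfl⟩
    exact ⟨a, u d, huI d, rfl⟩
  obtain ⟨g, hg, hg', hgf⟩ := h I R gI (regular hint hmul hun) I.subtype f
    Subtype.val_injective (fun a x => rfl) (fun n x hx => hx)
    (fun a x => by
      change ∑ᶠ d, a * (x : R) * e d = a * ∑ᶠ d, (x : R) * e d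
      refine Eq.trans ?_ ((AddMonoidHom.mulLeft a).map_finsum (hfin x x.2)).symm
      simp only [mul_assoc]
      rfl)
    (fun n x hx => by
      refine finsum_induction (fun y => y ∈ 𝒜 n) (zero_mem _) (fun _ _ => add_mem) fun d => ?_
      have := hmul (show (x : R) ∈ 𝒜 n from hx) (he d)
      rwa [add_zero] at this)
  -- As `u d = u d * v`, the extension `g` is determined on `u d` by `g v`: one has `e d = g (u d) =
  -- u d * g v`.
  have hgv : ∀ d, u d * g v * u d = e d := by
    intro d
    have h1 : g (u d) = u d * g v := by
      conv_lhs => rw [← huv d]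
      exact hg (u d) v
    have h2 : g (u d) = e d := by
      refine (hgf ⟨u d, huI d⟩).trans ?_
      change ∑ᶠ d', u d * e d' = e d
      rw [finsum_eq_single _ d fun d' hd' => hue _ _ hd'.symm, hue']
    rw [← h1, h2]
    by_cases hd : d ∈ S
    · simpa [e, hd] using idem d
    · simp [e, hd]
  -- Almost all `e d` are the same multiple `k • u d`. An index outside `S` gives `k = 0`, and then
  -- an index in `S` gives `u d = 0`.
  obtain ⟨k, hk⟩ := hb (g v) (hg' 0 v hv)
  have hk' : {d | ¬ u d * g v * u d = k • u d}.Finite := hk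
  obtain ⟨d, hd, hd'⟩ := (hS.sdiff hk').nonempty
  obtain ⟨d₁, hd₁, hd₁'⟩ := (hS'.sdiff hk').nonempty
  simp only [Set.mem_ofPred_eq, not_not, hgv] at hd' hd₁'
  have h1 : e d₁ = 0 := if_neg hd₁
  have h2 : e d = u d := if_pos hd
  rw [h1, eq_comm, smul_eq_zero, or_iff_left (hne d₁)] at hd₁'
  rw [h2, hd₁', zero_smul] at hd'
  exact hne d hd'

end NonInjective

end GradedRingTheory

/-! ### Concatenation of paths -/

namespace DirGraph

variable {V : Type u} {E : Type v} {G : DirGraph V E}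

theorem IsPath.append {a b c : V} {l m : List E} (hl : G.IsPath a l b) (hm : G.IsPath b m c) :
    G.IsPath a (l ++ m) c := by
  induction l generalizing a with
  | nil => cases hl; exact hm
  | cons e l ih => exact ⟨hl.1, ih hl.2⟩

theorem isPath_append {a c : V} {l m : List E} :
    G.IsPath a (l ++ m) c ↔ ∃ b, G.IsPath a l b ∧ G.IsPath b m c := by
  constructor
  · intro h
    induction l generalizing a with
    | nil => exact ⟨a, rfl, h⟩
    | cons e l ih =>
      obtain ⟨b, hb, hb'⟩ := ih h.2
      exact ⟨b, ⟨h.1, hb⟩, hb'⟩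
  · rintro ⟨b, hb, hb'⟩
    exact hb.append hb'

theorem IsPath.finish_unique {a b c : V} {l : List E} (h : G.IsPath a l b) (h' : G.IsPath a l c) :
    b = c := by
  induction l generalizing a with
  | nil => exact h.symm.trans h'
  | cons e l ih => exact ih h.2 h'.2

end DirGraph

/-! ### The universal property of the algebra and its consequences -/

namespace Leavitt

section Universal

variable {K : Type w} [Field K] {V : Type u} {E : Type v} {G : DirGraph V E}

/-- A family of elements of a unital algebra which satisfies the defining relations of the
Leavitt path algebra. -/
structure IsFamily (G : DirGraph V E) {A : Type*} [Semiring A] (f : LeavittGen V E → A) :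
    Prop where
  idem (a : V) : f (.vert a) * f (.vert a) = f (.vert a)
  orth (a b : V) : a ≠ b → f (.vert a) * f (.vert b) = 0
  src_edge (e : E) : f (.vert (G.src e)) * f (.edge e) = f (.edge e)
  edge_rng (e : E) : f (.edge e) * f (.vert (G.rng e)) = f (.edge e)
  rng_ghost (e : E) : f (.vert (G.rng e)) * f (.ghost e) = f (.ghost e)
  ghost_src (e : E) : f (.ghost e) * f (.vert (G.src e)) = f (.ghost e)
  ck1_eq (e : E) : f (.ghost e) * f (.edge e) = f (.vert (G.rng e))
  ck1_ne (e e' : E) : e ≠ e' → f (.ghost e) * f (.edge e') = 0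
  ck2 (a : V) (hfin : {e : E | G.src e = a}.Finite) (hne : {e : E | G.src e = a}.Nonempty) :
    f (.vert a) = ∑ e ∈ hfin.toFinset, f (.edge e) * f (.ghost e)

variable (K G) in
theorem isFamily_gen : IsFamily G (gen K G) where
  idem a := by simpa [gen, fv] using RingQuot.mkAlgHom_rel K (Rel.idem (K := K) (G := G) a)
  orth a b h := by simpa [gen, fv] using RingQuot.mkAlgHom_rel K (Rel.orth (K := K) (G := G) a b h)
  src_edge e := by
    simpa [gen, fv, fe] using RingQuot.mkAlgHom_rel K (Rel.src_edge (K := K) (G := G) e)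
  edge_rng e := by
    simpa [gen, fv, fe] using RingQuot.mkAlgHom_rel K (Rel.edge_rng (K := K) (G := G) e)
  rng_ghost e := by
    simpa [gen, fv, fg] using RingQuot.mkAlgHom_rel K (Rel.rng_ghost (K := K) (G := G) e)
  ghost_src e := by
    simpa [gen, fv, fg] using RingQuot.mkAlgHom_rel K (Rel.ghost_src (K := K) (G := G) e)
  ck1_eq e := by
    simpa [gen, fv, fe, fg] using RingQuot.mkAlgHom_rel K (Rel.ck1_eq (K := K) (G := G) e)
  ck1_ne e e' h := by
    simpa [gen, fe, fg] using RingQuot.mkAlgHom_rel K (Rel.ck1_ne (K := K) (G := G) e e' h)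
  ck2 a h h' := by
    simpa [gen, fv, fe, fg] using RingQuot.mkAlgHom_rel K (Rel.ck2 (K := K) (G := G) a h h')

/-- The universal property of the Leavitt path algebra. -/
noncomputable def lift {A : Type*} [Semiring A] [Algebra K A] (f : LeavittGen V E → A)
    (hf : IsFamily G f) : Unital K G →ₐ[K] A :=
  RingQuot.liftAlgHom K ⟨FreeAlgebra.lift K f, by
    intro x y h
    cases h with
    | idem a => simpa [fv] using hf.idem a
    | orth a b h => simpa [fv] using hf.orth a b h
    | src_edge e => simpa [fv, fe] using hf.src_edge e
    | edge_rng e => simpa [fv, fe] using hf.edge_rng e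
    | rng_ghost e => simpa [fv, fg] using hf.rng_ghost e
    | ghost_src e => simpa [fv, fg] using hf.ghost_src e
    | ck1_eq e => simpa [fv, fe, fg] using hf.ck1_eq e
    | ck1_ne e e' h => simpa [fe, fg] using hf.ck1_ne e e' h
    | ck2 a h h' => simpa [fv, fe, fg] using hf.ck2 a h h'⟩

theorem lift_gen {A : Type*} [Semiring A] [Algebra K A] (f : LeavittGen V E → A)
    (hf : IsFamily G f) (x : LeavittGen V E) : lift (K := K) f hf (gen K G x) = f x := by
  rw [lift, gen, RingQuot.liftAlgHom_mkAlgHom_apply, FreeAlgebra.lift_ι_apply]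

theorem algHom_ext {A : Type*} [Semiring A] [Algebra K A] {φ ψ : Unital K G →ₐ[K] A}
    (h : ∀ x, φ (gen K G x) = ψ (gen K G x)) : φ = ψ :=
  RingQuot.ringQuot_ext' K _ _ (FreeAlgebra.hom_ext (funext h))

end Universal

section Basic

variable (K : Type w) [Field K] {V : Type u} {E : Type v} (G : DirGraph V E)

/-- A vertex in the unitization of the Leavitt path algebra. -/
abbrev vt (a : V) : Unital K G := gen K G (.vert a)
/-- An edge in the unitization of the Leavitt path algebra. -/
abbrev ed (e : E) : Unital K G := gen K G (.edge e)
/-- A ghost edge in the unitization of the Leavitt path algebra. -/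
abbrev gh (e : E) : Unital K G := gen K G (.ghost e)

/-! ### The grading -/

/-- The coaction which records the degree. -/
noncomputable def coaction : Unital K G →ₐ[K] AddMonoidAlgebra (Unital K G) ℤ :=
  lift (fun x => match x with
    | .vert a => .single 0 (vt K G a)
    | .edge e => .single 1 (ed K G e)
    | .ghost e => .single (-1) (gh K G e))
    { idem := fun a => by rw [AddMonoidAlgebra.single_mul_single, (isFamily_gen K G).idem]; rfl
      orth := fun a b h => by
        rw [AddMonoidAlgebra.single_mul_single, (isFamily_gen K G).orth a b h,
          AddMonoidAlgebra.single_zero]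
      src_edge := fun e => by
        rw [AddMonoidAlgebra.single_mul_single, (isFamily_gen K G).src_edge]; rfl
      edge_rng := fun e => by
        rw [AddMonoidAlgebra.single_mul_single, (isFamily_gen K G).edge_rng]; rfl
      rng_ghost := fun e => by
        rw [AddMonoidAlgebra.single_mul_single, (isFamily_gen K G).rng_ghost]; rfl
      ghost_src := fun e => by
        rw [AddMonoidAlgebra.single_mul_single, (isFamily_gen K G).ghost_src]; rfl
      ck1_eq := fun e => by
        rw [AddMonoidAlgebra.single_mul_single, (isFamily_gen K G).ck1_eq]; rfl
      ck1_ne := fun e e' h => by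
        rw [AddMonoidAlgebra.single_mul_single, (isFamily_gen K G).ck1_ne e e' h,
          AddMonoidAlgebra.single_zero]
      ck2 := fun a h h' => by
        simp only [AddMonoidAlgebra.single_mul_single]
        rw [vt, (isFamily_gen K G).ck2 a h h']
        exact map_sum (AddMonoidAlgebra.singleAddHom (0 : ℤ)) _ _ }

/-- The homogeneous elements of degree `n`. -/
noncomputable def homog (n : ℤ) : Submodule K (Unital K G) where
  carrier := {x | coaction K G x = .single n x}
  zero_mem' := by simp
  add_mem' {x y} hx hy := by
    change coaction K G (x + y) = .single n (x + y)
    rw [map_add, hx, hy, AddMonoidAlgebra.single_add]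
  smul_mem' k x hx := by
    change coaction K G (k • x) = .single n (k • x)
    rw [map_smul, hx, AddMonoidAlgebra.smul_single]

variable {K G}

theorem mem_homog {n : ℤ} {x : Unital K G} : x ∈ homog K G n ↔ coaction K G x = .single n x :=
  Iff.rfl

theorem mul_mem_homog {m n : ℤ} {x y : Unital K G} (hx : x ∈ homog K G m)
    (hy : y ∈ homog K G n) : x * y ∈ homog K G (m + n) := by
  rw [mem_homog] at *
  rw [map_mul, hx, hy, AddMonoidAlgebra.single_mul_single]

theorem coeff_of_mem_homog {n : ℤ} {x : Unital K G} (hx : x ∈ homog K G n) (m : ℤ) :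
    (coaction K G x).coeff m = if m = n then x else 0 := by
  rw [mem_homog.1 hx, AddMonoidAlgebra.coeff_single, Finsupp.single_apply]
  simp only [eq_comm]

theorem eq_zero_of_mem_homog {m n : ℤ} (hmn : m ≠ n) {x : Unital K G} (hx : x ∈ homog K G m)
    (hx' : x ∈ homog K G n) : x = 0 := by
  have h := coeff_of_mem_homog hx m
  rw [coeff_of_mem_homog hx', if_neg hmn, if_pos rfl] at h
  exact h.symm

variable (K G)

theorem vt_mem_homog (a : V) : vt K G a ∈ homog K G 0 := lift_gen _ _ _

theorem ed_mem_homog (e : E) : ed K G e ∈ homog K G 1 := lift_gen _ _ _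

theorem gh_mem_homog (e : E) : gh K G e ∈ homog K G (-1) := lift_gen _ _ _

theorem pathElt_mem_homog (a : V) (l : List E) : pathElt K G a l ∈ homog K G l.length := by
  induction l generalizing a with
  | nil => exact vt_mem_homog K G a
  | cons e l ih =>
    have := mul_mem_homog (ed_mem_homog K G e) (ih (G.rng e))
    rwa [add_comm] at this

theorem ghostElt_mem_homog (a : V) (l : List E) : ghostElt K G a l ∈ homog K G (-l.length) := by
  induction l generalizing a with
  | nil => exact vt_mem_homog K G a
  | cons e l ih =>
    have := mul_mem_homog (ih (G.rng e)) (gh_mem_homog K G e)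
    rw [← neg_add] at this
    exact_mod_cast this

/-! ### The involution -/

/-- The involution exchanging edges and ghost edges, as a homomorphism to the opposite algebra. -/
noncomputable def starHom : Unital K G →ₐ[K] (Unital K G)ᵐᵒᵖ :=
  lift (fun x => MulOpposite.op (match x with
    | .vert a => vt K G a
    | .edge e => gh K G e
    | .ghost e => ed K G e))
    { idem := fun a => by rw [← MulOpposite.op_mul, (isFamily_gen K G).idem]
      orth := fun a b h => by
        rw [← MulOpposite.op_mul, (isFamily_gen K G).orth b a h.symm, MulOpposite.op_zero]
      src_edge := fun e => by rw [← MulOpposite.op_mul, (isFamily_gen K G).ghost_src]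
      edge_rng := fun e => by rw [← MulOpposite.op_mul, (isFamily_gen K G).rng_ghost]
      rng_ghost := fun e => by rw [← MulOpposite.op_mul, (isFamily_gen K G).edge_rng]
      ghost_src := fun e => by rw [← MulOpposite.op_mul, (isFamily_gen K G).src_edge]
      ck1_eq := fun e => by rw [← MulOpposite.op_mul, (isFamily_gen K G).ck1_eq]
      ck1_ne := fun e e' h => by
        rw [← MulOpposite.op_mul, (isFamily_gen K G).ck1_ne e' e h.symm, MulOpposite.op_zero]
      ck2 := fun a h h' => by
        simp only [← MulOpposite.op_mul]
        rw [vt, (isFamily_gen K G).ck2 a h h']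
        exact map_sum (MulOpposite.opAddEquiv : Unital K G ≃+ _) _ _ }

variable {K G}

/-- The involution `x ↦ x*` exchanging edges and ghost edges. -/
noncomputable def str (x : Unital K G) : Unital K G := (starHom K G x).unop

theorem str_mul (x y : Unital K G) : str (x * y) = str y * str x := by
  rw [str, map_mul, MulOpposite.unop_mul]; rfl

theorem str_zero : str (0 : Unital K G) = 0 := by
  rw [str, map_zero]; rfl

theorem str_vt (a : V) : str (vt K G a) = vt K G a := by
  rw [str, starHom, lift_gen]; rfl

theorem str_ed (e : E) : str (ed K G e) = gh K G e := by
  rw [str, starHom, lift_gen]; rfl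

theorem str_gh (e : E) : str (gh K G e) = ed K G e := by
  rw [str, starHom, lift_gen]; rfl

theorem str_str (x : Unital K G) : str (str x) = x := by
  have : ((starHom K G).op.comp ((starHom K G))) =
      (AlgEquiv.opOp K (Unital K G) : Unital K G →ₐ[K] (Unital K G)ᵐᵒᵖᵐᵒᵖ) := by
    refine algHom_ext fun x => ?_
    cases x with
    | vert a =>
      change MulOpposite.op (starHom K G (str (vt K G a))) = _
      rw [str_vt]
      change MulOpposite.op (MulOpposite.op (str (vt K G a))) = _
      rw [str_vt]; rfl
    | edge a =>
      change MulOpposite.op (starHom K G (str (ed K G a))) = _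
      rw [str_ed]
      change MulOpposite.op (MulOpposite.op (str (gh K G a))) = _
      rw [str_gh]; rfl
    | ghost a =>
      change MulOpposite.op (starHom K G (str (gh K G a))) = _
      rw [str_gh]
      change MulOpposite.op (MulOpposite.op (str (ed K G a))) = _
      rw [str_ed]; rfl
  exact congrArg (fun y => y.unop.unop) (DFunLike.congr_fun this x)

theorem str_pathElt (a : V) (l : List E) : str (pathElt K G a l) = ghostElt K G a l := by
  induction l generalizing a with
  | nil => exact str_vt a
  | cons e l ih => rw [pathElt, ghostElt, str_mul, str_ed, ih]

theorem str_ghostElt (a : V) (l : List E) : str (ghostElt K G a l) = pathElt K G a l := by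
  rw [← str_pathElt, str_str]

/-! ### Products of paths and ghost paths -/

theorem vt_mul_pathElt {a b : V} {l : List E} (h : G.IsPath a l b) :
    vt K G a * pathElt K G a l = pathElt K G a l := by
  cases l with
  | nil => exact (isFamily_gen K G).idem a
  | cons e l =>
    obtain ⟨rfl, -⟩ := h
    rw [pathElt, ← mul_assoc, (isFamily_gen K G).src_edge]

theorem vt_mul_pathElt_of_ne {a b c : V} {l : List E} (h : G.IsPath a l b) (hc : c ≠ a) :
    vt K G c * pathElt K G a l = 0 := by
  rw [← vt_mul_pathElt h, ← mul_assoc, (isFamily_gen K G).orth c a hc, zero_mul]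

theorem pathElt_mul_vt {a b : V} {l : List E} (h : G.IsPath a l b) :
    pathElt K G a l * vt K G b = pathElt K G a l := by
  induction l generalizing a with
  | nil => cases h; exact (isFamily_gen K G).idem _
  | cons e l ih => rw [pathElt, mul_assoc, ih h.2]

theorem pathElt_append {a b c : V} {l m : List E} (hl : G.IsPath a l b) (hm : G.IsPath b m c) :
    pathElt K G a (l ++ m) = pathElt K G a l * pathElt K G b m := by
  induction l generalizing a with
  | nil => cases hl; exact (vt_mul_pathElt hm).symm
  | cons e l ih => rw [List.cons_append, pathElt, pathElt, mul_assoc, ih hl.2]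

theorem pathElt_singleton (a : V) (e : E) : pathElt K G a [e] = ed K G e :=
  (isFamily_gen K G).edge_rng e

theorem ghostElt_singleton (a : V) (e : E) : ghostElt K G a [e] = gh K G e :=
  (isFamily_gen K G).rng_ghost e

theorem vt_mul_ghostElt {a b : V} {l : List E} (h : G.IsPath a l b) :
    vt K G b * ghostElt K G a l = ghostElt K G a l := by
  rw [← str_pathElt, ← str_vt, ← str_mul, pathElt_mul_vt h]

theorem ghostElt_mul_vt {a b : V} {l : List E} (h : G.IsPath a l b) :
    ghostElt K G a l * vt K G a = ghostElt K G a l := by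
  rw [← str_pathElt, ← str_vt, ← str_mul, vt_mul_pathElt h]

theorem ghostElt_append {a b c : V} {l m : List E} (hl : G.IsPath a l b) (hm : G.IsPath b m c) :
    ghostElt K G a (l ++ m) = ghostElt K G b m * ghostElt K G a l := by
  rw [← str_pathElt, pathElt_append hl hm, str_mul, str_pathElt, str_pathElt]

theorem ghostElt_mul_pathElt_append {a b c : V} {l m : List E} (hl : G.IsPath a l b)
    (hm : G.IsPath b m c) : ghostElt K G a l * pathElt K G a (l ++ m) = pathElt K G b m := by
  induction l generalizing a with
  | nil => cases hl; exact vt_mul_pathElt hm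
  | cons e l ih =>
    rw [List.cons_append, ghostElt, pathElt, mul_assoc, ← mul_assoc (gen _ _ _) (gen _ _ _),
      (isFamily_gen K G).ck1_eq, vt_mul_pathElt (hl.2.append hm), ih hl.2]

theorem ghostElt_mul_pathElt_self {a b : V} {l : List E} (hl : G.IsPath a l b) :
    ghostElt K G a l * pathElt K G a l = vt K G b := by
  have := ghostElt_mul_pathElt_append (K := K) hl (show G.IsPath b [] b from rfl)
  rwa [List.append_nil] at this

theorem ghostElt_append_mul_pathElt {a b c : V} {l m : List E} (hl : G.IsPath a l b)
    (hm : G.IsPath b m c) : ghostElt K G a (l ++ m) * pathElt K G a l = ghostElt K G b m := by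
  have := congrArg str (ghostElt_mul_pathElt_append (K := K) hl hm)
  rwa [str_mul, str_pathElt, str_pathElt, str_ghostElt] at this

/-- Incomparable paths with a common start first differ at some pair of edges. CK-1 cancels
everything before this pair and makes the pair itself zero. For different starts the vertices are
orthogonal. -/
theorem ghostElt_mul_pathElt_of_not_prefix {a b a' b' : V} {l m : List E} (hl : G.IsPath a l b)
    (hm : G.IsPath a' m b') (h : a = a' → ¬ l <+: m ∧ ¬ m <+: l) :
    ghostElt K G a l * pathElt K G a' m = 0 := by
  by_cases haa : a = a'
  · subst haa
    replace h := h rfl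
    induction l generalizing a m with
    | nil => exact absurd List.nil_prefix h.1
    | cons e l ih =>
      cases m with
      | nil => exact absurd List.nil_prefix h.2
      | cons f m =>
        rw [ghostElt, pathElt, mul_assoc, ← mul_assoc (gen _ _ _) (gen _ _ _)]
        by_cases hef : e = f
        · subst hef
          rw [(isFamily_gen K G).ck1_eq, vt_mul_pathElt hm.2]
          refine ih hl.2 hm.2 ⟨fun h' => h.1 ?_, fun h' => h.2 ?_⟩ <;>
            exact (List.prefix_cons_inj _).2 h'
        · rw [(isFamily_gen K G).ck1_ne e f hef, zero_mul, mul_zero]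
  · rw [← ghostElt_mul_vt hl, mul_assoc, vt_mul_pathElt_of_ne hm haa, mul_zero]

/-- A path on which no edge has an alternative. -/
theorem pathElt_mul_ghostElt_self {a b : V} {l : List E} (hl : G.IsPath a l b)
    (h : ∀ e ∈ l, ∀ f, G.src f = G.src e → f = e) :
    pathElt K G a l * ghostElt K G a l = vt K G a := by
  induction l generalizing a with
  | nil => exact (isFamily_gen K G).idem a
  | cons e l ih =>
    -- Only `e` leaves its source, so CK-2 reads `s(e) = e e*`.
    have hset : {f : E | G.src f = G.src e} = {e} := by
      ext f
      exact ⟨fun hf => h e List.mem_cons_self f hf, fun hf => congrArg G.src hf⟩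
    have hfin : {f : E | G.src f = G.src e}.Finite := hset ▸ Set.finite_singleton e
    have hck := (isFamily_gen K G).ck2 (G.src e) hfin ⟨e, rfl⟩
    have : hfin.toFinset = {e} := by ext f; simp [hset]
    rw [this, Finset.sum_singleton] at hck
    obtain ⟨rfl, hl⟩ := hl
    rw [pathElt, ghostElt, mul_assoc, ← mul_assoc (pathElt K G (G.rng e) l),
      ih hl fun e' he' => h e' (List.mem_cons_of_mem _ he'), (isFamily_gen K G).rng_ghost]
    exact hck.symm

end Basic

end Leavitt

/-! ### A representation in which vertices are non-zero -/

namespace DirGraph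

variable {V : Type u} {E : Type v} (G : DirGraph V E)

/-- A set `κ` with a decomposition into a disjoint union of copies of itself indexed by the edges
emitted by `a`, for each vertex `a` which is not a sink. -/
theorem exists_branching : ∃ (κ : Type v) (β : E → κ → κ), Nonempty κ ∧
    (∀ e, Function.Injective (β e)) ∧
    (∀ e e' x y, G.src e = G.src e' → β e x = β e' y → e = e') ∧
    ∀ e x, ∃ e' y, G.src e' = G.src e ∧ β e' y = x := by
  -- An infinite set at least as large as the set of edges: its product with any non-empty set of
  -- edges is equipotent to it.
  let κ := E ⊕ ULift.{v} ℕ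
  have hinf : Cardinal.aleph0 ≤ Cardinal.mk κ := by
    rw [Cardinal.aleph0_le_mk_iff]; infer_instance
  have key : ∀ e, Nonempty ({e' : E // G.src e' = G.src e} × κ ≃ κ) := by
    intro e
    rw [← Cardinal.eq, Cardinal.mk_prod, Cardinal.lift_id, Cardinal.lift_id]
    refine Cardinal.mul_eq_right hinf ?_ ?_
    · exact (Cardinal.mk_subtype_le _).trans
        (Cardinal.mk_le_of_injective (f := (Sum.inl : E → κ)) Sum.inl_injective)
    · rw [Cardinal.mk_ne_zero_iff]
      exact ⟨e, rfl⟩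
  have key' : ∀ a, ∃ B : {e' : E // G.src e' = a} × κ → κ, (∃ e, G.src e = a) →
      Function.Bijective B := by
    intro a
    by_cases h : ∃ e, G.src e = a
    · obtain ⟨e, rfl⟩ := h
      obtain ⟨B⟩ := key e
      exact ⟨B, fun _ => B.bijective⟩
    -- At a sink the choice is immaterial, because `B` is only evaluated at sources of edges.
    · exact ⟨fun _ => Sum.inr ⟨0⟩, fun h' => absurd h' h⟩
  choose B hB using key'
  have transport : ∀ (a : V) (e : E) (h : G.src e = a) (x : κ),
      B (G.src e) (⟨e, rfl⟩, x) = B a (⟨e, h⟩, x) := by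
    rintro _ e rfl x; rfl
  refine ⟨κ, fun e x => B (G.src e) (⟨e, rfl⟩, x), ⟨Sum.inr ⟨0⟩⟩, ?_, ?_, ?_⟩
  · intro e x y h
    exact congrArg Prod.snd ((hB _ ⟨e, rfl⟩).1 h)
  · intro e e' x y h hxy
    have : B (G.src e') (⟨e, h⟩, x) = B (G.src e') (⟨e', rfl⟩, y) :=
      (transport _ e h x).symm.trans hxy
    exact congrArg (fun z => z.1.1) ((hB _ ⟨e', rfl⟩).1 this)
  · intro e x
    obtain ⟨⟨⟨e', he'⟩, y⟩, hy⟩ := (hB (G.src e) ⟨e, rfl⟩).2 x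
    exact ⟨e', y, he', (transport _ e' he' y).trans hy⟩

end DirGraph

namespace Leavitt

variable (K : Type w) [Field K] {V : Type u} {E : Type v} (G : DirGraph V E)

open Classical in
-- The algebra acts on functions on `V × κ`: a vertex `a` restricts to the fibre over `a`, and an
-- edge carries the fibre over its end into the part of the fibre over its source given by `β e`.
-- These parts are disjoint for distinct edges with the same source, which is CK-1, and they fill
-- the fibre, which is CK-2.
theorem vt_ne_zero (a : V) : vt K G a ≠ 0 := by
  obtain ⟨κ, β, ⟨x₀⟩, hinj, hdisj, hcov⟩ := G.exists_branching
  let i : E → κ → V × κ := fun e y => (G.src e, β e y)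
  have hi : ∀ e, Function.Injective (i e) := fun e x y h => hinj e (congrArg Prod.snd h)
  let A : LeavittGen V E → Module.End K (V × κ → K) := fun x => match x with
    | .vert a =>
      { toFun := fun f z => if z.1 = a then f z else 0
        map_add' := fun f g => by funext z; by_cases h : z.1 = a <;> simp [h]
        map_smul' := fun k f => by funext z; by_cases h : z.1 = a <;> simp [h] }
    | .edge e => (Function.ExtendByZero.linearMap K (i e)).comp
        (LinearMap.funLeft K K fun y => (G.rng e, y))
    | .ghost e =>
      { toFun := fun f z => if z.1 = G.rng e then f (i e z.2) else 0
        map_add' := fun f g => by funext z; by_cases h : z.1 = G.rng e <;> simp [h]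
        map_smul' := fun k f => by funext z; by_cases h : z.1 = G.rng e <;> simp [h] }
  have vert_apply : ∀ a f z, A (.vert a) f z = if z.1 = a then f z else 0 := fun _ _ _ => rfl
  have ghost_apply : ∀ e f z, A (.ghost e) f z = if z.1 = G.rng e then f (i e z.2) else 0 :=
    fun _ _ _ => rfl
  have edge_apply : ∀ e f y, A (.edge e) f (i e y) = f (G.rng e, y) := fun e f y =>
    (hi e).extend_apply _ _ _
  have edge_apply' : ∀ e f z, (¬ ∃ y, i e y = z) → A (.edge e) f z = 0 := fun e f z h =>
    Function.extend_apply' _ _ _ h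
  have hA : IsFamily G A := by
    constructor
    · intro a; ext f z
      rw [Module.End.mul_apply, vert_apply, vert_apply]
      split_ifs <;> rfl
    · intro a b h; ext f z
      rw [Module.End.mul_apply, vert_apply, vert_apply]
      split_ifs with h1 h2
      · exact absurd (h1.symm.trans h2) h
      · rfl
      · rfl
    · intro e; ext f z
      rw [Module.End.mul_apply, vert_apply]
      split_ifs with h
      · rfl
      · refine (edge_apply' e f z ?_).symm
        rintro ⟨y, rfl⟩
        exact h rfl
    · intro e; ext f z
      rw [Module.End.mul_apply]
      by_cases h : ∃ y, i e y = z
      · obtain ⟨y, rfl⟩ := h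
        rw [edge_apply, edge_apply, vert_apply, if_pos rfl]
      · rw [edge_apply' _ _ _ h, edge_apply' _ _ _ h]
    · intro e; ext f z
      rw [Module.End.mul_apply, vert_apply, ghost_apply]
      split_ifs <;> rfl
    · intro e; ext f z
      rw [Module.End.mul_apply, ghost_apply, ghost_apply, vert_apply, if_pos rfl]
    · intro e; ext f ⟨w, x⟩
      rw [Module.End.mul_apply, ghost_apply, vert_apply, edge_apply]
      dsimp only
      split_ifs with h
      · rw [h]
      · rfl
    · intro e e' h; ext f z
      rw [Module.End.mul_apply, ghost_apply]
      split_ifs with h1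
      · rw [edge_apply']
        · rfl
        · rintro ⟨y, hy⟩
          exact h (hdisj _ _ _ _ (congrArg Prod.fst hy) (congrArg Prod.snd hy)).symm
      · rfl
    · intro a hfin hne; ext f ⟨w, x⟩
      rw [LinearMap.sum_apply, Finset.sum_apply, vert_apply]
      split_ifs with h
      · obtain ⟨e, he⟩ := hne
        -- The point lies in the part belonging to exactly one edge, and only this edge contributes
        -- to the sum.
        obtain ⟨e', y, he', rfl⟩ := hcov e x
        dsimp only at h
        have hw : (w, β e' y) = i e' y := by
          change _ = (G.src e', β e' y)
          rw [he', h, ← he]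
        rw [hw, Finset.sum_eq_single e', Module.End.mul_apply, edge_apply, ghost_apply, if_pos rfl]
        · intro e'' _ hne
          rw [Module.End.mul_apply, edge_apply']
          rintro ⟨y', hy'⟩
          exact hne (hdisj _ _ _ _ (congrArg Prod.fst hy') (congrArg Prod.snd hy'))
        · intro hmem
          exact absurd (hfin.mem_toFinset.2 (he'.trans he)) hmem
      · refine (Finset.sum_eq_zero fun e he => ?_).symm
        rw [Module.End.mul_apply, edge_apply']
        rintro ⟨y, hy⟩
        exact h ((congrArg Prod.fst hy).symm.trans (hfin.mem_toFinset.1 he))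
  intro h0
  have h1 := congrArg (lift (K := K) A hA) h0
  rw [lift_gen, map_zero] at h1
  -- A vertex does not kill the constant function `1`, as its value over `a` shows.
  have h2 := congrFun (DFunLike.congr_fun h1 (fun _ => (1 : K))) (a, x₀)
  rw [vert_apply, if_pos rfl] at h2
  exact one_ne_zero h2

variable {K G}

theorem smul_vt_eq_zero {k : K} {a : V} : k • vt K G a = 0 ↔ k = 0 := by
  rw [smul_eq_zero, or_iff_left (vt_ne_zero K G a)]

/-! ### The spanning set of products of paths and ghost paths -/

variable (K G)

/-- The products of a path and a ghost path. -/
def monomials : Set (Unital K G) :=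
  {x | ∃ p q : G.FinPath, p.finish = q.finish ∧
    x = pathElt K G p.start p.edges * ghostElt K G q.start q.edges}

/-- An edge lengthens the path `α` in `αβ*` and a ghost edge shortens it by CK-1; if `α` is a
vertex, the ghost edge is absorbed into `β*` instead. Otherwise the product is zero. -/
theorem gen_mul_mem_span (g : LeavittGen V E) {x : Unital K G} (hx : x ∈ monomials K G) :
    gen K G g * x ∈ Submodule.span K (monomials K G) := by
  obtain ⟨p, q, hpq, rfl⟩ := hx
  rw [← mul_assoc]
  cases g with
  | vert c =>
    by_cases hc : c = p.start
    · rw [hc, vt_mul_pathElt p.isPath]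
      exact Submodule.subset_span ⟨p, q, hpq, rfl⟩
    · rw [vt_mul_pathElt_of_ne p.isPath hc, zero_mul]
      exact zero_mem _
  | edge e =>
    by_cases he : G.rng e = p.start
    · refine Submodule.subset_span
        ⟨⟨G.src e, e :: p.edges, p.finish, rfl, he ▸ p.isPath⟩, q, hpq, ?_⟩
      rw [pathElt, he]
    · rw [← (isFamily_gen K G).edge_rng, mul_assoc (gen K G _) (gen K G _),
        vt_mul_pathElt_of_ne p.isPath he, mul_zero, zero_mul]
      exact zero_mem _
  | ghost e =>
    obtain ⟨a, l, b, h⟩ := p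
    cases l with
    | nil =>
      dsimp only at hpq h ⊢
      cases h
      by_cases he : G.src e = a
      · refine Submodule.subset_span ⟨⟨G.rng e, [], G.rng e, rfl⟩,
          ⟨q.start, q.edges ++ [e], G.rng e, q.isPath.append ⟨?_, rfl⟩⟩, rfl, ?_⟩
        · rw [← hpq, he]
        · have hq : G.IsPath q.finish [e] (G.rng e) := ⟨by rw [← hpq, he], rfl⟩
          dsimp only
          rw [pathElt, pathElt, ← he, (isFamily_gen K G).ghost_src,
            vt_mul_ghostElt (q.isPath.append hq), ghostElt_append q.isPath hq, ghostElt_singleton]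
      · rw [pathElt, ← (isFamily_gen K G).ghost_src, mul_assoc (gen K G _) (gen K G _),
          (isFamily_gen K G).orth _ _ he, mul_zero, zero_mul]
        exact zero_mem _
    | cons f l =>
      dsimp only at hpq ⊢
      rw [pathElt, ← mul_assoc (gen K G _)]
      by_cases hef : e = f
      · subst hef
        rw [(isFamily_gen K G).ck1_eq, vt_mul_pathElt h.2]
        exact Submodule.subset_span ⟨⟨G.rng e, l, b, h.2⟩, q, hpq, rfl⟩
      · rw [(isFamily_gen K G).ck1_ne e f hef, zero_mul, zero_mul]
        exact zero_mem _

theorem gen_mem_span (g : LeavittGen V E) : gen K G g ∈ Submodule.span K (monomials K G) := by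
  have key : ∀ a, gen K G g * vt K G a = gen K G g →
      gen K G g ∈ Submodule.span K (monomials K G) := by
    intro a ha
    rw [← ha]
    refine gen_mul_mem_span K G g ⟨⟨a, [], a, rfl⟩, ⟨a, [], a, rfl⟩, rfl, ?_⟩
    exact ((isFamily_gen K G).idem a).symm
  cases g with
  | vert a => exact key a ((isFamily_gen K G).idem a)
  | edge e => exact key _ ((isFamily_gen K G).edge_rng e)
  | ghost e => exact key _ ((isFamily_gen K G).ghost_src e)

theorem gen_mul_mem_span' (g : LeavittGen V E) {x : Unital K G}
    (hx : x ∈ Submodule.span K (monomials K G)) :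
    gen K G g * x ∈ Submodule.span K (monomials K G) := by
  induction hx using Submodule.span_induction with
  | mem x hx => exact gen_mul_mem_span K G g hx
  | zero => rw [mul_zero]; exact zero_mem _
  | add x y _ _ hx hy => rw [mul_add]; exact add_mem hx hy
  | smul k x _ hx => rw [mul_smul_comm]; exact Submodule.smul_mem _ k hx

theorem mem_span_of_mem_algebra {x : Unital K G} (hx : x ∈ algebra K G) :
    x ∈ Submodule.span K (monomials K G) := by
  -- Membership alone is not preserved by products in an evident way; stability of the span under
  -- left multiplication by `x` is proved along with it.
  have key : x ∈ Submodule.span K (monomials K G) ∧ ∀ y ∈ Submodule.span K (monomials K G),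
      x * y ∈ Submodule.span K (monomials K G) := by
    induction hx using NonUnitalAlgebra.adjoin_induction with
    | mem x hx =>
      obtain ⟨g, rfl⟩ := hx
      exact ⟨gen_mem_span K G g, fun y hy => gen_mul_mem_span' K G g hy⟩
    | zero => exact ⟨zero_mem _, fun y _ => by rw [zero_mul]; exact zero_mem _⟩
    | add x y _ _ hx hy =>
      exact ⟨add_mem hx.1 hy.1, fun z hz => by
        rw [add_mul]; exact add_mem (hx.2 z hz) (hy.2 z hz)⟩
    | smul k x _ hx =>
      exact ⟨Submodule.smul_mem _ k hx.1, fun z hz => by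
        rw [smul_mul_assoc]; exact Submodule.smul_mem _ k (hx.2 z hz)⟩
    | mul x y _ _ hx hy =>
      exact ⟨hx.2 y hy.1, fun z hz => by rw [mul_assoc]; exact hx.2 _ (hy.2 z hz)⟩
  exact key.1

theorem gen_mem_algebra (g : LeavittGen V E) : gen K G g ∈ algebra K G :=
  NonUnitalAlgebra.subset_adjoin K ⟨g, rfl⟩

theorem pathElt_mem_algebra (a : V) (l : List E) : pathElt K G a l ∈ algebra K G := by
  induction l generalizing a with
  | nil => exact gen_mem_algebra K G _
  | cons e l ih => exact mul_mem (gen_mem_algebra K G _) (ih _)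

theorem ghostElt_mem_algebra (a : V) (l : List E) : ghostElt K G a l ∈ algebra K G := by
  induction l generalizing a with
  | nil => exact gen_mem_algebra K G _
  | cons e l ih => exact mul_mem (ih _) (gen_mem_algebra K G _)

theorem str_mem_algebra {x : Unital K G} (hx : x ∈ algebra K G) : str x ∈ algebra K G := by
  induction hx using NonUnitalAlgebra.adjoin_induction with
  | mem x hx =>
    obtain ⟨g, rfl⟩ := hx
    cases g with
    | vert a => rw [str_vt]; exact gen_mem_algebra K G _
    | edge a => rw [str_ed]; exact gen_mem_algebra K G _
    | ghost a => rw [str_gh]; exact gen_mem_algebra K G _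
  | zero => rw [str_zero]; exact zero_mem _
  | add x y _ _ hx hy =>
    have : str (x + y) = str x + str y := by rw [str, map_add]; rfl
    rw [this]; exact add_mem hx hy
  | smul k x _ hx =>
    have : str (k • x) = k • str x := by rw [str, map_smul]; rfl
    rw [this]; exact SMulMemClass.smul_mem k hx
  | mul x y _ _ hx hy => rw [str_mul]; exact mul_mem hy hx

/-- The involution turns `αβ*` into `βα*`, of opposite degree. Since the monomials span, it
exchanges the coefficients of the coaction at `m` and `-m`. -/
theorem str_mem_homog {n : ℤ} {x : Unital K G} (hx : x ∈ algebra K G) (hn : x ∈ homog K G n) :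
    str x ∈ homog K G (-n) := by
  have key : ∀ y ∈ Submodule.span K (monomials K G), ∀ m,
      (coaction K G (str y)).coeff (-m) = str ((coaction K G y).coeff m) := by
    intro y hy m
    induction hy using Submodule.span_induction with
    | mem y hy =>
      obtain ⟨p, q, -, rfl⟩ := hy
      have h1 := mul_mem_homog (pathElt_mem_homog K G p.start p.edges)
        (ghostElt_mem_homog K G q.start q.edges)
      have h2 := mul_mem_homog (pathElt_mem_homog K G q.start q.edges)
        (ghostElt_mem_homog K G p.start p.edges)
      rw [str_mul, str_ghostElt, str_pathElt, coeff_of_mem_homog h1, coeff_of_mem_homog h2]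
      by_cases h : m = (p.edges.length : ℤ) + -(q.edges.length : ℤ)
      · rw [if_pos (by omega), if_pos h, str_mul, str_ghostElt, str_pathElt]
      · rw [if_neg (by omega), if_neg h, str_zero]
    | zero => simp [str]
    | add x y _ _ hx hy =>
      have add : ∀ x y : Unital K G, str (x + y) = str x + str y := fun x y => by
        rw [str, map_add]; rfl
      rw [add, map_add, map_add, AddMonoidAlgebra.coeff_add, AddMonoidAlgebra.coeff_add,
        Finsupp.add_apply, Finsupp.add_apply, add, hx, hy]
    | smul k x _ hx =>
      have smul : ∀ (k : K) (x : Unital K G), str (k • x) = k • str x := fun k x => by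
        rw [str, map_smul]; rfl
      rw [smul, map_smul, map_smul, AddMonoidAlgebra.coeff_smul, AddMonoidAlgebra.coeff_smul,
        Finsupp.smul_apply, Finsupp.smul_apply, smul, hx]
  have := key x (mem_span_of_mem_algebra K G hx)
  rw [mem_homog]
  ext m
  have h := this (-m)
  rw [neg_neg] at h
  rw [h, coeff_of_mem_homog hn, AddMonoidAlgebra.coeff_single, Finsupp.single_apply]
  by_cases hm : -n = m
  · rw [if_pos (by omega), if_pos hm]
  · rw [if_neg (by omega), if_neg hm, str_zero]

end Leavitt

/-! ### Grading and involution of the Leavitt path algebra -/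

namespace LeavittPathAlgebra

open Leavitt

variable {K : Type w} [Field K] {V : Type u} {E : Type v} {G : DirGraph V E}

theorem incl_injective : Function.Injective (incl K G) := Subtype.val_injective

theorem incl_mem (x : LeavittPathAlgebra K G) : incl K G x ∈ algebra K G := Subtype.property x

/-- The element of the Leavitt path algebra with a given image in the unitization. -/
def mk (x : Unital K G) (hx : x ∈ algebra K G) : LeavittPathAlgebra K G := ⟨x, hx⟩

theorem incl_mk (x : Unital K G) (hx : x ∈ algebra K G) : incl K G (mk x hx) = x := rfl

/-- It suffices to check an additive property on multiples of products of a path and a ghost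
path. -/
theorem monomial_induction {P : LeavittPathAlgebra K G → Prop} (x : LeavittPathAlgebra K G)
    (mono : ∀ (k : K) (p q : G.FinPath), p.finish = q.finish → ∀ x : LeavittPathAlgebra K G,
      incl K G x = k • (pathElt K G p.start p.edges * ghostElt K G q.start q.edges) → P x)
    (zero : P 0) (add : ∀ x y, P x → P y → P (x + y)) : P x := by
  have key : ∀ y ∈ Submodule.span K (monomials K G), ∀ k : K, ∃ x : LeavittPathAlgebra K G,
      incl K G x = k • y ∧ P x := by
    intro y hy
    induction hy using Submodule.span_induction with
    | mem y hy =>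
      intro k
      obtain ⟨p, q, hpq, rfl⟩ := hy
      have hmem : k • (pathElt K G p.start p.edges * ghostElt K G q.start q.edges) ∈ algebra K G :=
        SMulMemClass.smul_mem k (mul_mem (pathElt_mem_algebra K G _ _)
          (ghostElt_mem_algebra K G _ _))
      exact ⟨mk _ hmem, rfl, mono k p q hpq _ rfl⟩
    | zero =>
      intro k
      exact ⟨0, by rw [map_zero, smul_zero], zero⟩
    | add y z _ _ hy hz =>
      intro k
      obtain ⟨a, ha, ha'⟩ := hy k
      obtain ⟨b, hb, hb'⟩ := hz k
      exact ⟨a + b, by rw [map_add, ha, hb, smul_add], add a b ha' hb'⟩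
    | smul c y _ hy =>
      intro k
      obtain ⟨a, ha, ha'⟩ := hy (k * c)
      exact ⟨a, by rw [ha, mul_smul], ha'⟩
  obtain ⟨y, hy, hy'⟩ := key _ (mem_span_of_mem_algebra K G (incl_mem x)) 1
  rw [one_smul] at hy
  rwa [← incl_injective hy]

/-- The coefficient at `n` of the coaction of a monomial is the monomial itself or zero, according
to its degree. Hence a homogeneous combination of monomials equals the sum of its terms of the right
degree. From here on degrees are computed by the coaction. -/
theorem mem_grading_iff {n : ℤ} {x : LeavittPathAlgebra K G} :
    x ∈ grading K G n ↔ incl K G x ∈ homog K G n := by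
  constructor
  · intro hx
    change incl K G x ∈ Submodule.span K _ at hx
    refine Submodule.span_le.2 ?_ hx
    rintro _ ⟨p, q, -, hn, rfl⟩
    have := mul_mem_homog (pathElt_mem_homog K G p.start p.edges)
      (ghostElt_mem_homog K G q.start q.edges)
    rwa [← sub_eq_add_neg, hn] at this
  · intro hx
    change incl K G x ∈ Submodule.span K _
    have key : ∀ y ∈ Submodule.span K (monomials K G),
        (coaction K G y).coeff n ∈ Submodule.span K
          {x : Leavitt.Unital K G | ∃ p q : G.FinPath, p.finish = q.finish ∧
            (p.edges.length : ℤ) - (q.edges.length : ℤ) = n ∧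
            x = Leavitt.pathElt K G p.start p.edges * Leavitt.ghostElt K G q.start q.edges} := by
      intro y hy
      induction hy using Submodule.span_induction with
      | mem y hy =>
        obtain ⟨p, q, hpq, rfl⟩ := hy
        rw [coeff_of_mem_homog (mul_mem_homog (pathElt_mem_homog K G p.start p.edges)
          (ghostElt_mem_homog K G q.start q.edges))]
        split_ifs with h
        · exact Submodule.subset_span ⟨p, q, hpq, by omega, rfl⟩
        · exact zero_mem _
      | zero => simp
      | add y z _ _ hy hz => rw [map_add]; exact add_mem hy hz
      | smul c y _ hy => rw [map_smul]; exact Submodule.smul_mem _ c hy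
    have := key _ (mem_span_of_mem_algebra K G (incl_mem x))
    rwa [coeff_of_mem_homog hx, if_pos rfl] at this

variable (K G)

theorem grading_mul {m n : ℤ} {a x : LeavittPathAlgebra K G}
    (ha : a ∈ (grading K G m).toAddSubgroup) (hx : x ∈ (grading K G n).toAddSubgroup) :
    a * x ∈ (grading K G (m + n)).toAddSubgroup := by
  rw [Submodule.mem_toAddSubgroup, mem_grading_iff] at *
  rw [map_mul]
  exact mul_mem_homog ha hx

theorem iSup_grading : ⨆ n, (grading K G n).toAddSubgroup = ⊤ := by
  rw [eq_top_iff]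
  intro x _
  refine monomial_induction (P := fun x => x ∈ ⨆ n, (grading K G n).toAddSubgroup) x ?_
    (zero_mem _) (fun _ _ => add_mem)
  intro k p q hpq x hx
  refine AddSubgroup.mem_iSup_of_mem (p.edges.length + -q.edges.length : ℤ) ?_
  rw [Submodule.mem_toAddSubgroup, mem_grading_iff, hx]
  exact Submodule.smul_mem _ k (mul_mem_homog (pathElt_mem_homog K G p.start p.edges)
      (ghostElt_mem_homog K G q.start q.edges))

/-- The coefficients of the coaction serve as projections; they map the algebra to itself, since
this holds on homogeneous elements. -/
theorem isInternal_grading :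
    DirectSum.IsInternal fun n => (grading K G n).toAddSubgroup := by
  have hmem : ∀ n, ∀ x : LeavittPathAlgebra K G,
      (coaction K G (incl K G x)).coeff n ∈ algebra K G := by
    intro n x
    have hx : x ∈ ⨆ n, (grading K G n).toAddSubgroup := iSup_grading K G ▸ AddSubgroup.mem_top x
    refine AddSubgroup.iSup_induction _
      (C := fun x => (coaction K G (incl K G x)).coeff n ∈ algebra K G) hx ?_ ?_ ?_
    · intro m x hx
      rw [Submodule.mem_toAddSubgroup, mem_grading_iff] at hx
      rw [coeff_of_mem_homog hx]
      split_ifs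
      exacts [incl_mem x, zero_mem _]
    · simp
    · intro x y hx hy
      rw [map_add, map_add]; exact add_mem hx hy
  refine GradedRingTheory.isInternal_of_projections
    (fun n =>
      { toFun := fun x => mk _ (hmem n x)
        map_zero' := incl_injective (by rw [incl_mk]; simp)
        map_add' := fun x y => incl_injective (by
          change (coaction K G (incl K G (x + y))).coeff n = (coaction K G (incl K G x)).coeff n +
            (coaction K G (incl K G y)).coeff n
          rw [map_add, map_add]; rfl) }) ?_ ?_
    (iSup_grading K G)
  · intro n x hx
    rw [Submodule.mem_toAddSubgroup, mem_grading_iff] at hx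
    refine incl_injective ?_
    change (coaction K G (incl K G x)).coeff n = _
    rw [coeff_of_mem_homog hx, if_pos rfl]
  · intro m n hmn x hx
    rw [Submodule.mem_toAddSubgroup, mem_grading_iff] at hx
    refine incl_injective ?_
    change (coaction K G (incl K G x)).coeff m = _
    rw [coeff_of_mem_homog hx, if_neg hmn, map_zero]

/-- The source of `α` is a left unit for `αβ*`. -/
theorem closure_mul_eq_top :
    AddSubgroup.closure {y : LeavittPathAlgebra K G | ∃ a x, y = a * x} = ⊤ := by
  rw [eq_top_iff]
  intro x _
  refine monomial_induction (P := fun x => x ∈ AddSubgroup.closure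
    {y : LeavittPathAlgebra K G | ∃ a x, y = a * x}) x ?_ (zero_mem _) (fun _ _ => add_mem)
  intro k p q hpq x hx
  refine AddSubgroup.subset_closure ⟨mk _ (gen_mem_algebra K G (.vert p.start)), x, ?_⟩
  refine incl_injective ?_
  rw [map_mul, incl_mk, hx, mul_smul_comm, ← mul_assoc, vt_mul_pathElt p.isPath]

/-- The involution, as an isomorphism with the opposite ring. -/
noncomputable def starEquiv : LeavittPathAlgebra K G ≃+* (LeavittPathAlgebra K G)ᵐᵒᵖ where
  toFun x := MulOpposite.op (mk (str (incl K G x)) (str_mem_algebra K G (incl_mem x)))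
  invFun x := mk (str (incl K G x.unop)) (str_mem_algebra K G (incl_mem _))
  left_inv x := incl_injective (str_str _)
  right_inv x := MulOpposite.unop_injective (incl_injective (str_str _))
  map_mul' x y := MulOpposite.unop_injective (incl_injective (by
    change str (incl K G (x * y)) = str (incl K G y) * str (incl K G x)
    rw [map_mul, str_mul]))
  map_add' x y := MulOpposite.unop_injective (incl_injective (by
    change str (incl K G (x + y)) = str (incl K G x) + str (incl K G y)
    rw [map_add, str, map_add]; rfl))

/-- The involution is an isomorphism with the opposite ring which negates degrees, and so is its
inverse. -/
theorem isRightSelfInjective_iff :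
    GradedRingTheory.IsRightSelfInjective (fun n => (grading K G n).toAddSubgroup) ↔
      GradedRingTheory.IsLeftSelfInjective (fun n => (grading K G n).toAddSubgroup) := by
  have key : ∀ n a, a ∈ (grading K G n).toAddSubgroup ↔ starEquiv K G a ∈
      GradedRingTheory.opGrading (fun n => (grading K G n).toAddSubgroup) (-n) := by
    intro n a
    have h1 : starEquiv K G a ∈ GradedRingTheory.opGrading
        (fun n => (grading K G n).toAddSubgroup) (-n) ↔
        str (incl K G a) ∈ homog K G (-n) := by
      rw [← incl_mk (str (incl K G a)) (str_mem_algebra K G (incl_mem a)), ← mem_grading_iff]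
      constructor
      · rintro ⟨x, hx, hxa⟩
        have : x = (starEquiv K G a).unop := congrArg MulOpposite.unop hxa
        rw [this] at hx
        exact hx
      · intro h
        exact ⟨_, h, rfl⟩
    rw [h1, Submodule.mem_toAddSubgroup, mem_grading_iff]
    constructor
    · exact str_mem_homog K G (incl_mem a)
    · intro h
      have := str_mem_homog K G (str_mem_algebra K G (incl_mem a)) h
      rwa [str_str, neg_neg] at this
  constructor
  · refine GradedRingTheory.IsLeftSelfInjective.of_antigraded (starEquiv K G).symm ?_
    intro n a
    rw [key, RingEquiv.apply_symm_apply, neg_neg]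
  · exact GradedRingTheory.IsLeftSelfInjective.of_antigraded (starEquiv K G) key

end LeavittPathAlgebra

/-! ### Infinite paths -/

namespace DirGraph

variable {V : Type u} {E : Type v} {G : DirGraph V E}

theorem eq_of_not_isBifurcation {a : V} (h : ¬ G.IsBifurcation a) {e f : E} (he : G.src e = a)
    (hf : G.src f = a) : e = f := by
  by_contra hef
  exact h ⟨e, f, hef, he, hf⟩

theorem IsPath.src_getElem_zero {a b : V} {l : List E} (h : G.IsPath a l b) (hl : 0 < l.length) :
    G.src l[0] = a := by
  cases l with
  | nil => simp at hl
  | cons e l => exact h.1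

theorem IsPath.rng_getElem {a b : V} {l : List E} (h : G.IsPath a l b) {i : ℕ}
    (hi : i + 1 < l.length) : G.rng l[i] = G.src l[i + 1] := by
  induction l generalizing a i with
  | nil => simp at hi
  | cons e l ih =>
    cases i with
    | zero => exact (h.2.src_getElem_zero (by simpa using hi)).symm
    | succ i => exact ih h.2 (by simpa using hi)

theorem IsPath.rng_getElem_last {a b : V} {l : List E} (h : G.IsPath a l b) {i : ℕ}
    (hi : i + 1 = l.length) : G.rng l[i] = b := by
  induction l generalizing a i with
  | nil => simp at hi
  | cons e l ih =>
    cases i with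
    | zero =>
      have : l = [] := by simpa using hi
      subst this
      exact h.2
    | succ i => exact ih h.2 (by simpa using hi)

/-- The infinite path `ccc⋯`. -/
def infPower (c : List E) (hc : c ≠ []) (n : ℕ) : E :=
  (c)[n % c.length]'(Nat.mod_lt _ (List.length_pos_iff.2 hc))

theorem isInfPower_infPower (c : List E) (hc : c ≠ []) : IsInfPower c (infPower c hc) :=
  fun _ => List.getElem?_eq_getElem _

theorem infPower_eq {c : List E} (hc : c ≠ []) {n i : ℕ} (hi : i < c.length)
    (h : n % c.length = i) : infPower c hc n = (c)[i] := by
  subst h; rfl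

theorem IsCycleAt.src_infPower_zero {a : V} {c : List E} (h : G.IsCycleAt a c) :
    G.src (infPower c h.1 0) = a := by
  rw [infPower_eq h.1 (List.length_pos_iff.2 h.1) (Nat.zero_mod _)]
  exact h.2.1.src_getElem_zero _

theorem IsCycleAt.isInfPath_infPower {a : V} {c : List E} (h : G.IsCycleAt a c) :
    G.IsInfPath (infPower c h.1) := by
  intro n
  have hpos := List.length_pos_iff.2 h.1
  have hlt := Nat.mod_lt n hpos
  rw [infPower_eq h.1 hlt rfl]
  by_cases hn : n % c.length + 1 < c.length
  · rw [infPower_eq h.1 hn (by rw [Nat.add_mod, Nat.mod_eq_of_lt (a := 1) (by omega),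
      Nat.mod_eq_of_lt hn])]
    exact h.2.1.rng_getElem hn
  -- At the last edge of the cycle the index wraps around to `0`, and the path closes up.
  · have hn : n % c.length + 1 = c.length := by omega
    rw [infPower_eq h.1 hpos (Nat.mod_eq_zero_of_dvd ⟨n / c.length + 1, by
      have := Nat.div_add_mod n c.length
      rw [Nat.mul_succ]; linarith⟩), h.2.1.rng_getElem_last hn,
      h.2.1.src_getElem_zero]

theorem IsInfPath.isPath {p : ℕ → E} (hp : G.IsInfPath p) (n : ℕ) :
    G.IsPath (G.src (p 0)) ((List.range n).map p) (G.src (p n)) := by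
  induction n with
  | zero => rfl
  | succ n ih =>
    rw [List.range_succ, List.map_append]
    exact ih.append ⟨rfl, hp n⟩

/-- If no vertex of an infinite path is a bifurcation, each path that starts at one of its vertices
follows it. -/
theorem IsPath.finish_eq_of_isStraightLine {q : ℕ → E} (hq : G.IsStraightLine q) {n : ℕ}
    {l : List E} {b : V} (h : G.IsPath (G.src (q n)) l b) : b = G.src (q (n + l.length)) := by
  induction l generalizing n with
  | nil => exact h.symm
  | cons e l ih =>
    have he : e = q n := eq_of_not_isBifurcation (hq.2 n) h.1 rfl
    subst he
    have h2 := h.2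
    rw [hq.1 n] at h2
    rw [ih h2, List.length_cons, Nat.add_right_comm, add_assoc]

/-- An infinite path with finitely many bifurcations ends in a straight line with a line point or
winds around a cycle. -/
theorem IsInfPath.tailEquiv_of_finite {p : ℕ → E} (hp : G.IsInfPath p)
    (hfin : {n | G.IsBifurcation (G.src (p n))}.Finite) :
    (∃ q, G.IsStraightLine q ∧ G.ContainsLinePoint q ∧ DirGraph.TailEquiv p q) ∨
      (∃ c q, G.IsCycle c ∧ DirGraph.IsInfPower c q ∧ DirGraph.TailEquiv p q) := by
  obtain ⟨N, hN⟩ := hfin.bddAbove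
  -- `N` bounds the positions of the bifurcations, so the path is straight from `N + 1` on.
  let q : ℕ → E := fun n => p (N + 1 + n)
  have hq : G.IsStraightLine q := by
    refine ⟨fun n => hp _, fun n hn => ?_⟩
    have : N + 1 + n ≤ N := hN hn
    omega
  by_cases hc : ∃ n c, G.IsCycleAt (G.src (q n)) c
  · obtain ⟨n, c, hc⟩ := hc
    right
    -- One more edge is deleted on both sides, because `TailEquiv` asks for initial segments of
    -- positive length.
    refine ⟨c, infPower c hc.1, ⟨_, hc⟩, isInfPower_infPower c hc.1, N + 1 + n + 1, 1,
      by omega, by omega, fun k => ?_⟩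
    -- For lack of bifurcations the tail has to follow the cycle edge by edge.
    have key : ∀ k, G.src (infPower c hc.1 k) = G.src (q (n + k)) := by
      intro k
      induction k with
      | zero => exact hc.src_infPower_zero
      | succ k ih =>
        have : infPower c hc.1 k = q (n + k) := eq_of_not_isBifurcation (hq.2 _) ih rfl
        rw [← hc.isInfPath_infPower k, this, hq.1, add_assoc]
    have := eq_of_not_isBifurcation (hq.2 _) (key (1 + k)) rfl
    rw [this]
    change p _ = p _
    congr 1
    omega
  -- A path starting on the tail cannot leave it, and no vertex of the tail is the base of a cycle;
  -- so the first vertex of the tail is a line point.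
  · left
    push Not at hc
    refine ⟨q, hq, ⟨0, ?_⟩, N + 1 + 1, 1, by omega, by omega, fun k => ?_⟩
    · rintro b ⟨l, hl⟩
      rw [hl.finish_eq_of_isStraightLine hq]
      exact ⟨hq.2 _, fun ⟨c, h⟩ => hc _ c h⟩
    · change p _ = p _
      congr 1
      omega

end DirGraph

/-! ### From self-injectivity to the conditions on the graph -/

namespace LeavittPathAlgebra

open Leavitt DirGraph

variable {K : Type w} [Field K] {V : Type u} {E : Type v} {G : DirGraph V E}

/-- If there are infinitely many paths from `a`, none of which is a prefix of another one, such that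
each path is a prefix of almost all of them or incomparable to almost all of them, the algebra is
not graded left self-injective. -/
theorem not_isLeftSelfInjective_of_paths {D : Type*} [Infinite D] (a : V) (ω : D → List E)
    (t : D → V) (hω : ∀ d, G.IsPath a (ω d) (t d)) (hne : ∀ d d', d ≠ d' → ¬ ω d <+: ω d')
    (hcof : ∀ α : List E, (∀ᶠ d in Filter.cofinite, α <+: ω d) ∨
      ∀ᶠ d in Filter.cofinite, ¬ ω d <+: α ∧ ¬ α <+: ω d) :
    ¬ GradedRingTheory.IsLeftSelfInjective fun n => (grading K G n).toAddSubgroup := by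
  let U : D → Unital K G := fun d => pathElt K G a (ω d) * ghostElt K G a (ω d)
  have hU : ∀ d, U d ∈ algebra K G := fun d =>
    mul_mem (pathElt_mem_algebra K G _ _) (ghostElt_mem_algebra K G _ _)
  have hself : ∀ d, ghostElt K G a (ω d) * pathElt K G a (ω d) = vt K G (t d) := fun d =>
    ghostElt_mul_pathElt_self (hω d)
  have hzero : ∀ d a' b' l, G.IsPath a' l b' → (a = a' → ¬ ω d <+: l ∧ ¬ l <+: ω d) →
      ghostElt K G a (ω d) * pathElt K G a' l = 0 := fun d a' b' l hl h =>
    ghostElt_mul_pathElt_of_not_prefix (hω d) hl h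
  have hzero' : ∀ d a' b' l, G.IsPath a' l b' → (a = a' → ¬ ω d <+: l ∧ ¬ l <+: ω d) →
      ghostElt K G a' l * pathElt K G a (ω d) = 0 := fun d a' b' l hl h =>
    ghostElt_mul_pathElt_of_not_prefix hl (hω d) fun haa => (h haa.symm).symm
  refine GradedRingTheory.not_isLeftSelfInjective (K := K) (isInternal_grading K G)
    (grading_mul K G) (closure_mul_eq_top K G) (fun d => mk (U d) (hU d)) (fun d => ?_)
    (fun d => ?_) (fun d d' hd => ?_) (fun d hd => ?_) (mk (vt K G a) (gen_mem_algebra K G _))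
    ?_ (fun d => ?_) (fun b hb => ?_)
  · rw [Submodule.mem_toAddSubgroup, mem_grading_iff, incl_mk]
    have := mul_mem_homog (pathElt_mem_homog K G a (ω d)) (ghostElt_mem_homog K G a (ω d))
    rwa [add_neg_cancel] at this
  · refine incl_injective ?_
    rw [map_mul, incl_mk, mul_assoc, ← mul_assoc (ghostElt K G a (ω d)), hself,
      vt_mul_ghostElt (hω d)]
  · refine incl_injective ?_
    rw [map_mul, incl_mk, incl_mk, map_zero, mul_assoc, ← mul_assoc (ghostElt K G a (ω d)),
      hzero d a _ _ (hω d') fun _ => ⟨hne d d' hd, hne d' d hd.symm⟩, zero_mul, mul_zero]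
  · have h0 : U d = 0 := by rw [← incl_mk (U d) (hU d), hd, map_zero]
    have h1 : ghostElt K G a (ω d) * U d * pathElt K G a (ω d) = vt K G (t d) := by
      rw [← mul_assoc, hself, mul_assoc, hself, (isFamily_gen K G).idem]
    rw [h0, mul_zero, zero_mul] at h1
    exact vt_ne_zero K G (t d) h1.symm
  · rw [Submodule.mem_toAddSubgroup, mem_grading_iff, incl_mk]
    exact vt_mem_homog K G a
  · refine incl_injective ?_
    rw [map_mul, incl_mk, incl_mk, mul_assoc, ghostElt_mul_vt (hω d)]
  · have key : ∃ k : K, ∀ᶠ d in Filter.cofinite, U d * incl K G b * U d = k • U d := by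
      change incl K G b ∈ Submodule.span K _ at hb
      generalize incl K G b = x at hb
      induction hb using Submodule.span_induction with
      | mem y hy =>
        obtain ⟨p, q, hpq, hlen, rfl⟩ := hy
        -- The monomial `αβ*` has degree 0. If both paths start at `a` and are prefixes of almost
        -- all `ω d`, they are comparable and of the same length, so `α = β` and the scalar is `1`.
        -- Otherwise one of them starts elsewhere or is incomparable with almost all `ω d`, and the
        -- scalar is `0`.
        by_cases hp : a = p.start ∧ ∀ᶠ d in Filter.cofinite, p.edges <+: ω d
        · by_cases hq : a = q.start ∧ ∀ᶠ d in Filter.cofinite, q.edges <+: ω d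
          · obtain ⟨d, hd, hd'⟩ := (hp.2.and hq.2).exists
            have hedges : p.edges = q.edges :=
              (List.prefix_of_prefix_length_le hd hd' (by omega)).eq_of_length (by omega)
            refine ⟨1, hp.2.mono fun d hd => ?_⟩
            obtain ⟨m, hm⟩ := hd
            have h1 : G.IsPath a p.edges p.finish := hp.1 ▸ p.isPath
            have h2 : G.IsPath p.finish m (t d) := by
              obtain ⟨c, hc, hc'⟩ := isPath_append.1 (hm ▸ hω d)
              rwa [hc.finish_unique h1] at hc'
            have h3 : ghostElt K G a (ω d) * pathElt K G a p.edges = ghostElt K G p.finish m := by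
              rw [← hm]; exact ghostElt_append_mul_pathElt h1 h2
            have h4 : ghostElt K G a p.edges * pathElt K G a (ω d) = pathElt K G p.finish m := by
              rw [← hm]; exact ghostElt_mul_pathElt_append h1 h2
            rw [← hedges, ← hp.1, ← hq.1, one_smul]
            calc U d * (pathElt K G a p.edges * ghostElt K G a p.edges) * U d
                = pathElt K G a (ω d) * ((ghostElt K G a (ω d) * pathElt K G a p.edges) *
                  (ghostElt K G a p.edges * pathElt K G a (ω d))) * ghostElt K G a (ω d) := by
                  simp only [U, mul_assoc]
              _ = U d := by
                  rw [h3, h4, ghostElt_mul_pathElt_self h2, mul_assoc, vt_mul_ghostElt (hω d)]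
          · have h : ∀ᶠ d in Filter.cofinite, a = q.start →
                ¬ ω d <+: q.edges ∧ ¬ q.edges <+: ω d := by
              by_cases haq : a = q.start
              · exact ((hcof q.edges).resolve_left fun h => hq ⟨haq, h⟩).mono fun _ h _ => h
              · exact Filter.Eventually.of_forall fun _ h => absurd h haq
            refine ⟨0, h.mono fun d hd => ?_⟩
            rw [zero_smul, mul_assoc, mul_assoc (pathElt K G p.start p.edges),
              ← mul_assoc (ghostElt K G q.start q.edges), hzero' d _ _ _ q.isPath hd, zero_mul,
              mul_zero, mul_zero]
        · have h : ∀ᶠ d in Filter.cofinite, a = p.start →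
              ¬ ω d <+: p.edges ∧ ¬ p.edges <+: ω d := by
            by_cases hap : a = p.start
            · exact ((hcof p.edges).resolve_left fun h => hp ⟨hap, h⟩).mono fun _ h _ => h
            · exact Filter.Eventually.of_forall fun _ h => absurd h hap
          refine ⟨0, h.mono fun d hd => ?_⟩
          rw [zero_smul, mul_assoc (pathElt K G a (ω d)),
            ← mul_assoc (ghostElt K G a (ω d)) (pathElt K G p.start p.edges),
            hzero d _ _ _ p.isPath hd, zero_mul, mul_zero, zero_mul]
      | zero => exact ⟨0, Filter.Eventually.of_forall fun d => by simp⟩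
      | add y z _ _ hy hz =>
        obtain ⟨k, hk⟩ := hy
        obtain ⟨k', hk'⟩ := hz
        exact ⟨k + k', (hk.and hk').mono fun d hd => by
          rw [mul_add, add_mul, hd.1, hd.2, add_smul]⟩
      | smul c y _ hy =>
        obtain ⟨k, hk⟩ := hy
        exact ⟨c * k, hk.mono fun d hd => by
          rw [mul_smul_comm, smul_mul_assoc, hd, mul_smul]⟩
    obtain ⟨k, hk⟩ := key
    refine ⟨k, hk.mono fun d hd => incl_injective ?_⟩
    rw [map_mul, map_mul, map_smul]
    exact hd

/-- The edges at an infinite emitter form a family of paths as required: a path of positive length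
is comparable with at most one of them, the one with its own first edge. -/
theorem rowFinite_of_isLeftSelfInjective
    (h : GradedRingTheory.IsLeftSelfInjective fun n => (grading K G n).toAddSubgroup) :
    G.RowFinite := by
  intro a
  by_contra hinf
  have : Infinite {e : E // G.src e = a} := Set.infinite_coe_iff.2 hinf
  refine not_isLeftSelfInjective_of_paths (D := {e : E // G.src e = a}) a (fun e => [e.1])
    (fun e => G.rng e.1) (fun e => ⟨e.2, rfl⟩) ?_ ?_ h
  · intro e e' hne hpre
    exact hne (Subtype.ext (by simpa using hpre))
  · intro α
    cases α with
    | nil => exact Or.inl (Filter.Eventually.of_forall fun e => List.nil_prefix)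
    | cons f α =>
      right
      have hfin : {e : {e : E // G.src e = a} | e.1 = f}.Finite :=
        Set.Subsingleton.finite fun x hx y hy => Subtype.ext (hx.trans hy.symm)
      refine Filter.mem_of_superset hfin.compl_mem_cofinite fun e he => ?_
      have hef : ¬ e.1 = f := he
      have hfe : ¬ f = e.1 := fun h => hef h.symm
      simp [List.cons_prefix_cons, hef, hfe]

/-- At each bifurcation `p` can be left by an edge other than its own. A path which is an initial
segment of `p` is a prefix of almost all the paths so obtained, and any other path is incomparable
with almost all of them. -/
theorem finite_bifurcations_of_isLeftSelfInjective
    (h : GradedRingTheory.IsLeftSelfInjective fun n => (grading K G n).toAddSubgroup)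
    {p : ℕ → E} (hp : G.IsInfPath p) : {n | G.IsBifurcation (G.src (p n))}.Finite := by
  by_contra hinf
  let D := {n // G.IsBifurcation (G.src (p n))}
  have : Infinite D := Set.infinite_coe_iff.2 hinf
  have hf : ∀ d : D, ∃ f, G.src f = G.src (p d.1) ∧ f ≠ p d.1 := by
    rintro ⟨n, e, f, hef, he, hf⟩
    by_cases hep : e = p n
    · exact ⟨f, hf, fun h => hef (hep.trans h.symm)⟩
    · exact ⟨e, he, hep⟩
  choose f hf hfp using hf
  have htake : ∀ (d : D) k, k ≤ d.1 →
      ((List.range d.1).map p ++ [f d]).take k = (List.range k).map p := by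
    intro d k hk
    rw [List.take_append_of_le_length (by simpa using hk), ← List.map_take, List.take_range,
      min_eq_left hk]
  have hge : ∀ k : ℕ, ∀ᶠ d : D in Filter.cofinite, k ≤ d.1 := by
    intro k
    have hfin : {d : D | d.1 < k}.Finite :=
      (Set.finite_lt_nat k).preimage Subtype.val_injective.injOn
    refine hfin.subset fun d hd => ?_
    simpa using hd
  refine not_isLeftSelfInjective_of_paths (D := D) (G.src (p 0))
    (fun d => (List.range d.1).map p ++ [f d]) (fun d => G.rng (f d))
    (fun d => (hp.isPath d.1).append ⟨hf d, rfl⟩) ?_ ?_ h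
  · intro d d' hne hpre
    have hlen := hpre.length_le
    simp only [List.length_append, List.length_map, List.length_range, List.length_singleton,
      add_le_add_iff_right] at hlen
    have hlt : d.1 < d'.1 := lt_of_le_of_ne hlen fun h => hne (Subtype.ext h)
    have heq := List.prefix_iff_eq_take.1 hpre
    -- At position `d` the later path still follows `p`, whereas the earlier one takes `f d`.
    rw [htake d' _ (by simp; omega)] at heq
    simp only [List.length_append, List.length_map, List.length_range, List.length_singleton,
      List.range_succ, List.map_append, List.map_singleton, List.append_cancel_left_eq,
      List.cons.injEq, and_true] at heq
    exact hfp d heq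
  · intro α
    by_cases hα : α = (List.range α.length).map p
    · left
      refine (hge α.length).mono fun d hd => ?_
      rw [List.prefix_iff_eq_take, htake d _ hd]
      exact hα
    · right
      refine (hge α.length).mono fun d hd => ⟨fun h' => ?_, fun h' => ?_⟩
      · have := h'.length_le
        simp only [List.length_append, List.length_map, List.length_range,
          List.length_singleton] at this
        omega
      · rw [List.prefix_iff_eq_take, htake d _ hd] at h'
        exact hα h'

/-- The conditions on the graph which follow from graded left self-injectivity. -/
theorem graph_conditions_of_isLeftSelfInjective
    (h : GradedRingTheory.IsLeftSelfInjective fun n => (grading K G n).toAddSubgroup) :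
    G.RowFinite ∧ (∀ c, G.IsCycle c → ¬ G.HasExit c) ∧
      ∀ p, G.IsInfPath p →
        (∃ q, G.IsStraightLine q ∧ G.ContainsLinePoint q ∧ DirGraph.TailEquiv p q) ∨
        (∃ c q, G.IsCycle c ∧ DirGraph.IsInfPower c q ∧ DirGraph.TailEquiv p q) := by
  refine ⟨rowFinite_of_isLeftSelfInjective h, ?_, fun p hp =>
    hp.tailEquiv_of_finite (finite_bifurcations_of_isLeftSelfInjective h hp)⟩
  rintro c ⟨a, hc⟩ ⟨e, he, f, hf, hfe⟩
  obtain ⟨i, hi, rfl⟩ := List.getElem_of_mem he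
  -- An exit at the edge of index `i` recurs as a bifurcation of `ccc⋯` at all positions `i + k|c|`.
  refine Set.infinite_of_injective_forall_mem (f := fun k : ℕ => i + c.length * k) ?_ ?_
    (finite_bifurcations_of_isLeftSelfInjective h hc.isInfPath_infPower)
  · intro k k' hk
    have hpos := List.length_pos_iff.2 hc.1
    exact Nat.eq_of_mul_eq_mul_left hpos (Nat.add_left_cancel hk)
  · intro k
    have : infPower c hc.1 (i + c.length * k) = (c)[i] :=
      infPower_eq hc.1 hi (by rw [Nat.add_mul_mod_self_left, Nat.mod_eq_of_lt hi])
    exact ⟨f, (c)[i], hfe, by rw [hf, this], by rw [this]⟩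

end LeavittPathAlgebra

/-! ## Finitely supported matrices -/

namespace FinMat

variable {I : Type u} {A : Type v} [Ring A]

/-- The matrix with entry `a` in position `(p, q)` and zeros elsewhere. -/
noncomputable def unit (p q : I) (a : A) : FinMat I A := Finsupp.single (p, q) a

@[ext]
theorem ext {M N : FinMat I A} (h : ∀ i j, M.entry i j = N.entry i j) : M = N :=
  Finsupp.ext fun p => h p.1 p.2

theorem entry_zero (i j : I) : (0 : FinMat I A).entry i j = 0 := rfl

theorem entry_add (M N : FinMat I A) (i j : I) : (M + N).entry i j = M.entry i j + N.entry i j :=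
  rfl

open Classical in
theorem entry_unit (p q : I) (a : A) (i j : I) :
    (unit p q a).entry i j = if i = p ∧ j = q then a else 0 := by
  change (Finsupp.single (p, q) a : (I × I) →₀ A) (i, j) = _
  rw [Finsupp.single_apply]
  simp only [Prod.mk.injEq, eq_comm]

@[elab_as_elim]
theorem induction_on {P : FinMat I A → Prop} (M : FinMat I A) (zero : P 0)
    (add : ∀ M N, P M → P N → P (M + N)) (unit : ∀ p q a, P (unit p q a)) : P M :=
  Finsupp.induction_linear (motive := P) M zero add fun p a => unit p.1 p.2 a

open Classical in
theorem unit_mul_unit (p q r s : I) (a b : A) :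
    unit p q a * unit r s b = if q = r then unit p s (a * b) else 0 :=
  mulAux_single (p, q) (r, s) a b

theorem unit_mul_unit_same (p q s : I) (a b : A) :
    unit p q a * unit q s b = unit p s (a * b) := by
  rw [unit_mul_unit, if_pos rfl]

open Classical in
theorem entry_unit_mul (p q : I) (a : A) (M : FinMat I A) (i j : I) :
    (unit p q a * M).entry i j = if i = p then a * M.entry q j else 0 := by
  induction M using FinMat.induction_on with
  | zero => simp [entry_zero]
  | add M N hM hN =>
    rw [mul_add, entry_add, entry_add, hM, hN]
    split_ifs <;> simp [mul_add]
  | unit r s b =>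
    rw [unit_mul_unit, entry_unit]
    by_cases hi : i = p <;> by_cases hq : q = r <;> by_cases hj : j = s <;>
      simp [hi, hq, hj, entry_unit, entry_zero]

open Classical in
theorem entry_mul_unit (p q : I) (a : A) (M : FinMat I A) (i j : I) :
    (M * unit p q a).entry i j = if j = q then M.entry i p * a else 0 := by
  induction M using FinMat.induction_on with
  | zero => simp [entry_zero]
  | add M N hM hN =>
    rw [add_mul, entry_add, entry_add, hM, hN]
    split_ifs <;> simp [add_mul]
  | unit r s b =>
    rw [unit_mul_unit, entry_unit]
    by_cases hi : i = r <;> by_cases hq : s = p <;> by_cases hj : j = q <;>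
      simp [hi, hq, hj, entry_unit, entry_zero, eq_comm]
    exact fun h => absurd h.symm hq

end FinMat

/-! ## Direct sums of rings -/

namespace RingDirectSum

variable {K : Type w} [Field K] {ι : Type u} {R : ι → Type v}
  [∀ i, NonUnitalRing (R i)] [∀ i, Module K (R i)]

open Classical in
/-- The inclusion of a summand. -/
noncomputable def of (i : ι) (x : R i) : RingDirectSum K R :=
  ⟨Pi.single i x, (Set.finite_singleton i).subset fun j hj => by
    by_contra h
    exact hj (Pi.single_eq_of_ne h x)⟩

theorem ext {f g : RingDirectSum K R} (h : ∀ i, component K R f i = component K R g i) : f = g :=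
  Subtype.ext (funext h)

theorem component_add (f g : RingDirectSum K R) (i : ι) :
    component K R (f + g) i = component K R f i + component K R g i := rfl

theorem component_sub (f g : RingDirectSum K R) (i : ι) :
    component K R (f - g) i = component K R f i - component K R g i := rfl

theorem component_mul (f g : RingDirectSum K R) (i : ι) :
    component K R (f * g) i = component K R f i * component K R g i := rfl

theorem component_zero (i : ι) : component K R 0 i = 0 := rfl

theorem component_smul (k : K) (f : RingDirectSum K R) (i : ι) :
    component K R (k • f) i = k • component K R f i := rfl

open Classical in
theorem component_of_same (i : ι) (x : R i) : component K R (of i x) i = x :=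
  Pi.single_eq_same i x

open Classical in
theorem component_of_ne {i j : ι} (h : j ≠ i) (x : R i) : component K R (of i x) j = 0 :=
  Pi.single_eq_of_ne h x

theorem finite_support (f : RingDirectSum K R) : {i | component K R f i ≠ 0}.Finite := f.2

theorem of_zero (i : ι) : (of i 0 : RingDirectSum K R) = 0 := ext fun j => by
  by_cases h : j = i
  · subst h; rw [component_of_same]; rfl
  · rw [component_of_ne h]; rfl

theorem of_add (i : ι) (x y : R i) : (of i (x + y) : RingDirectSum K R) = of i x + of i y :=
  ext fun j => by
    by_cases h : j = i
    · subst h; rw [component_add, component_of_same, component_of_same, component_of_same]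
    · rw [component_add, component_of_ne h, component_of_ne h, component_of_ne h, add_zero]

theorem of_mul_of (i : ι) (x y : R i) : (of i x * of i y : RingDirectSum K R) = of i (x * y) :=
  ext fun j => by
    by_cases h : j = i
    · subst h; rw [component_mul, component_of_same, component_of_same, component_of_same]
    · rw [component_mul, component_of_ne h, component_of_ne h, component_of_ne h, mul_zero]

theorem of_mul (i : ι) (x : R i) (f : RingDirectSum K R) :
    of i x * f = of i (x * component K R f i) :=
  ext fun j => by
    by_cases h : j = i
    · subst h; rw [component_mul, component_of_same, component_of_same]
    · rw [component_mul, component_of_ne h, component_of_ne h, zero_mul]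

theorem of_mul_of_ne {i j : ι} (h : i ≠ j) (x : R i) (y : R j) :
    (of i x * of j y : RingDirectSum K R) = 0 := by
  rw [of_mul, component_of_ne h, mul_zero, of_zero]

@[elab_as_elim]
theorem induction_on {P : RingDirectSum K R → Prop} (f : RingDirectSum K R) (zero : P 0)
    (add : ∀ f g, P f → P g → P (f + g)) (of : ∀ i x, P (of i x)) : P f := by
  classical
  have key : ∀ (s : Finset ι) (f : RingDirectSum K R),
      (∀ i, i ∉ s → component K R f i = 0) → P f := by
    intro s
    induction s using Finset.induction_on with
    | empty =>
      intro f hf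
      have : f = 0 := ext fun i => hf i (Finset.notMem_empty i)
      rwa [this]
    | insert a s ha ih =>
      intro f hf
      rw [← add_sub_cancel (RingDirectSum.of a (component K R f a)) f]
      refine add _ _ (of _ _) (ih _ fun i hi => ?_)
      rw [component_sub]
      by_cases hia : i = a
      · subst hia; rw [component_of_same, sub_self]
      · rw [component_of_ne hia, sub_zero]
        exact hf i (by simp [hia, hi])
  exact key (finite_support f).toFinset f fun i hi => by simpa using hi

end RingDirectSum

/-! ## Graded semisimplicity of direct sums of matrix rings -/

namespace GradedRingTheory

/-- The idempotents are the diagonal units `e_pp`. A non-zero homogeneous `x = x e_pp` lives in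
column `p`; if its entry at `(r, p)` has the left inverse `b`, then `e_pr(b) x = e_pp`. -/
theorem HasPrimitiveIdempotents.ringDirectSum {K : Type w} [Field K] {I : Type u}
    {Λ : I → Type*} {A : I → Type*} [∀ i, Ring (A i)] [∀ i, Nontrivial (A i)]
    [∀ i, Algebra K (A i)]
    (𝒜 : ∀ i, ℤ → Submodule K (A i)) (δ : ∀ i, Λ i → ℤ) (one_mem : ∀ i, 1 ∈ 𝒜 i 0)
    (div : ∀ i n a, a ∈ 𝒜 i n → a ≠ 0 → ∃ b, b * a = 1) :
    HasPrimitiveIdempotents fun n => (RingDirectSum.grading K (fun i => FinMat (Λ i) (A i))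
      (fun i => FinMat.grading (𝒜 i) (δ i)) n).toAddSubgroup := by
  classical
  refine ⟨{u | ∃ i p, u = RingDirectSum.of i (FinMat.unit p p 1)}, ?_, ?_, ?_⟩
  · rintro _ ⟨i, p, rfl⟩
    refine ⟨fun j => ?_, ?_, fun h => ?_⟩
    · by_cases h : j = i
      · subst h
        rw [RingDirectSum.component_of_same]
        intro r s
        rw [FinMat.entry_unit]
        split_ifs with h
        · rw [h.1, h.2, zero_add, sub_self]; exact one_mem j
        · exact zero_mem _
      · rw [RingDirectSum.component_of_ne h]; exact zero_mem _
    · rw [RingDirectSum.of_mul_of, FinMat.unit_mul_unit_same, one_mul]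
    · have := congrArg (fun f => (RingDirectSum.component K _ f i).entry p p) h
      simp only [RingDirectSum.component_of_same, FinMat.entry_unit, and_self, if_true] at this
      exact one_ne_zero this
  · rw [eq_top_iff]
    intro f _
    induction f using RingDirectSum.induction_on with
    | zero => exact zero_mem _
    | add f g hf hg => exact add_mem (hf trivial) (hg trivial)
    | of i M =>
      induction M using FinMat.induction_on with
      | zero => rw [RingDirectSum.of_zero]; exact zero_mem _
      | add M N hM hN => rw [RingDirectSum.of_add]; exact add_mem (hM trivial) (hN trivial)
      | unit p q a =>
        refine AddSubgroup.subset_closure ⟨RingDirectSum.of i (FinMat.unit p q a), _,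
          ⟨i, q, rfl⟩, ?_⟩
        rw [RingDirectSum.of_mul_of, FinMat.unit_mul_unit_same, mul_one]
  · rintro _ ⟨i, p, rfl⟩ n x hx hxu hx0
    have hcomp : ∀ j, j ≠ i → RingDirectSum.component K _ x j = 0 := by
      intro j hj
      rw [← hxu, RingDirectSum.component_mul, RingDirectSum.component_of_ne hj, mul_zero]
    have hcol : ∀ r s, s ≠ p → (RingDirectSum.component K _ x i).entry r s = 0 := by
      intro r s hs
      rw [← hxu, RingDirectSum.component_mul, RingDirectSum.component_of_same,
        FinMat.entry_mul_unit, if_neg hs]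
    obtain ⟨r, hr⟩ : ∃ r, (RingDirectSum.component K _ x i).entry r p ≠ 0 := by
      by_contra h
      push Not at h
      refine hx0 (RingDirectSum.ext fun j => ?_)
      by_cases hj : j = i
      · subst hj
        refine FinMat.ext fun r s => ?_
        by_cases hs : s = p
        · subst hs; exact h r
        · exact hcol r s hs
      · exact hcomp j hj
    obtain ⟨b, hb⟩ := div i _ _ (hx i r p) hr
    refine ⟨RingDirectSum.of i (FinMat.unit p r b), ?_⟩
    rw [RingDirectSum.of_mul]
    congr 1
    refine FinMat.ext fun k l => ?_
    rw [FinMat.entry_unit_mul, FinMat.entry_unit]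
    by_cases hl : l = p
    · subst hl; rw [hb]; simp
    · rw [hcol r l hl, mul_zero]; simp [hl]

theorem HasPrimitiveIdempotents.prod {R : Type u} {S : Type v} [NonUnitalRing R] [NonUnitalRing S]
    {𝒜 : ℤ → AddSubgroup R} {ℬ : ℤ → AddSubgroup S} {𝒞 : ℤ → AddSubgroup (R × S)}
    (h𝒞 : ∀ n x, x ∈ 𝒞 n ↔ x.1 ∈ 𝒜 n ∧ x.2 ∈ ℬ n) (hR : HasPrimitiveIdempotents 𝒜)
    (hS : HasPrimitiveIdempotents ℬ) : HasPrimitiveIdempotents 𝒞 := by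
  obtain ⟨U, hU, hUtop, hUmin⟩ := hR
  obtain ⟨W, hW, hWtop, hWmin⟩ := hS
  refine ⟨{u | (∃ a ∈ U, u = (a, 0)) ∨ ∃ b ∈ W, u = (0, b)}, ?_, ?_, ?_⟩
  · rintro _ (⟨a, ha, rfl⟩ | ⟨a, ha, rfl⟩)
    · refine ⟨(h𝒞 _ _).2 ⟨(hU a ha).1, zero_mem _⟩, ?_, fun h => (hU a ha).2.2 ?_⟩
      · rw [Prod.mk_mul_mk, (hU a ha).2.1, mul_zero]
      · exact congrArg Prod.fst h
    · refine ⟨(h𝒞 _ _).2 ⟨zero_mem _, (hW a ha).1⟩, ?_, fun h => (hW a ha).2.2 ?_⟩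
      · rw [Prod.mk_mul_mk, (hW a ha).2.1, mul_zero]
      · exact congrArg Prod.snd h
  · rw [eq_top_iff]
    rintro ⟨x, y⟩ -
    set C := AddSubgroup.closure {y : R × S | ∃ a, ∃ u ∈ {u : R × S | (∃ a ∈ U, u = (a, 0)) ∨
      ∃ b ∈ W, u = (0, b)}, y = a * u} with hC
    have h1 : AddSubgroup.closure {y | ∃ a, ∃ u ∈ U, y = a * u} ≤
        C.comap (AddMonoidHom.inl R S) := by
      refine (AddSubgroup.closure_le _).2 ?_
      rintro _ ⟨a, u, hu, rfl⟩
      exact AddSubgroup.subset_closure ⟨(a, 0), (u, 0), Or.inl ⟨u, hu, rfl⟩, by simp⟩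
    have h2 : AddSubgroup.closure {y | ∃ a, ∃ u ∈ W, y = a * u} ≤
        C.comap (AddMonoidHom.inr R S) := by
      refine (AddSubgroup.closure_le _).2 ?_
      rintro _ ⟨a, u, hu, rfl⟩
      exact AddSubgroup.subset_closure ⟨(0, a), (0, u), Or.inr ⟨u, hu, rfl⟩, by simp⟩
    rw [hUtop] at h1
    rw [hWtop] at h2
    have : (x, y) = (x, 0) + (0, y) := by simp
    rw [this]
    exact add_mem (h1 (AddSubgroup.mem_top x)) (h2 (AddSubgroup.mem_top y))
  · rintro _ (⟨a, ha, rfl⟩ | ⟨a, ha, rfl⟩) n ⟨x, y⟩ hx hxu hx0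
    · have h1 : x * a = x := congrArg Prod.fst hxu
      have h2 : y = 0 := by simpa using (congrArg Prod.snd hxu).symm
      subst h2
      obtain ⟨z, hz⟩ := hUmin a ha n x ((h𝒞 _ _).1 hx).1 h1 fun h => hx0 (by rw [h]; rfl)
      exact ⟨(z, 0), by rw [Prod.mk_mul_mk, hz, mul_zero]⟩
    · have h1 : y * a = y := congrArg Prod.snd hxu
      have h2 : x = 0 := by simpa using (congrArg Prod.fst hxu).symm
      subst h2
      obtain ⟨z, hz⟩ := hWmin a ha n y ((h𝒞 _ _).1 hx).2 h1 fun h => hx0 (by rw [h]; rfl)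
      exact ⟨(0, z), by rw [Prod.mk_mul_mk, hz, mul_zero]⟩

end GradedRingTheory

/-! ## The rings `K[x^t, x^{-t}]` -/

section Laurent

variable (K : Type w) [Field K]

/-- The substitution `x ↦ x^t` in `K[x, x⁻¹]`. -/
noncomputable def laurentExpand (t : ℕ) : K[T;T⁻¹] →ₐ[K] K[T;T⁻¹] :=
  AddMonoidAlgebra.mapDomainAlgHom K K (AddMonoidHom.mulLeft (t : ℤ))

variable {K}

theorem laurentExpand_single (t : ℕ) (n : ℤ) (r : K) :
    laurentExpand K t (.single n r) = .single (t * n) r :=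
  AddMonoidAlgebra.mapDomain_single

theorem coeff_laurentExpand {t : ℕ} (ht : 0 < t) (p : K[T;T⁻¹]) (n : ℤ) :
    (laurentExpand K t p).coeff (t * n) = p.coeff n := by
  have hinj : Function.Injective fun n : ℤ => (t : ℤ) * n :=
    mul_right_injective₀ (by exact_mod_cast ht.ne')
  exact Finsupp.mapDomain_apply hinj p.coeff n

theorem laurentExpand_injective {t : ℕ} (ht : 0 < t) : Function.Injective (laurentExpand K t) := by
  intro p q h
  refine LaurentPolynomial.ext fun n => ?_
  rw [← coeff_laurentExpand ht, h, coeff_laurentExpand ht]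

theorem range_laurentExpand (t : ℕ) : (laurentExpand K t).range = laurentSub K t := by
  apply le_antisymm
  · rintro _ ⟨p, rfl⟩
    change laurentExpand K t p ∈ _
    induction p using AddMonoidAlgebra.induction_linear with
    | zero => rw [map_zero]; exact zero_mem _
    | add p q hp hq => rw [map_add]; exact add_mem hp hq
    | single n r =>
      rw [laurentExpand_single]
      have hT : ∀ n : ℤ, (LaurentPolynomial.T (t * n) : K[T;T⁻¹]) ∈ laurentSub K t := by
        intro n
        obtain ⟨m, rfl | rfl⟩ := n.eq_nat_or_neg
        · rw [mul_comm, ← LaurentPolynomial.T_pow]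
          exact pow_mem (Algebra.subset_adjoin (by simp)) m
        · rw [show (t : ℤ) * -(m : ℤ) = m * -(t : ℤ) by ring, ← LaurentPolynomial.T_pow]
          exact pow_mem (Algebra.subset_adjoin (by simp)) m
      rw [LaurentPolynomial.single_eq_C_mul_T, ← LaurentPolynomial.smul_eq_C_mul]
      exact Subalgebra.smul_mem _ (hT n) r
  · refine Algebra.adjoin_le ?_
    rintro _ (rfl | rfl)
    · exact ⟨.single 1 1, by
        change laurentExpand K t _ = _
        rw [laurentExpand_single, mul_one]; rfl⟩
    · exact ⟨.single (-1) 1, by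
        change laurentExpand K t _ = _
        rw [laurentExpand_single, mul_neg, mul_one]; rfl⟩

/-- The isomorphism of `K[x, x⁻¹]` with `K[x^t, x^{-t}]` which maps `x` to `x^t`. -/
noncomputable def laurentEquiv {t : ℕ} (ht : 0 < t) : K[T;T⁻¹] ≃ₐ[K] LaurentRing K t :=
  (AlgEquiv.ofInjective _ (laurentExpand_injective ht)).trans
    (Subalgebra.equivOfEq _ _ (range_laurentExpand t))

/-- Under `x ↦ x^t` the monomial `x^k` acquires degree `t k`. -/
theorem mem_laurentGrading_iff {t : ℕ} (ht : 0 < t) {n : ℤ} {p : K[T;T⁻¹]} :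
    laurentEquiv ht p ∈ laurentGrading K t n ↔ ∀ k, p.coeff k ≠ 0 → t * k = n := by
  change laurentExpand K t p ∈ AddMonoidAlgebra.grade K n ↔ _
  constructor
  · intro h k hk
    refine h _ (Finsupp.mem_support_iff.2 ?_)
    rwa [coeff_laurentExpand ht]
  · intro h
    have : p = p.coeff.sum AddMonoidAlgebra.single := (AddMonoidAlgebra.sum_coeff_single p).symm
    rw [this, Finsupp.sum, map_sum]
    refine sum_mem fun k hk => ?_
    rw [laurentExpand_single, h k (Finsupp.mem_support_iff.1 hk)]
    exact AddMonoidAlgebra.single_mem_grade _ _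

instance (t : ℕ) : Nontrivial (LaurentRing K t) :=
  inferInstanceAs (Nontrivial (laurentSub K t))

theorem one_mem_laurentGrading (t : ℕ) : (1 : LaurentRing K t) ∈ laurentGrading K t 0 := by
  change LaurentRing.incl K t 1 ∈ AddMonoidAlgebra.grade K 0
  rw [map_one]
  exact AddMonoidAlgebra.single_mem_grade _ _

/-- For `t > 0` distinct powers of `x^t` have distinct degrees, so a non-zero homogeneous element is
a monomial and therefore invertible. -/
theorem exists_mul_eq_one_of_mem_laurentGrading {t : ℕ} (ht : 0 < t) {n : ℤ} {a : LaurentRing K t}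
    (ha : a ∈ laurentGrading K t n) (ha0 : a ≠ 0) : ∃ b, b * a = 1 := by
  obtain ⟨p, rfl⟩ := (laurentEquiv ht).surjective a
  rw [mem_laurentGrading_iff ht] at ha
  have hp : p ≠ 0 := fun h => ha0 (by rw [h, map_zero])
  obtain ⟨k, hk⟩ : ∃ k, p.coeff k ≠ 0 := by
    by_contra h
    push Not at h
    exact hp (LaurentPolynomial.ext h)
  have hpk : p = .single k (p.coeff k) := by
    refine LaurentPolynomial.ext fun m => ?_
    rw [AddMonoidAlgebra.coeff_single, Finsupp.single_apply]
    split_ifs with h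
    · rw [h]
    · by_contra hm
      refine h (mul_left_cancel₀ (a := (t : ℤ)) (by exact_mod_cast ht.ne') ?_)
      rw [ha k hk, ha m hm]
  refine ⟨laurentEquiv ht (.single (-k) (p.coeff k)⁻¹), ?_⟩
  rw [← map_mul]
  conv_lhs => rw [hpk]
  rw [AddMonoidAlgebra.single_mul_single, AddMonoidAlgebra.coeff_single, Finsupp.single_eq_same,
    inv_mul_cancel₀ hk, neg_add_cancel]
  exact map_one _

theorem one_mem_fieldGrading : (1 : K) ∈ fieldGrading K 0 := by simp [fieldGrading]

theorem MatrixSum.hasPrimitiveIdempotents {I : Type u} {J : Type v} (Λ : I → Type (max u v))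
    (Υ : J → Type (max u v)) (t : J → ℕ) (ht : ∀ j, 0 < t j) (δ : ∀ i, Λ i → ℤ)
    (ε : ∀ j, Υ j → ℤ) :
    GradedRingTheory.HasPrimitiveIdempotents fun n =>
      (MatrixSum.grading K Λ Υ t δ ε n).toAddSubgroup :=
  GradedRingTheory.HasPrimitiveIdempotents.prod (fun _ _ => Iff.rfl)
    (GradedRingTheory.HasPrimitiveIdempotents.ringDirectSum (fun _ => fieldGrading K) δ
      (fun _ => one_mem_fieldGrading) fun _ _ a _ ha => ⟨a⁻¹, inv_mul_cancel₀ ha⟩)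
    (GradedRingTheory.HasPrimitiveIdempotents.ringDirectSum (fun j => laurentGrading K (t j)) ε
      (fun _ => one_mem_laurentGrading _) fun j _ _ h h0 =>
        exists_mul_eq_one_of_mem_laurentGrading (ht j) h h0)

theorem GradedIso.hasPrimitiveIdempotents {A : Type u} {B : Type v} [NonUnitalRing A]
    [NonUnitalRing B] [Module K A] [Module K B] {𝒜 : ℤ → Submodule K A} {ℬ : ℤ → Submodule K B}
    (h : GradedIso K A B 𝒜 ℬ)
    (hB : GradedRingTheory.HasPrimitiveIdempotents fun n => (ℬ n).toAddSubgroup) :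
    GradedRingTheory.HasPrimitiveIdempotents fun n => (𝒜 n).toAddSubgroup := by
  obtain ⟨φ, hφ, hdeg⟩ := h
  exact hB.of_equiv (φ : A →ₙ+* B) hφ hdeg

end Laurent

/-! ## Graded matrix units -/

/-- Graded matrix units in a graded algebra `U`: for each `i`, elements `row i p` and `col i p`
with `col i p * row i q = δ_{pq} v i`, together with a homomorphism from the coefficient ring `A i`
to `U` whose image commutes with the idempotent `v i`. -/
structure MatrixUnits (K : Type w) [Field K] {U : Type*} [Ring U] [Algebra K U]
    (𝒰 : ℤ → Submodule K U) {I : Type*} {Λ : I → Type*} {A : I → Type*} [∀ i, Ring (A i)]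
    [∀ i, Algebra K (A i)] (𝒜 : ∀ i, ℤ → Submodule K (A i)) (δ : ∀ i, Λ i → ℤ) where
  v : I → U
  row : ∀ i, Λ i → U
  col : ∀ i, Λ i → U
  coef : ∀ i, A i →ₐ[K] U
  row_mul : ∀ i p, row i p * v i = row i p
  mul_col : ∀ i p, v i * col i p = col i p
  comm : ∀ i a, v i * coef i a = coef i a * v i
  col_mul_row : ∀ i p, col i p * row i p = v i
  col_mul_row_of_ne : ∀ i p q, p ≠ q → col i p * row i q = 0
  col_mul_row_of_index_ne : ∀ i j p q, i ≠ j → col i p * row j q = 0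
  row_mem : ∀ i p, row i p ∈ 𝒰 (δ i p)
  col_mem : ∀ i p, col i p ∈ 𝒰 (-δ i p)
  coef_mul_mem : ∀ i n a, coef i a * v i ∈ 𝒰 n ↔ a ∈ 𝒜 i n
  eq_zero : ∀ i a, coef i a * v i = 0 → a = 0

namespace MatrixUnits

variable {K : Type w} [Field K] {U : Type*} [Ring U] [Algebra K U]
  {𝒰 : ℤ → Submodule K U} {I : Type*} {Λ : I → Type*} {A : I → Type*} [∀ i, Ring (A i)]
  [∀ i, Algebra K (A i)] {𝒜 : ∀ i, ℤ → Submodule K (A i)} {δ : ∀ i, Λ i → ℤ}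
  (S : MatrixUnits K 𝒰 𝒜 δ)

/-- The image of the matrix `e_pq(a)`. -/
def elt (i : I) (p q : Λ i) : A i →ₗ[K] U :=
  (LinearMap.mulLeft K (S.row i p)).comp
    ((LinearMap.mulRight K (S.col i q)).comp (S.coef i).toLinearMap)

theorem elt_apply (i : I) (p q : Λ i) (a : A i) :
    S.elt i p q a = S.row i p * (S.coef i a * S.col i q) := rfl

/-- The linear map from the matrices of index `i` to `U`. -/
noncomputable def matrixMap (i : I) : FinMat (Λ i) (A i) →ₗ[K] U :=
  Finsupp.lsum K fun pq : Λ i × Λ i => S.elt i pq.1 pq.2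

theorem matrixMap_apply (i : I) (M : FinMat (Λ i) (A i)) :
    S.matrixMap i M = Finsupp.sum M fun pq a => S.elt i pq.1 pq.2 a := rfl

theorem matrixMap_unit (i : I) (p q : Λ i) (a : A i) :
    S.matrixMap i (FinMat.unit p q a) = S.elt i p q a := by
  rw [matrixMap_apply]
  exact Finsupp.sum_single_index (h := fun (pq : Λ i × Λ i) (a : A i) => S.elt i pq.1 pq.2 a) (map_zero _)

theorem v_mul_coef_mul_col (i : I) (q : Λ i) (a : A i) :
    S.v i * (S.coef i a * S.col i q) = S.coef i a * S.col i q := by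
  rw [← mul_assoc, S.comm, mul_assoc, S.mul_col]

theorem elt_mul_elt (i : I) (p q r : Λ i) (a b : A i) :
    S.elt i p q a * S.elt i q r b = S.elt i p r (a * b) := by
  have : S.elt i p q a * S.elt i q r b = S.row i p * (S.coef i a *
      (S.col i q * S.row i q * (S.coef i b * S.col i r))) := by
    simp only [elt_apply, mul_assoc]
  rw [this, S.col_mul_row, v_mul_coef_mul_col, elt_apply, map_mul, mul_assoc]

theorem elt_mul_elt_of_col_mul_row (i j : I) (p q : Λ i) (r s : Λ j) (a : A i) (b : A j)
    (h : S.col i q * S.row j r = 0) : S.elt i p q a * S.elt j r s b = 0 := by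
  have : S.elt i p q a * S.elt j r s b = S.row i p * (S.coef i a *
      (S.col i q * S.row j r * (S.coef j b * S.col j s))) := by
    simp only [elt_apply, mul_assoc]
  rw [this, h, zero_mul, mul_zero, mul_zero]

theorem matrixMap_mul (i : I) (M N : FinMat (Λ i) (A i)) :
    S.matrixMap i (M * N) = S.matrixMap i M * S.matrixMap i N := by
  classical
  induction M using FinMat.induction_on with
  | zero => rw [zero_mul, map_zero, zero_mul]
  | add M M' h h' => rw [add_mul, map_add, map_add, h, h', add_mul]
  | unit p q a =>
    induction N using FinMat.induction_on with
    | zero => rw [mul_zero, map_zero, mul_zero]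
    | add N N' h h' => rw [mul_add, map_add, map_add, h, h', mul_add]
    | unit r s b =>
      rw [FinMat.unit_mul_unit, matrixMap_unit, matrixMap_unit]
      split_ifs with h
      · subst h; rw [elt_mul_elt, matrixMap_unit]
      · rw [S.elt_mul_elt_of_col_mul_row _ _ _ _ _ _ _ _ (S.col_mul_row_of_ne i q r h), map_zero]

theorem matrixMap_mul_of_ne {i j : I} (hij : i ≠ j) (M : FinMat (Λ i) (A i))
    (N : FinMat (Λ j) (A j)) : S.matrixMap i M * S.matrixMap j N = 0 := by
  induction M using FinMat.induction_on with
  | zero => rw [map_zero, zero_mul]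
  | add M M' h h' => rw [map_add, add_mul, h, h', add_zero]
  | unit p q a =>
    induction N using FinMat.induction_on with
    | zero => rw [map_zero, mul_zero]
    | add N N' h h' => rw [map_add, mul_add, h, h', add_zero]
    | unit r s b =>
      rw [matrixMap_unit, matrixMap_unit]
      exact S.elt_mul_elt_of_col_mul_row _ _ _ _ _ _ _ _ (S.col_mul_row_of_index_ne i j q r hij)

theorem finite_support (f : RingDirectSum K fun i => FinMat (Λ i) (A i)) :
    (Function.support fun i => S.matrixMap i (RingDirectSum.component K _ f i)).Finite :=
  (RingDirectSum.finite_support f).subset fun i hi h => hi (by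
    change S.matrixMap i (RingDirectSum.component K _ f i) = 0
    rw [h, map_zero])

/-- The linear map from the direct sum of the matrix rings to `U`. -/
noncomputable def sumMap : (RingDirectSum K fun i => FinMat (Λ i) (A i)) →ₗ[K] U where
  toFun f := ∑ᶠ i, S.matrixMap i (RingDirectSum.component K _ f i)
  map_add' f g := by
    rw [← finsum_add_distrib (S.finite_support f) (S.finite_support g)]
    exact finsum_congr fun i => by rw [RingDirectSum.component_add, map_add]
  map_smul' k f := by
    rw [RingHom.id_apply, smul_finsum' _ (S.finite_support f)]
    exact finsum_congr fun i => by rw [RingDirectSum.component_smul, map_smul]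

theorem sumMap_apply (f : RingDirectSum K fun i => FinMat (Λ i) (A i)) :
    S.sumMap f = ∑ᶠ i, S.matrixMap i (RingDirectSum.component K _ f i) := rfl

theorem sumMap_of (i : I) (M : FinMat (Λ i) (A i)) :
    S.sumMap (RingDirectSum.of i M) = S.matrixMap i M := by
  rw [sumMap_apply, finsum_eq_single _ i, RingDirectSum.component_of_same]
  intro j hj
  rw [RingDirectSum.component_of_ne hj, map_zero]

theorem sumMap_mul (f g : RingDirectSum K fun i => FinMat (Λ i) (A i)) :
    S.sumMap (f * g) = S.sumMap f * S.sumMap g := by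
  induction f using RingDirectSum.induction_on with
  | zero => rw [zero_mul, map_zero, zero_mul]
  | add M M' h h' => rw [add_mul, map_add, map_add, h, h', add_mul]
  | of i M =>
    induction g using RingDirectSum.induction_on with
    | zero => rw [mul_zero, map_zero, mul_zero]
    | add N N' h h' => rw [mul_add, map_add, map_add, h, h', mul_add]
    | of j N =>
      by_cases hij : i = j
      · subst hij
        rw [RingDirectSum.of_mul_of, sumMap_of, sumMap_of, sumMap_of, matrixMap_mul]
      · rw [RingDirectSum.of_mul_of_ne hij, sumMap_of, sumMap_of, matrixMap_mul_of_ne _ hij,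
          map_zero]

/-- An additive property of the elements `elt i p q a` holds on the image of `sumMap`. -/
theorem sumMap_induction {P : U → Prop} (zero : P 0) (add : ∀ x y, P x → P y → P (x + y))
    (elt : ∀ i p q a, P (S.elt i p q a)) (f : RingDirectSum K fun i => FinMat (Λ i) (A i)) :
    P (S.sumMap f) := by
  induction f using RingDirectSum.induction_on with
  | zero => rw [map_zero]; exact zero
  | add f g hf hg => rw [map_add]; exact add _ _ hf hg
  | of i M =>
    rw [sumMap_of]
    induction M using FinMat.induction_on with
    | zero => rw [map_zero]; exact zero
    | add f g hf hg => rw [map_add]; exact add _ _ hf hg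
    | unit p q a => rw [matrixMap_unit]; exact elt i p q a

/-- All units except the one in position `(p, q)` of the summand `i` are killed by orthogonality.
Since `coef i a * v i` determines `a` and its degree, this recovers a matrix from its image and is
the source of both injectivity and compatibility with the gradings. -/
theorem col_mul_sumMap_mul_row (f : RingDirectSum K fun i => FinMat (Λ i) (A i)) (i : I)
    (p q : Λ i) : S.col i p * S.sumMap f * S.row i q =
      S.coef i ((RingDirectSum.component K _ f i).entry p q) * S.v i := by
  classical
  have hassoc : ∀ j (r s : Λ j) a, S.col i p * S.elt j r s a * S.row i q =
      (S.col i p * S.row j r) * (S.coef j a * (S.col j s * S.row i q)) := by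
    intro j r s a
    simp only [elt_apply, mul_assoc]
  induction f using RingDirectSum.induction_on with
  | zero =>
    rw [RingDirectSum.component_zero, FinMat.entry_zero, map_zero, map_zero, mul_zero, zero_mul,
      zero_mul]
  | add f g hf hg =>
    rw [RingDirectSum.component_add, FinMat.entry_add, map_add, map_add, mul_add, add_mul, hf, hg,
      add_mul]
  | of j M =>
    rw [sumMap_of]
    by_cases hij : i = j
    · subst hij
      rw [RingDirectSum.component_of_same]
      induction M using FinMat.induction_on with
      | zero => rw [FinMat.entry_zero, map_zero, map_zero, mul_zero, zero_mul, zero_mul]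
      | add f g hf hg => rw [FinMat.entry_add, map_add, map_add, mul_add, add_mul, hf, hg, add_mul]
      | unit r s a =>
        rw [matrixMap_unit, FinMat.entry_unit, hassoc]
        by_cases hr : p = r
        · by_cases hs : q = s
          · subst hr hs
            rw [if_pos ⟨rfl, rfl⟩, S.col_mul_row, S.col_mul_row, ← mul_assoc, S.comm, mul_assoc]
            congr 1
            -- Idempotency of `v i` is not among the axioms; it follows from `col * row = v` and
            -- `row * v = row`.
            calc S.v i * S.v i = S.col i p * S.row i p * S.v i := by rw [S.col_mul_row]
              _ = S.v i := by rw [mul_assoc, S.row_mul, S.col_mul_row]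
          · rw [if_neg fun h => hs h.2, S.col_mul_row_of_ne i s q (Ne.symm hs), mul_zero,
              mul_zero, map_zero, zero_mul]
        · rw [if_neg fun h => hr h.1, S.col_mul_row_of_ne i p r hr, zero_mul, map_zero, zero_mul]
    · rw [RingDirectSum.component_of_ne hij, FinMat.entry_zero, map_zero, zero_mul]
      induction M using FinMat.induction_on with
      | zero => rw [map_zero, mul_zero, zero_mul]
      | add f g hf hg => rw [map_add, mul_add, add_mul, hf, hg, add_zero]
      | unit r s a =>
        rw [matrixMap_unit, hassoc, S.col_mul_row_of_index_ne i j p r hij, zero_mul]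

theorem sumMap_mem (hmul : ∀ {m n : ℤ} {x y : U}, x ∈ 𝒰 m → y ∈ 𝒰 n → x * y ∈ 𝒰 (m + n))
    {f : RingDirectSum K fun i => FinMat (Λ i) (A i)} {n : ℤ}
    (hf : f ∈ RingDirectSum.grading K _ (fun i => FinMat.grading (𝒜 i) (δ i)) n) :
    S.sumMap f ∈ 𝒰 n := by
  rw [sumMap_apply]
  refine finsum_induction (· ∈ 𝒰 n) (zero_mem _) (fun _ _ => add_mem) fun i => ?_
  rw [matrixMap_apply]
  refine sum_mem fun pq _ => ?_
  have h1 := (S.coef_mul_mem i _ _).2 (hf i pq.1 pq.2)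
  have h2 := hmul (hmul (S.row_mem i pq.1) h1) (S.col_mem i pq.2)
  rw [mul_assoc, mul_assoc, S.mul_col] at h2
  have e : δ i pq.1 + (n + δ i pq.2 - δ i pq.1) + -δ i pq.2 = n := by ring
  rw [e] at h2
  exact h2

theorem entry_mem (hmul : ∀ {m n : ℤ} {x y : U}, x ∈ 𝒰 m → y ∈ 𝒰 n → x * y ∈ 𝒰 (m + n))
    {f : RingDirectSum K fun i => FinMat (Λ i) (A i)} {n : ℤ} {i : I} {p q : Λ i}
    {x : U} (hx : x ∈ 𝒰 n) (hfx : S.col i p * S.sumMap f * S.row i q = S.col i p * x * S.row i q) :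
    (RingDirectSum.component K _ f i).entry p q ∈ 𝒜 i (n + δ i q - δ i p) := by
  rw [← S.coef_mul_mem, ← S.col_mul_sumMap_mul_row, hfx]
  have := hmul (hmul (S.col_mem i p) hx) (S.row_mem i q)
  convert this using 2
  ring

theorem eq_zero_of_col_mul_sumMap_mul_row {f : RingDirectSum K fun i => FinMat (Λ i) (A i)}
    (h : ∀ i p q, S.col i p * S.sumMap f * S.row i q = 0) : f = 0 := by
  refine RingDirectSum.ext fun i => FinMat.ext fun p q => ?_
  rw [RingDirectSum.component_zero, FinMat.entry_zero]
  refine S.eq_zero i _ ?_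
  rw [← S.col_mul_sumMap_mul_row, h]

section cross

variable {J : Type*} {Υ : J → Type*} {B : J → Type*} [∀ i, Ring (B i)]
  [∀ i, Algebra K (B i)] {ℬ : ∀ i, ℤ → Submodule K (B i)} {ε : ∀ i, Υ i → ℤ}
  {S} {S' : MatrixUnits K 𝒰 ℬ ε}

theorem col_mul_sumMap_eq_zero (h : ∀ i p j q, S.col i p * S'.row j q = 0) (i : I) (p : Λ i)
    (g : RingDirectSum K fun j => FinMat (Υ j) (B j)) : S.col i p * S'.sumMap g = 0 := by
  refine S'.sumMap_induction (P := fun x => S.col i p * x = 0) (mul_zero _) ?_ ?_ g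
  · intro x y hx hy; rw [mul_add, hx, hy, add_zero]
  · intro j q r a; rw [elt_apply, ← mul_assoc, h, zero_mul]

theorem sumMap_mul_sumMap_eq_zero (h : ∀ i p j q, S.col i p * S'.row j q = 0)
    (f : RingDirectSum K fun i => FinMat (Λ i) (A i))
    (g : RingDirectSum K fun j => FinMat (Υ j) (B j)) : S.sumMap f * S'.sumMap g = 0 := by
  refine S.sumMap_induction (P := fun x => x * S'.sumMap g = 0) (zero_mul _) ?_ ?_ f
  · intro x y hx hy; rw [add_mul, hx, hy, add_zero]
  · intro j q r a
    rw [elt_apply, mul_assoc, mul_assoc, col_mul_sumMap_eq_zero h, mul_zero, mul_zero]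

variable (S S') in
/-- The homomorphism given by two orthogonal systems of matrix units. -/
noncomputable def prodMap (h : ∀ i p j q, S.col i p * S'.row j q = 0)
    (h' : ∀ i p j q, S'.col i p * S.row j q = 0) :
    (RingDirectSum K fun i => FinMat (Λ i) (A i)) × (RingDirectSum K fun j => FinMat (Υ j) (B j))
      →ₙₐ[K] U where
  toFun x := S.sumMap x.1 + S'.sumMap x.2
  map_smul' k x := by
    change S.sumMap (k • x.1) + S'.sumMap (k • x.2) = k • _
    rw [map_smul, map_smul, smul_add]
  map_zero' := by
    change S.sumMap 0 + S'.sumMap 0 = 0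
    rw [map_zero, map_zero, add_zero]
  map_add' x y := by
    change S.sumMap (x.1 + y.1) + S'.sumMap (x.2 + y.2) = _
    rw [map_add, map_add]; abel
  map_mul' x y := by
    change S.sumMap (x.1 * y.1) + S'.sumMap (x.2 * y.2) = _
    rw [sumMap_mul, sumMap_mul, add_mul, mul_add, mul_add, sumMap_mul_sumMap_eq_zero h,
      sumMap_mul_sumMap_eq_zero h', add_zero, zero_add]

variable (h : ∀ i p j q, S.col i p * S'.row j q = 0) (h' : ∀ i p j q, S'.col i p * S.row j q = 0)

theorem prodMap_apply
    (x : (RingDirectSum K fun i => FinMat (Λ i) (A i)) ×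
      (RingDirectSum K fun j => FinMat (Υ j) (B j))) :
    S.prodMap S' h h' x = S.sumMap x.1 + S'.sumMap x.2 := rfl

theorem elt_mem_range_prodMap (i : I) (p q : Λ i) (a : A i) :
    S.elt i p q a ∈ Set.range (S.prodMap S' h h') :=
  ⟨(RingDirectSum.of i (FinMat.unit p q a), 0), by
    rw [prodMap_apply, map_zero, add_zero, sumMap_of, matrixMap_unit]⟩

theorem elt_mem_range_prodMap' (j : J) (p q : Υ j) (a : B j) :
    S'.elt j p q a ∈ Set.range (S.prodMap S' h h') :=
  ⟨(0, RingDirectSum.of j (FinMat.unit p q a)), by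
    rw [prodMap_apply, map_zero, zero_add, sumMap_of, matrixMap_unit]⟩

theorem col_mul_prodMap_mul_row
    (x : (RingDirectSum K fun i => FinMat (Λ i) (A i)) ×
      (RingDirectSum K fun j => FinMat (Υ j) (B j))) (i : I) (p q : Λ i) :
    S.col i p * S.prodMap S' h h' x * S.row i q = S.col i p * S.sumMap x.1 * S.row i q := by
  rw [prodMap_apply, mul_add, col_mul_sumMap_eq_zero h, add_zero]

theorem col_mul_prodMap_mul_row'
    (x : (RingDirectSum K fun i => FinMat (Λ i) (A i)) ×
      (RingDirectSum K fun j => FinMat (Υ j) (B j))) (i : J) (p q : Υ i) :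
    S'.col i p * S.prodMap S' h h' x * S'.row i q = S'.col i p * S'.sumMap x.2 * S'.row i q := by
  rw [prodMap_apply, mul_add, col_mul_sumMap_eq_zero h', zero_add]

/-- The columns of each system annihilate the image of the other one, so that the entries of the two
components can be recovered separately. -/
theorem prodMap_injective : Function.Injective (S.prodMap S' h h') := by
  refine (injective_iff_map_eq_zero _).2 fun x hx => Prod.ext ?_ ?_
  · refine S.eq_zero_of_col_mul_sumMap_mul_row fun i p q => ?_
    rw [← col_mul_prodMap_mul_row h h', hx, mul_zero, zero_mul]
  · refine S'.eq_zero_of_col_mul_sumMap_mul_row fun i p q => ?_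
    rw [← col_mul_prodMap_mul_row' h h', hx, mul_zero, zero_mul]

theorem prodMap_mem_iff
    (hmul : ∀ {m n : ℤ} {x y : U}, x ∈ 𝒰 m → y ∈ 𝒰 n → x * y ∈ 𝒰 (m + n)) {n : ℤ}
    {x : (RingDirectSum K fun i => FinMat (Λ i) (A i)) ×
      (RingDirectSum K fun j => FinMat (Υ j) (B j))} :
    S.prodMap S' h h' x ∈ 𝒰 n ↔
      x.1 ∈ RingDirectSum.grading K _ (fun i => FinMat.grading (𝒜 i) (δ i)) n ∧
      x.2 ∈ RingDirectSum.grading K _ (fun i => FinMat.grading (ℬ i) (ε i)) n := by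
  refine ⟨fun hx => ⟨fun i p q => ?_, fun i p q => ?_⟩, fun hx => ?_⟩
  · exact S.entry_mem hmul hx (col_mul_prodMap_mul_row h h' x i p q).symm
  · exact S'.entry_mem hmul hx (col_mul_prodMap_mul_row' h h' x i p q).symm
  · exact add_mem (S.sumMap_mem hmul hx.1) (S'.sumMap_mem hmul hx.2)

end cross

end MatrixUnits

theorem GradedIso.symm {K : Type w} [Field K] {A : Type u} {B : Type v} [NonUnitalRing A]
    [NonUnitalRing B] [Module K A] [Module K B] {𝒜 : ℤ → Submodule K A} {ℬ : ℤ → Submodule K B}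
    (h : GradedIso K A B 𝒜 ℬ) : GradedIso K B A ℬ 𝒜 := by
  obtain ⟨φ, hφ, hdeg⟩ := h
  obtain ⟨ψ, h1, h2⟩ := Function.bijective_iff_has_inverse.1 hφ
  refine ⟨NonUnitalAlgHom.inverse φ ψ h1 h2, ?_, fun n b => ?_⟩
  · exact Function.bijective_iff_has_inverse.2 ⟨φ, h2, h1⟩
  · change b ∈ ℬ n ↔ ψ b ∈ 𝒜 n
    rw [hdeg, h2]

/-- It permits the construction to take place in the unitization, where a cycle without exits can be
completed to a unit. -/
theorem LeavittPathAlgebra.gradedIso_of_injective (K : Type w) [Field K] {V : Type u} {E : Type v}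
    (G : DirGraph V E) {B : Type*} [NonUnitalRing B] [Module K B] {ℬ : ℤ → Submodule K B}
    (φ : B →ₙₐ[K] Leavitt.Unital K G) (hinj : Function.Injective φ)
    (hrange : Set.range φ = Leavitt.algebra K G)
    (hdeg : ∀ n b, φ b ∈ Leavitt.homog K G n ↔ b ∈ ℬ n) :
    GradedIso K (LeavittPathAlgebra K G) B (LeavittPathAlgebra.grading K G) ℬ := by
  have hmem : ∀ b, φ b ∈ Leavitt.algebra K G := fun b => by
    rw [← SetLike.mem_coe, ← hrange]; exact ⟨b, rfl⟩
  let ψ : B →ₙₐ[K] LeavittPathAlgebra K G := NonUnitalAlgHom.codRestrict φ (Leavitt.algebra K G) hmem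
  have hψ : ∀ b, LeavittPathAlgebra.incl K G (ψ b) = φ b := fun b => rfl
  refine GradedIso.symm ⟨ψ, ⟨fun b b' hb => hinj ?_, fun x => ?_⟩, fun n b => ?_⟩
  · rw [← hψ, hb, hψ]
  · have hx : LeavittPathAlgebra.incl K G x ∈ Set.range φ := by
      rw [hrange]; exact LeavittPathAlgebra.incl_mem x
    obtain ⟨b, hb⟩ := hx
    exact ⟨b, LeavittPathAlgebra.incl_injective (by rw [hψ, hb])⟩
  · rw [LeavittPathAlgebra.mem_grading_iff, hψ, hdeg]

/-! ## Line points and cycles without exits -/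

namespace DirGraph

variable {V : Type u} {E : Type v} {G : DirGraph V E}

theorem mem_tree_self (a : V) : a ∈ G.tree a := ⟨[], rfl⟩

theorem mem_tree_trans {a b c : V} (h : b ∈ G.tree a) (h' : c ∈ G.tree b) : c ∈ G.tree a := by
  obtain ⟨l, hl⟩ := h
  obtain ⟨m, hm⟩ := h'
  exact ⟨l ++ m, hl.append hm⟩

/-- A repeated vertex cuts out a closed segment. With `l₃ ≠ []` this segment is shorter than the
whole path, even if the latter is closed, as needed for a descent. -/
theorem IsPath.nodup_or_exists {a b : V} {l : List E} (h : G.IsPath a l b) :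
    (l.map G.src).Nodup ∨ ∃ l₁ l₂ l₃ d, l = l₁ ++ l₂ ++ l₃ ∧ l₂ ≠ [] ∧ l₃ ≠ [] ∧
      G.IsPath a l₁ d ∧ G.IsPath d l₂ d := by
  induction l generalizing a with
  | nil => exact Or.inl List.nodup_nil
  | cons e l ih =>
    obtain ⟨rfl, h2⟩ := h
    rcases ih h2 with hl | ⟨l₁, l₂, l₃, d, rfl, hne, hne', h1, h3⟩
    · by_cases he : G.src e ∈ l.map G.src
      · obtain ⟨f, hf, hfe⟩ := List.mem_map.1 he
        obtain ⟨s, t, rfl⟩ := List.append_of_mem hf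
        obtain ⟨b', hs, ht⟩ := isPath_append.1 h2
        refine Or.inr ⟨[], e :: s, f :: t, G.src e, rfl, by simp, by simp, rfl, rfl, ?_⟩
        rwa [← hfe, ht.1]
      · exact Or.inl (List.nodup_cons.2 ⟨he, hl⟩)
    · exact Or.inr ⟨e :: l₁, l₂, l₃, d, rfl, hne, hne', ⟨rfl, h1⟩, h3⟩

/-- Passing to shorter closed segments must end with one that repeats no vertex. The base vertex may
change but stays in the tree. -/
theorem IsPath.exists_isCycleAt {a : V} {l : List E} (h : G.IsPath a l a) (hl : l ≠ []) :
    ∃ b ∈ G.tree a, ∃ c, G.IsCycleAt b c := by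
  induction hn : l.length using Nat.strong_induction_on generalizing a l with
  | _ n ih =>
    subst hn
    rcases h.nodup_or_exists with hnd | ⟨l₁, l₂, l₃, d, rfl, hne, hne', h1, h2⟩
    · exact ⟨a, mem_tree_self a, l, hl, h, hnd⟩
    · have : l₂.length < (l₁ ++ l₂ ++ l₃).length := by
        have := List.length_pos_iff.2 hne'
        simp only [List.length_append]; omega
      obtain ⟨b, hb, hc⟩ := ih _ this h2 hne rfl
      exact ⟨b, mem_tree_trans ⟨_, h1⟩ hb, hc⟩

theorem IsPath.prefix_or_prefix {a b d : V} {l m : List E}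
    (ha : ∀ x ∈ G.tree a, ¬ G.IsBifurcation x) (hl : G.IsPath a l b) (hm : G.IsPath a m d) :
    l <+: m ∨ m <+: l := by
  induction l generalizing a m with
  | nil => exact Or.inl List.nil_prefix
  | cons e l ih =>
    cases m with
    | nil => exact Or.inr List.nil_prefix
    | cons f m =>
      have := eq_of_not_isBifurcation (ha a (mem_tree_self a)) hl.1 hm.1
      subst this
      have := ih (fun x hx => ha x (mem_tree_trans ⟨[e], hl.1, rfl⟩ hx)) hl.2 hm.2
      simpa [List.cons_prefix_cons] using this

theorem IsLinePoint.of_mem_tree {a b : V} (ha : G.IsLinePoint a) (hb : b ∈ G.tree a) :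
    G.IsLinePoint b := fun _ hx => ha _ (mem_tree_trans hb hx)

/-- Without bifurcations one path is a prefix of the other. The remainder is a closed path, which if
non-empty would yield a cycle in the tree. -/
theorem IsLinePoint.path_unique {a b : V} (ha : G.IsLinePoint a) {l m : List E}
    (hl : G.IsPath a l b) (hm : G.IsPath a m b) : l = m := by
  have key : ∀ {l m : List E}, G.IsPath a l b → G.IsPath a m b → l <+: m → l = m := by
    rintro l _ hl hm ⟨r, rfl⟩
    obtain ⟨b', h1, h2⟩ := isPath_append.1 hm
    obtain rfl := hl.finish_unique h1
    by_contra hr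
    have hr : r ≠ [] := fun h => hr (by rw [h, List.append_nil])
    obtain ⟨d, hd, hc⟩ := h2.exists_isCycleAt hr
    exact (ha d (mem_tree_trans ⟨l, h1⟩ hd)).2 hc
  rcases hl.prefix_or_prefix (fun x hx => (ha x hx).1) hm with h | h
  · exact key hl hm h
  · exact (key hm hl h).symm

theorem IsLinePoint.dist_eq {a b : V} (ha : G.IsLinePoint a) {l : List E} (hl : G.IsPath a l b) :
    G.dist a b = l.length := by
  have : {n | ∃ l, G.IsPath a l b ∧ l.length = n} = {l.length} := by
    ext n
    constructor
    · rintro ⟨m, hm, rfl⟩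
      rw [ha.path_unique hm hl]; rfl
    · rintro rfl
      exact ⟨l, hl, rfl⟩
  rw [dist, this, csInf_singleton]

theorem IsPath.src_mem_tree {a b : V} {l : List E} (h : G.IsPath a l b) {e : E} (he : e ∈ l) :
    G.src e ∈ G.tree a := by
  obtain ⟨s, t, rfl⟩ := List.append_of_mem he
  obtain ⟨d, hs, ht⟩ := isPath_append.1 h
  exact ⟨s, by rw [ht.1]; exact hs⟩

theorem IsLinePoint.eq_of_src_eq {a b : V} (ha : G.IsLinePoint a) {l : List E}
    (hl : G.IsPath a l b) : ∀ e ∈ l, ∀ f, G.src f = G.src e → f = e := fun _ he _ hf =>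
  eq_of_not_isBifurcation (ha _ (hl.src_mem_tree he)).1 hf rfl

theorem IsLinePointReps.eq {X : Set V} (hX : G.IsLinePointReps X) {x y : V} (hx : x ∈ X)
    (hy : y ∈ X) {b : V} (hbx : b ∈ G.tree x) (hby : b ∈ G.tree y) : x = y :=
  (hX.2 x (hX.1 x hx)).unique ⟨hx, b, hbx, hbx⟩ ⟨hy, b, hbx, hby⟩

/-- Each path ending in the tree of `x` enters this tree at the end of an initial segment. -/
theorem IsPath.exists_linePaths {x a b : V} {l : List E} (h : G.IsPath a l b)
    (hb : b ∈ G.tree x) : ∃ (p : G.LinePaths x) (m : List E), p.1.start = a ∧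
      l = p.1.edges ++ m ∧ G.IsPath p.1.finish m b := by
  induction l generalizing a with
  | nil => exact ⟨⟨⟨a, [], b, h⟩, hb, by simp⟩, [], rfl, rfl, rfl⟩
  | cons e l ih =>
    by_cases ha : a ∈ G.tree x
    · exact ⟨⟨⟨a, [], a, rfl⟩, ha, by simp⟩, e :: l, rfl, rfl, h⟩
    · obtain ⟨⟨⟨s, q, t, hq⟩, h1, h2⟩, m, hs, hl, hm⟩ := ih h.2
      dsimp only at hs hl hm h1 h2
      subst hs
      refine ⟨⟨⟨a, e :: q, t, h.1, hq⟩, h1, ?_⟩, m, rfl, congrArg (e :: ·) hl, hm⟩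
      rintro f hf
      rcases List.mem_cons.1 hf with rfl | hf
      · rwa [h.1]
      · exact h2 f hf

/-- Once in the tree of `x`, a path remains there. So `q` ends in both trees, whence `x = y`, and a
non-empty remainder would put a vertex of `q` before its last one into the tree. -/
theorem LinePaths.eq_of_prefix {X : Set V} (hX : G.IsLinePointReps X) {x y : V} (hx : x ∈ X)
    (hy : y ∈ X) {p : G.LinePaths x} {q : G.LinePaths y} (hs : p.1.start = q.1.start)
    (h : p.1.edges <+: q.1.edges) : x = y ∧ p.1 = q.1 := by
  obtain ⟨⟨a, l, b, hl⟩, hp1, hp2⟩ := p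
  obtain ⟨⟨a', m, d, hm⟩, hq1, hq2⟩ := q
  dsimp only at *
  subst hs
  obtain ⟨r, rfl⟩ := h
  obtain ⟨b', h1, h2⟩ := isPath_append.1 hm
  obtain rfl := hl.finish_unique h1
  have hxy : x = y := hX.eq hx hy (mem_tree_trans hp1 ⟨r, h2⟩) hq1
  subst hxy
  refine ⟨rfl, ?_⟩
  cases r with
  | nil => cases h2; simp
  | cons e r =>
    refine absurd ?_ (hq2 e (by simp))
    rw [h2.1]; exact hp1

theorem IsCycleAt.base_unique {a b : V} {c : List E} (h : G.IsCycleAt a c)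
    (h' : G.IsCycleAt b c) : a = b := by
  cases c with
  | nil => exact absurd rfl h.1
  | cons e c => exact h.2.1.1.symm.trans h'.2.1.1

theorem IsCycleAt.rotate {a : V} {s t : List E} (h : G.IsCycleAt a (s ++ t)) :
    ∃ b, G.IsPath a s b ∧ G.IsPath b t a ∧ G.IsCycleAt b (t ++ s) := by
  obtain ⟨b, h1, h2⟩ := isPath_append.1 h.2.1
  refine ⟨b, h1, h2, ?_, h2.append h1, ?_⟩
  · intro h0
    rw [List.append_eq_nil_iff] at h0
    exact h.1 (by rw [h0.1, h0.2]; rfl)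
  · rw [List.map_append, List.nodup_append_comm, ← List.map_append]
    exact h.2.2

theorem IsCycleAt.rotate_of_mem {a : V} {c : List E} (h : G.IsCycleAt a c) {e : E} (he : e ∈ c) :
    ∃ s t, c = s ++ t ∧ G.IsPath a s (G.src e) ∧ G.IsPath (G.src e) t a ∧
      G.IsCycleAt (G.src e) (t ++ s) := by
  obtain ⟨s, t, rfl⟩ := List.append_of_mem he
  obtain ⟨b, h1, h2, h3⟩ := h.rotate
  obtain rfl := h2.1
  exact ⟨s, e :: t, rfl, h1, h2, h3⟩

theorem IsCycleAt.exists_src_eq {a : V} {c : List E} (h : G.IsCycleAt a c) :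
    ∃ e ∈ c, G.src e = a := by
  obtain ⟨hne, hp, -⟩ := h
  cases c with
  | nil => exact absurd rfl hne
  | cons e c => exact ⟨e, by simp, hp.1⟩

theorem eq_of_not_hasExit {c : List E} (h : ¬ G.HasExit c) {e f : E} (he : e ∈ c)
    (hf : G.src f = G.src e) : f = e := by
  by_contra hne
  exact h ⟨e, he, f, hf, hne⟩

/-- A path starting on a cycle without exits stays on it. -/
theorem IsCycleAt.exists_src_eq_of_isPath {a : V} {c : List E} (h : G.IsCycleAt a c)
    (hc : ¬ G.HasExit c) {b d : V} {l : List E} (hl : G.IsPath b l d)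
    (hb : ∃ e ∈ c, G.src e = b) : ∃ e ∈ c, G.src e = d := by
  induction l generalizing b with
  | nil => cases hl; exact hb
  | cons e l ih =>
    refine ih hl.2 ?_
    obtain ⟨f, hf, hfb⟩ := hb
    have := eq_of_not_hasExit hc hf (hl.1.trans hfb.symm)
    subst this
    obtain ⟨s, t, rfl⟩ := List.append_of_mem hf
    obtain ⟨b', h1, h2⟩ := isPath_append.1 h.2.1
    cases t with
    | nil =>
      have : G.rng e = a := h2.2
      rw [this]
      exact h.exists_src_eq
    | cons g t => exact ⟨g, by simp, h2.2.1⟩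

theorem IsCycleAt.not_isBifurcation {a : V} {c : List E} (h : G.IsCycleAt a c)
    (hc : ¬ G.HasExit c) : ∀ x ∈ G.tree a, ¬ G.IsBifurcation x := by
  rintro x ⟨l, hl⟩ ⟨e, f, hef, he, hf⟩
  obtain ⟨g, hg, hgx⟩ := h.exists_src_eq_of_isPath hc hl h.exists_src_eq
  exact hef ((eq_of_not_hasExit hc hg (he.trans hgx.symm)).trans
    (eq_of_not_hasExit hc hg (hf.trans hgx.symm)).symm)

/-- The absence of exits makes the two paths comparable, and a cycle has no proper non-empty initial
segment which returns to its base. -/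
theorem IsCycleAt.prefix_of_isPath {a : V} {c : List E} (h : G.IsCycleAt a c)
    (hc : ¬ G.HasExit c) {l : List E} (hl : G.IsPath a l a) (hne : l ≠ []) : c <+: l := by
  rcases h.2.1.prefix_or_prefix (h.not_isBifurcation hc) hl with h1 | ⟨s, rfl⟩
  · exact h1
  · cases s with
    | nil => rw [List.append_nil]
    | cons f s =>
      obtain ⟨b, h1, h2⟩ := isPath_append.1 h.2.1
      obtain rfl := h1.finish_unique hl
      cases l with
      | nil => exact absurd rfl hne
      | cons e l =>
        have := h.2.2
        rw [List.cons_append, List.map_cons, List.nodup_cons] at this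
        refine absurd ?_ this.1
        rw [h1.1, ← h2.1]
        simp

/-- A path starting on `c` stays on `c`, so `c` can be rotated to the base `b`. There, two cycles
without exits are prefixes of each other. -/
theorem IsCycleAt.isRotated {a b : V} {c d : List E} (h : G.IsCycleAt a c)
    (hc : ¬ G.HasExit c) (h' : G.IsCycleAt b d) (hd : ¬ G.HasExit d) {l : List E}
    (hl : G.IsPath a l b) : c ~r d := by
  obtain ⟨e, he, rfl⟩ := h.exists_src_eq_of_isPath hc hl h.exists_src_eq
  obtain ⟨s, t, rfl, -, -, h3⟩ := h.rotate_of_mem he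
  have hts : ¬ G.HasExit (t ++ s) := by
    rintro ⟨e, he, f, hf⟩
    exact hc ⟨e, by simpa [or_comm] using he, f, hf⟩
  have : t ++ s = d := (h3.prefix_of_isPath hts h'.2.1 h'.1).eq_of_length_le
    (h'.prefix_of_isPath hd h3.2.1 h3.1).length_le
  rw [← this]
  exact List.isRotated_append

theorem IsCycleReps.eq {Y : Set (List E)} (hY : G.IsCycleReps Y)
    (hexit : ∀ c, G.IsCycle c → ¬ G.HasExit c) {c d : List E} (hc : c ∈ Y) (hd : d ∈ Y) {a b : V}
    (h : G.IsCycleAt a c) (h' : G.IsCycleAt b d) {l : List E} (hl : G.IsPath a l b) : c = d :=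
  (hY.2 c ⟨a, h⟩).unique ⟨hc, List.IsRotated.refl c⟩
    ⟨hd, h.isRotated (hexit c ⟨a, h⟩) h' (hexit d ⟨b, h'⟩) hl⟩

/-- The remainder of `q` leads from one cycle to the other, so the cycles coincide and the remainder
is closed. Were it non-empty it would begin with `c`, and `q` would include all edges of `c`. -/
theorem CyclePaths.eq_of_prefix {Y : Set (List E)} (hY : G.IsCycleReps Y)
    (hexit : ∀ c, G.IsCycle c → ¬ G.HasExit c) {c d : List E} (hc : c ∈ Y) (hd : d ∈ Y)
    {p : G.CyclePaths c} {q : G.CyclePaths d} (hs : p.1.start = q.1.start)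
    (h : p.1.edges <+: q.1.edges) : c = d ∧ p.1 = q.1 := by
  obtain ⟨⟨a, l, b, hl⟩, hp1, hp2⟩ := p
  obtain ⟨⟨a', m, d, hm⟩, hq1, hq2⟩ := q
  dsimp only at *
  subst hs
  obtain ⟨r, rfl⟩ := h
  obtain ⟨b', h1, h2⟩ := isPath_append.1 hm
  obtain rfl := hl.finish_unique h1
  have hcd := hY.eq hexit hc hd hp1 hq1 h2
  subst hcd
  refine ⟨rfl, ?_⟩
  obtain rfl := hp1.base_unique hq1
  by_cases hr : r = []
  · subst hr; simp
  · have := hp1.prefix_of_isPath (hexit _ ⟨_, hp1⟩) h2 hr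
    exact absurd (fun e he => List.mem_append_right _ (this.subset he)) hq2

/-- Comparability in either direction would put a vertex of a cycle into the tree of a line point: a
path entering this tree stays in it, and a path reaching a cycle without exits stays on it. -/
theorem not_prefix_of_linePaths_of_cyclePaths {x : V} (hx : G.IsLinePoint x) {c : List E}
    (hexit : ¬ G.HasExit c) (p : G.LinePaths x) (q : G.CyclePaths c)
    (hs : p.1.start = q.1.start) : ¬ p.1.edges <+: q.1.edges ∧ ¬ q.1.edges <+: p.1.edges := by
  obtain ⟨⟨a, l, b, hl⟩, hp1, hp2⟩ := p
  obtain ⟨⟨a', m, d, hm⟩, hq1, hq2⟩ := q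
  dsimp only at *
  subst hs
  constructor
  · rintro ⟨r, rfl⟩
    obtain ⟨b', h1, h2⟩ := isPath_append.1 hm
    obtain rfl := hl.finish_unique h1
    exact (hx d (mem_tree_trans hp1 ⟨r, h2⟩)).2 ⟨c, hq1⟩
  · rintro ⟨r, rfl⟩
    obtain ⟨b', h1, h2⟩ := isPath_append.1 hl
    obtain rfl := hm.finish_unique h1
    obtain ⟨e, he, rfl⟩ := hq1.exists_src_eq_of_isPath hexit h2 hq1.exists_src_eq
    obtain ⟨s, t, rfl, -, -, h3⟩ := hq1.rotate_of_mem he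
    exact (hx _ hp1).2 ⟨_, h3⟩

/-- Each path ending at the base vertex of a cycle without exits is a path not including all
the edges of the cycle, followed by a closed path. -/
theorem IsPath.exists_cyclePaths {a b : V} {c l : List E} (h : G.IsPath a l b)
    (hc : G.IsCycleAt b c) : ∃ (p : G.CyclePaths c) (m : List E), p.1.start = a ∧
      p.1.finish = b ∧ l = p.1.edges ++ m ∧ G.IsPath b m b := by
  induction hn : l.length using Nat.strong_induction_on generalizing l with
  | _ n ih =>
    subst hn
    by_cases hall : ∀ e ∈ c, e ∈ l
    -- The edge of `c` that leaves `b` occurs in the path. Cutting just before it leaves a shorter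
    -- path to `b`, followed by a closed path.
    · obtain ⟨e, he, hb⟩ := hc.exists_src_eq
      obtain ⟨s, t, rfl⟩ := List.append_of_mem (hall e he)
      obtain ⟨b', h1, h2⟩ := isPath_append.1 h
      obtain rfl : b = b' := hb.symm.trans h2.1
      obtain ⟨p, m, hp, hp', hm, hm'⟩ := ih s.length (by simp) h1 rfl
      exact ⟨p, m ++ e :: t, hp, hp', by rw [hm, List.append_assoc], hm'.append h2⟩
    · exact ⟨⟨⟨a, l, b, h⟩, hc, hall⟩, [], rfl, rfl, (List.append_nil _).symm, rfl⟩

end DirGraph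

/-! ## The matrix units given by line points and cycles -/

namespace Leavitt

open DirGraph

variable (K : Type w) [Field K] {V : Type u} {E : Type v} (G : DirGraph V E)

section Line

variable {G}

/-- The path from a line point `x` to the end of a path in `G.LinePaths x`. -/
noncomputable def linePath {x : V} (p : G.LinePaths x) : List E := Classical.choose p.2.1

theorem isPath_linePath {x : V} (p : G.LinePaths x) : G.IsPath x (linePath p) p.1.finish :=
  Classical.choose_spec p.2.1

/-- The product of a path ending in the tree of `x` and a ghost path to `x`. -/
noncomputable def lineRow {x : V} (p : G.LinePaths x) : Unital K G :=
  pathElt K G p.1.start p.1.edges * ghostElt K G x (linePath p)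

/-- The product of a path starting at `x` and the ghost path of a path ending in the tree of `x`. -/
noncomputable def lineCol {x : V} (p : G.LinePaths x) : Unital K G :=
  pathElt K G x (linePath p) * ghostElt K G p.1.start p.1.edges

/-- The inner product of `p` with its ghost is a vertex by CK-1; what remains is `m m*` for a path
`m` from the line point, equal to `x` because `m` meets no bifurcation. -/
theorem lineCol_mul_lineRow {x : V} (hx : G.IsLinePoint x) (p : G.LinePaths x) :
    lineCol K p * lineRow K p = vt K G x := by
  rw [lineCol, lineRow, mul_assoc, ← mul_assoc (ghostElt K G _ _),
    ghostElt_mul_pathElt_self p.1.isPath, vt_mul_ghostElt (isPath_linePath p),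
    pathElt_mul_ghostElt_self (isPath_linePath p) (hx.eq_of_src_eq (isPath_linePath p))]

theorem lineCol_mul_lineRow_of_ne {X : Set V} (hX : G.IsLinePointReps X) {x y : V} (hx : x ∈ X)
    (hy : y ∈ X) {p : G.LinePaths x} {q : G.LinePaths y} (h : ¬ (x = y ∧ p.1 = q.1)) :
    lineCol K p * lineRow K q = 0 := by
  rw [lineCol, lineRow, mul_assoc, ← mul_assoc (ghostElt K G _ _),
    ghostElt_mul_pathElt_of_not_prefix p.1.isPath q.1.isPath fun hs =>
      ⟨fun h' => h (LinePaths.eq_of_prefix hX hx hy hs h'),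
        fun h' => h ((LinePaths.eq_of_prefix hX hy hx hs.symm h').imp Eq.symm Eq.symm)⟩,
    zero_mul, mul_zero]

theorem smul_vt_mem_homog_iff {k : K} {a : V} {n : ℤ} :
    k • vt K G a ∈ homog K G n ↔ k ∈ fieldGrading K n := by
  by_cases hn : n = 0
  · subst hn
    simpa [fieldGrading] using (homog K G 0).smul_mem k (vt_mem_homog K G a)
  · rw [fieldGrading, if_neg hn, Submodule.mem_bot]
    refine ⟨fun h => smul_vt_eq_zero.1
      (eq_zero_of_mem_homog hn h ((homog K G 0).smul_mem k (vt_mem_homog K G a))), ?_⟩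
    rintro rfl
    rw [zero_smul]; exact zero_mem _

/-- The matrix units given by the line points. -/
noncomputable def lineUnits {X : Set V} (hX : G.IsLinePointReps X) :
    MatrixUnits K (homog K G) (Λ := fun x : X => G.LinePaths x.1) (A := fun _ => K)
      (fun _ => fieldGrading K) (fun x => G.lineShift x.1) where
  v x := vt K G x.1
  row _ p := lineRow K p
  col _ p := lineCol K p
  coef _ := Algebra.ofId K _
  row_mul x p := by rw [lineRow, mul_assoc, ghostElt_mul_vt (isPath_linePath p)]
  mul_col x p := by rw [lineCol, ← mul_assoc, vt_mul_pathElt (isPath_linePath p)]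
  comm x a := by rw [Algebra.ofId_apply, Algebra.commutes]
  col_mul_row x p := lineCol_mul_lineRow K (hX.1 _ x.2) p
  col_mul_row_of_ne x p q h :=
    lineCol_mul_lineRow_of_ne K hX x.2 x.2 fun h' => h (Subtype.ext h'.2)
  col_mul_row_of_index_ne x y p q h :=
    lineCol_mul_lineRow_of_ne K hX x.2 y.2 fun h' => h (Subtype.ext h'.1)
  row_mem x p := by
    have := mul_mem_homog (pathElt_mem_homog K G p.1.start p.1.edges)
      (ghostElt_mem_homog K G x.1 (linePath p))
    rwa [← (hX.1 _ x.2).dist_eq (isPath_linePath p)] at this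
  col_mem x p := by
    have := mul_mem_homog (pathElt_mem_homog K G x.1 (linePath p))
      (ghostElt_mem_homog K G p.1.start p.1.edges)
    rw [← (hX.1 _ x.2).dist_eq (isPath_linePath p)] at this
    rwa [lineShift, neg_sub, sub_eq_add_neg]
  coef_mul_mem x n a := by
    rw [Algebra.ofId_apply, ← Algebra.smul_def]; exact smul_vt_mem_homog_iff K
  eq_zero x a h := by
    rw [Algebra.ofId_apply, ← Algebra.smul_def] at h; exact smul_vt_eq_zero.1 h

end Line

section Cycle

variable {G} {b : V} {c : List E}

/-- A cycle `c` at `b` without exits gives the unit `c + (1 - b)`. -/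
noncomputable def cycleUnit (hc : G.IsCycleAt b c) (hexit : ¬ G.HasExit c) : (Unital K G)ˣ where
  val := pathElt K G b c + (1 - vt K G b)
  inv := ghostElt K G b c + (1 - vt K G b)
  val_inv := by
    -- While `c* c = b` holds for any closed path, `c c* = b` relies on the absence of exits.
    have h1 := pathElt_mul_ghostElt_self (K := K) hc.2.1 fun e he f => eq_of_not_hasExit hexit he
    have h2 := (isFamily_gen K G).idem b
    rw [mul_add, add_mul, add_mul, h1, mul_sub, mul_one, sub_mul, one_mul,
      vt_mul_ghostElt hc.2.1, pathElt_mul_vt hc.2.1, mul_sub, sub_mul, sub_mul, h2]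
    simp
  inv_val := by
    have h1 := ghostElt_mul_pathElt_self (K := K) hc.2.1
    have h2 := (isFamily_gen K G).idem b
    rw [mul_add, add_mul, add_mul, h1, mul_sub, mul_one, sub_mul, one_mul,
      vt_mul_pathElt hc.2.1, ghostElt_mul_vt hc.2.1, mul_sub, sub_mul, sub_mul, h2]
    simp

variable (hc : G.IsCycleAt b c) (hexit : ¬ G.HasExit c)

theorem cycleUnit_mul_vt : (cycleUnit K hc hexit : Unital K G) * vt K G b = pathElt K G b c := by
  have h2 := (isFamily_gen K G).idem b
  rw [cycleUnit, Units.val_mk, add_mul, pathElt_mul_vt hc.2.1, sub_mul, one_mul, h2, sub_self,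
    add_zero]

theorem vt_mul_cycleUnit : vt K G b * (cycleUnit K hc hexit : Unital K G) = pathElt K G b c := by
  have h2 := (isFamily_gen K G).idem b
  rw [cycleUnit, Units.val_mk, mul_add, vt_mul_pathElt hc.2.1, mul_sub, mul_one, h2, sub_self,
    add_zero]

theorem cycleUnit_inv_mul_vt :
    ((cycleUnit K hc hexit)⁻¹ : (Unital K G)ˣ).val * vt K G b = ghostElt K G b c := by
  have h2 := (isFamily_gen K G).idem b
  change (ghostElt K G b c + (1 - vt K G b)) * vt K G b = _
  rw [add_mul, ghostElt_mul_vt hc.2.1, sub_mul, one_mul, h2, sub_self, add_zero]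

theorem commute_vt_cycleUnit_zpow (k : ℤ) :
    Commute (vt K G b) ((cycleUnit K hc hexit ^ k : (Unital K G)ˣ) : Unital K G) :=
  Commute.units_zpow_right
    ((vt_mul_cycleUnit K hc hexit).trans (cycleUnit_mul_vt K hc hexit).symm) k

theorem cycleUnit_zpow_mul_vt_mem_homog (k : ℤ) :
    ((cycleUnit K hc hexit ^ k : (Unital K G)ˣ) : Unital K G) * vt K G b ∈
      homog K G (c.length * k) := by
  induction k using Int.induction_on with
  | zero => rw [zpow_zero, Units.val_one, one_mul, mul_zero]; exact vt_mem_homog K G b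
  | succ k ih =>
    have := mul_mem_homog ih (pathElt_mem_homog K G b c)
    rw [mul_assoc, vt_mul_pathElt hc.2.1, ← cycleUnit_mul_vt K hc hexit, ← mul_assoc,
      ← Units.val_mul, ← zpow_add_one] at this
    convert this using 2
    ring
  | pred k ih =>
    have := mul_mem_homog ih (ghostElt_mem_homog K G b c)
    rw [mul_assoc, vt_mul_ghostElt hc.2.1, ← cycleUnit_inv_mul_vt K hc hexit, ← mul_assoc,
      ← Units.val_mul, ← zpow_sub_one] at this
    convert this using 2
    ring

/-- The homomorphism from `K[x, x⁻¹]` mapping `x` to the unit given by the cycle. -/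
noncomputable def cycleHom : K[T;T⁻¹] →ₐ[K] Unital K G :=
  AddMonoidAlgebra.lift K (Unital K G) ℤ
    ((Units.coeHom (Unital K G)).comp (zpowersHom _ (cycleUnit K hc hexit)))

theorem cycleHom_single (k : ℤ) (r : K) : cycleHom K hc hexit (.single k r) =
    r • ((cycleUnit K hc hexit ^ k : (Unital K G)ˣ) : Unital K G) := by
  rw [cycleHom, AddMonoidAlgebra.lift_single]; rfl

theorem commute_vt_cycleHom (p : K[T;T⁻¹]) : Commute (vt K G b) (cycleHom K hc hexit p) := by
  induction p using AddMonoidAlgebra.induction_linear with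
  | zero => rw [map_zero]; exact Commute.zero_right _
  | add p q hp hq => rw [map_add]; exact hp.add_right hq
  | single k r =>
    rw [cycleHom_single]
    exact (commute_vt_cycleUnit_zpow K hc hexit k).smul_right r

/-- The powers of the cycle have the distinct degrees `|c| k`, so the coaction separates the terms
of a Laurent polynomial. This yields linear independence of the powers and the degrees of their
combinations. -/
theorem coeff_coaction_cycleHom_mul_vt (p : K[T;T⁻¹]) (k : ℤ) :
    (coaction K G (cycleHom K hc hexit p * vt K G b)).coeff (c.length * k) =
      p.coeff k • (((cycleUnit K hc hexit ^ k : (Unital K G)ˣ) : Unital K G) * vt K G b) := by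
  induction p using AddMonoidAlgebra.induction_linear with
  | zero => simp
  | add p q hp hq =>
    rw [map_add, add_mul, map_add, AddMonoidAlgebra.coeff_add, Finsupp.add_apply, hp, hq,
      AddMonoidAlgebra.coeff_add, Finsupp.add_apply, add_smul]
  | single m r =>
    have hlen : (c.length : ℤ) ≠ 0 := by
      exact_mod_cast (List.length_pos_iff.2 hc.1).ne'
    rw [cycleHom_single, smul_mul_assoc, map_smul, AddMonoidAlgebra.coeff_smul,
      Finsupp.smul_apply, coeff_of_mem_homog (cycleUnit_zpow_mul_vt_mem_homog K hc hexit m),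
      AddMonoidAlgebra.coeff_single, Finsupp.single_apply]
    by_cases hmk : m = k
    · subst hmk; simp
    · rw [if_neg fun h => hmk (mul_left_cancel₀ hlen h).symm, if_neg hmk, smul_zero, zero_smul]

theorem smul_cycleUnit_zpow_mul_vt_eq_zero {k : ℤ} {r : K}
    (h : r • (((cycleUnit K hc hexit ^ k : (Unital K G)ˣ) : Unital K G) * vt K G b) = 0) :
    r = 0 := by
  have h2 := congrArg (((cycleUnit K hc hexit ^ (-k) : (Unital K G)ˣ) : Unital K G) * ·) h
  rw [mul_smul_comm, ← mul_assoc, ← Units.val_mul, ← zpow_add, neg_add_cancel, zpow_zero,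
    Units.val_one, one_mul, mul_zero] at h2
  exact smul_vt_eq_zero.1 h2

theorem cycleHom_mul_vt_eq_zero {p : K[T;T⁻¹]} (h : cycleHom K hc hexit p * vt K G b = 0) :
    p = 0 := by
  refine LaurentPolynomial.ext fun k => smul_cycleUnit_zpow_mul_vt_eq_zero K hc hexit (k := k) ?_
  rw [← coeff_coaction_cycleHom_mul_vt, h, map_zero]; rfl

theorem cycleHom_mul_vt_mem_homog_iff {p : K[T;T⁻¹]} {n : ℤ} :
    cycleHom K hc hexit p * vt K G b ∈ homog K G n ↔ ∀ k, p.coeff k ≠ 0 → c.length * k = n := by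
  constructor
  · intro h k hk
    by_contra hkn
    refine hk (smul_cycleUnit_zpow_mul_vt_eq_zero K hc hexit (k := k) ?_)
    rw [← coeff_coaction_cycleHom_mul_vt, coeff_of_mem_homog h, if_neg hkn]
  · intro h
    have hp : p = p.coeff.sum AddMonoidAlgebra.single := (AddMonoidAlgebra.sum_coeff_single p).symm
    rw [hp, Finsupp.sum, map_sum, Finset.sum_mul]
    refine sum_mem fun k hk => ?_
    rw [cycleHom_single, smul_mul_assoc, ← h k (Finsupp.mem_support_iff.1 hk)]
    exact Submodule.smul_mem _ _ (cycleUnit_zpow_mul_vt_mem_homog K hc hexit k)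

/-- A closed path at the base vertex of a cycle without exits is a power of the cycle. -/
theorem pathElt_eq_cycleUnit_zpow {l : List E} (hl : G.IsPath b l b) : ∃ k : ℤ,
    pathElt K G b l = ((cycleUnit K hc hexit ^ k : (Unital K G)ˣ) : Unital K G) * vt K G b ∧
    ghostElt K G b l = ((cycleUnit K hc hexit ^ (-k) : (Unital K G)ˣ) : Unital K G) * vt K G b := by
  induction hn : l.length using Nat.strong_induction_on generalizing l with
  | _ n ih =>
    subst hn
    by_cases hne : l = []
    · subst hne
      exact ⟨0, by simp [pathElt], by simp [ghostElt]⟩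
    · obtain ⟨m, rfl⟩ := hc.prefix_of_isPath hexit hl hne
      obtain ⟨b', h1, h2⟩ := isPath_append.1 hl
      obtain rfl := hc.2.1.finish_unique h1
      have hlen : m.length < (c ++ m).length := by
        have := List.length_pos_iff.2 hc.1
        rw [List.length_append]; omega
      obtain ⟨k, hk1, hk2⟩ := ih _ hlen h2 rfl
      refine ⟨1 + k, ?_, ?_⟩
      · rw [pathElt_append h1 h2, hk1, ← (commute_vt_cycleUnit_zpow K hc hexit k).eq, ← mul_assoc,
          pathElt_mul_vt h1, ← cycleUnit_mul_vt K hc hexit, mul_assoc,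
          (commute_vt_cycleUnit_zpow K hc hexit k).eq, ← mul_assoc, ← Units.val_mul,
          ← zpow_one_add]
      · rw [ghostElt_append h1 h2, hk2, mul_assoc, vt_mul_ghostElt h1,
          ← cycleUnit_inv_mul_vt K hc hexit, ← mul_assoc, ← Units.val_mul, ← zpow_sub_one]
        congr 3
        ring

end Cycle

section CycleUnits

variable {G} {Y : Set (List E)}

/-- The base vertex of a cycle. -/
noncomputable def cycleBase (hY : G.IsCycleReps Y) (c : Y) : V := Classical.choose (hY.1 c.1 c.2)

theorem isCycleAt_cycleBase (hY : G.IsCycleReps Y) (c : Y) : G.IsCycleAt (cycleBase hY c) c.1 :=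
  Classical.choose_spec (hY.1 c.1 c.2)

theorem finish_eq_cycleBase (hY : G.IsCycleReps Y) (c : Y) (p : G.CyclePaths c.1) :
    p.1.finish = cycleBase hY c :=
  p.2.1.base_unique (isCycleAt_cycleBase hY c)

theorem ghostElt_mul_pathElt_cyclePaths_of_ne (hY : G.IsCycleReps Y)
    (hexit : ∀ c, G.IsCycle c → ¬ G.HasExit c) {c d : List E} (hc : c ∈ Y) (hd : d ∈ Y)
    {p : G.CyclePaths c} {q : G.CyclePaths d} (h : ¬ (c = d ∧ p.1 = q.1)) :
    ghostElt K G p.1.start p.1.edges * pathElt K G q.1.start q.1.edges = 0 :=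
  ghostElt_mul_pathElt_of_not_prefix p.1.isPath q.1.isPath fun hs =>
    ⟨fun h' => h (CyclePaths.eq_of_prefix hY hexit hc hd hs h'),
      fun h' => h ((CyclePaths.eq_of_prefix hY hexit hd hc hs.symm h').imp Eq.symm Eq.symm)⟩

/-- The matrix units given by the cycles. -/
noncomputable def cycleUnits (hY : G.IsCycleReps Y)
    (hexit : ∀ c, G.IsCycle c → ¬ G.HasExit c) :
    MatrixUnits K (homog K G) (Λ := fun c : Y => G.CyclePaths c.1)
      (A := fun c => LaurentRing K c.1.length)
      (fun c => laurentGrading K c.1.length) (fun c => G.cycleShift c.1) where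
  v c := vt K G (cycleBase hY c)
  row _ p := pathElt K G p.1.start p.1.edges
  col _ p := ghostElt K G p.1.start p.1.edges
  coef c := (cycleHom K (isCycleAt_cycleBase hY c) (hexit _ (hY.1 _ c.2))).comp
    (laurentEquiv (List.length_pos_iff.2 (isCycleAt_cycleBase hY c).1)).symm.toAlgHom
  row_mul c p := by rw [← finish_eq_cycleBase hY c p, pathElt_mul_vt p.1.isPath]
  mul_col c p := by rw [← finish_eq_cycleBase hY c p, vt_mul_ghostElt p.1.isPath]
  comm c a := commute_vt_cycleHom K _ _ _
  col_mul_row c p := by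
    rw [← finish_eq_cycleBase hY c p, ghostElt_mul_pathElt_self p.1.isPath]
  col_mul_row_of_ne c p q h := ghostElt_mul_pathElt_cyclePaths_of_ne K hY hexit c.2 c.2
    fun h' => h (Subtype.ext h'.2)
  col_mul_row_of_index_ne c d p q h := ghostElt_mul_pathElt_cyclePaths_of_ne K hY hexit c.2 d.2
    fun h' => h (Subtype.ext h'.1)
  row_mem c p := pathElt_mem_homog K G _ _
  col_mem c p := ghostElt_mem_homog K G _ _
  coef_mul_mem c n a := by
    obtain ⟨p, rfl⟩ := (laurentEquiv (K := K)
      (List.length_pos_iff.2 (isCycleAt_cycleBase hY c).1)).surjective a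
    rw [mem_laurentGrading_iff, ← cycleHom_mul_vt_mem_homog_iff K (isCycleAt_cycleBase hY c)
      (hexit _ (hY.1 _ c.2))]
    simp
  eq_zero c a h := by
    have := cycleHom_mul_vt_eq_zero K _ _ h
    simpa using this

end CycleUnits

end Leavitt

/-! ## The decomposition of the algebra -/

namespace Leavitt

open DirGraph

variable {K : Type w} [Field K] {V : Type u} {E : Type v} {G : DirGraph V E}

/-- `S` contains all the products of a path and a ghost path meeting at `a`. -/
def Covers (S : Submodule K (Unital K G)) (a : V) : Prop :=
  ∀ b d l m, G.IsPath b l a → G.IsPath d m a → pathElt K G b l * ghostElt K G d m ∈ S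

variable {S : Submodule K (Unital K G)}

/-- Here `l l* = a`, and therefore `αβ* = (αl)(βl)*`. -/
theorem Covers.of_isPath {a b : V} {l : List E} (hl : G.IsPath a l b)
    (h : ∀ e ∈ l, ∀ f, G.src f = G.src e → f = e) (hb : Covers S b) : Covers S a := by
  intro x y m n hm hn
  have := hb x y _ _ (hm.append hl) (hn.append hl)
  rwa [pathElt_append hm hl, ghostElt_append hn hl, mul_assoc, ← mul_assoc (pathElt K G a l),
    pathElt_mul_ghostElt_self hl h, vt_mul_ghostElt hn] at this

/-- Inserting CK-2 between the factors gives `αβ* = ∑ (αe)(βe)*`. -/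
theorem Covers.of_edges {a : V} (hfin : {e : E | G.src e = a}.Finite)
    (hne : {e : E | G.src e = a}.Nonempty) (h : ∀ e, G.src e = a → Covers S (G.rng e)) :
    Covers S a := by
  intro x y m n hm hn
  have hck : vt K G a = _ := (isFamily_gen K G).ck2 a hfin hne
  rw [← vt_mul_ghostElt hn, hck, Finset.sum_mul, Finset.mul_sum]
  refine sum_mem fun e he => ?_
  have he : G.src e = a := by simpa using he
  have hp : G.IsPath a [e] (G.rng e) := ⟨he, rfl⟩
  have := h e he x y _ _ (hm.append hp) (hn.append hp)
  rw [pathElt_append hm hp, ghostElt_append hn hp, pathElt_singleton, ghostElt_singleton,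
    mul_assoc] at this
  rwa [mul_assoc]

/-- Line points and vertices on cycles inherit covering from the chosen representatives. If some
vertex were not covered, neither would be the end of one of its edges, and so on; the resulting
infinite path contradicts the hypothesis on infinite paths. -/
theorem Covers.of_graph_conditions {X : Set V} (hX : G.IsLinePointReps X) {Y : Set (List E)}
    (hY : G.IsCycleReps Y) (hfin : G.RowFinite) (hexit : ∀ c, G.IsCycle c → ¬ G.HasExit c)
    (hinf : ∀ p, G.IsInfPath p →
      (∃ q, G.IsStraightLine q ∧ G.ContainsLinePoint q ∧ DirGraph.TailEquiv p q) ∨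
      (∃ c q, G.IsCycle c ∧ DirGraph.IsInfPower c q ∧ DirGraph.TailEquiv p q))
    (hline : ∀ x ∈ X, ∀ a ∈ G.tree x, Covers S a)
    (hcycle : ∀ c ∈ Y, ∀ a, G.IsCycleAt a c → Covers S a) (a : V) : Covers S a := by
  have hlp : ∀ a, G.IsLinePoint a → Covers S a := by
    intro a ha
    obtain ⟨x, ⟨hx, b, ⟨l, hl⟩, hb⟩, -⟩ := hX.2 a ha
    exact Covers.of_isPath hl (ha.eq_of_src_eq hl) (hline x hx b hb)
  have hcp : ∀ a c, G.IsCycleAt a c → Covers S a := by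
    intro a c hc
    obtain ⟨d, ⟨hd, hcd⟩, -⟩ := hY.2 c ⟨a, hc⟩
    -- The representative is based at another vertex of the cycle; covering is pulled back along the
    -- segment of `c` leading there.
    obtain ⟨n, hn, rfl⟩ := List.isRotated_iff_mod.1 hcd
    rw [List.rotate_eq_drop_append_take hn] at hd
    have hc' := hc
    rw [← List.take_append_drop n c] at hc'
    obtain ⟨b, h1, -, h3⟩ := hc'.rotate
    exact Covers.of_isPath h1 (fun e he f =>
      eq_of_not_hasExit (hexit c ⟨a, hc⟩) (List.mem_of_mem_take he)) (hcycle _ hd _ h3)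
  by_contra ha
  have step : ∀ b : {b : V // ¬ Covers S b}, ∃ e, G.src e = b.1 ∧ ¬ Covers S (G.rng e) := by
    rintro ⟨b, hb⟩
    -- A sink is a line point, hence covered; so an uncovered vertex emits an edge.
    have hne : {e : E | G.src e = b}.Nonempty := by
      by_contra hne
      rw [Set.not_nonempty_iff_eq_empty, Set.eq_empty_iff_forall_notMem] at hne
      refine hb (hlp b ?_)
      rintro d ⟨l, hl⟩
      have : l = [] := by
        cases l with
        | nil => rfl
        | cons e l => exact absurd hl.1 (hne e)
      subst this
      cases hl
      refine ⟨fun ⟨e, _, _, he, _⟩ => hne e he, fun ⟨c, hc⟩ => ?_⟩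
      obtain ⟨e, -, he⟩ := hc.exists_src_eq
      exact hne e he
    by_contra hcon
    push Not at hcon
    exact hb (Covers.of_edges (hfin b) hne hcon)
  choose f hf hf' using step
  let s : ℕ → {b : V // ¬ Covers S b} := fun n =>
    Nat.rec ⟨a, ha⟩ (fun _ b => ⟨G.rng (f b), hf' b⟩) n
  have hs : ∀ n, G.src (f (s n)) = (s n).1 := fun n => hf _
  have hpath : G.IsInfPath fun n => f (s n) := fun n => (hs (n + 1)).symm
  rcases hinf _ hpath with ⟨q, hq, ⟨j, hj⟩, m, n, -, -, hmn⟩ | ⟨c, q, ⟨b, hc⟩, hq, m, n, -, -, hmn⟩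
  -- The line point is at position `j` of `q`. The vertex at position `n + j` lies in its tree, so
  -- it is a line point as well.
  · refine (s (m + j)).2 ?_
    rw [← hs, show f (s (m + j)) = q (n + j) from hmn j]
    refine hlp _ (hj.of_mem_tree ?_)
    have : ∀ k, G.src (q (j + k)) ∈ G.tree (G.src (q j)) := by
      intro k
      induction k with
      | zero => exact mem_tree_self _
      | succ k ih => exact mem_tree_trans ih ⟨[q (j + k)], rfl, hq.1 _⟩
    rw [add_comm n j]
    exact this n
  · refine (s (m + 0)).2 ?_
    rw [← hs, show f (s (m + 0)) = q (n + 0) from hmn 0]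
    have hmem : q (n + 0) ∈ c := List.mem_of_getElem? (hq (n + 0))
    obtain ⟨s, t, -, -, -, h3⟩ := hc.rotate_of_mem hmem
    exact hcp _ _ h3

theorem algebra_le_of_covers (h : ∀ a, Covers S a) {x : Unital K G} (hx : x ∈ algebra K G) :
    x ∈ S := by
  refine Submodule.span_le.2 ?_ (mem_span_of_mem_algebra K G hx)
  rintro _ ⟨p, q, hpq, rfl⟩
  exact h q.finish _ _ _ _ (hpq ▸ p.isPath) q.isPath

theorem cycleUnit_zpow_mul_vt_mem_algebra {b : V} {c : List E} (hc : G.IsCycleAt b c)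
    (hexit : ¬ G.HasExit c) (k : ℤ) :
    ((cycleUnit K hc hexit ^ k : (Unital K G)ˣ) : Unital K G) * vt K G b ∈ algebra K G := by
  induction k using Int.induction_on with
  | zero => rw [zpow_zero, Units.val_one, one_mul]; exact gen_mem_algebra K G _
  | succ k ih =>
    rw [zpow_add_one, Units.val_mul, mul_assoc, cycleUnit_mul_vt, ← vt_mul_pathElt hc.2.1,
      ← mul_assoc]
    exact mul_mem ih (pathElt_mem_algebra K G _ _)
  | pred k ih =>
    rw [zpow_sub_one, Units.val_mul, mul_assoc, cycleUnit_inv_mul_vt, ← vt_mul_ghostElt hc.2.1,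
      ← mul_assoc]
    exact mul_mem ih (ghostElt_mem_algebra K G _ _)

theorem cycleHom_mul_vt_mem_algebra {b : V} {c : List E} (hc : G.IsCycleAt b c)
    (hexit : ¬ G.HasExit c) (p : K[T;T⁻¹]) :
    cycleHom K hc hexit p * vt K G b ∈ algebra K G := by
  induction p using AddMonoidAlgebra.induction_linear with
  | zero => rw [map_zero, zero_mul]; exact zero_mem _
  | add p q hp hq => rw [map_add, add_mul]; exact add_mem hp hq
  | single k r =>
    rw [cycleHom_single, smul_mul_assoc]
    exact SMulMemClass.smul_mem _ (cycleUnit_zpow_mul_vt_mem_algebra hc hexit k)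

section Systems

variable {X : Set V} (hX : G.IsLinePointReps X) {Y : Set (List E)} (hY : G.IsCycleReps Y)
  (hexit : ∀ c, G.IsCycle c → ¬ G.HasExit c)

theorem lineUnits_elt_mem_algebra (x : X) (p q : G.LinePaths x.1) (a : K) :
    (lineUnits K hX).elt x p q a ∈ algebra K G := by
  have h : (lineUnits K hX).elt x p q a = a • (lineRow K p * lineCol K q) := by
    change lineRow K p * (Algebra.ofId K _ a * lineCol K q) = _
    rw [Algebra.ofId_apply, ← Algebra.smul_def, mul_smul_comm]
  rw [h]
  exact SMulMemClass.smul_mem _ (mul_mem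
    (mul_mem (pathElt_mem_algebra K G _ _) (ghostElt_mem_algebra K G _ _))
    (mul_mem (pathElt_mem_algebra K G _ _) (ghostElt_mem_algebra K G _ _)))

theorem cycleUnits_elt_mem_algebra (c : Y) (p q : G.CyclePaths c.1)
    (a : LaurentRing K c.1.length) : (cycleUnits K hY hexit).elt c p q a ∈ algebra K G := by
  -- The image of the coefficient ring contains `1`, which need not lie in the algebra. Splitting
  -- the base vertex off the column makes the coefficient occur only as `coef a * v`.
  rw [MatrixUnits.elt_apply, ← (cycleUnits K hY hexit).mul_col, ← mul_assoc _ _ (_ * _),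
    mul_assoc, ← mul_assoc ((cycleUnits K hY hexit).coef c a)]
  exact mul_mem (pathElt_mem_algebra K G _ _) (mul_mem
    (cycleHom_mul_vt_mem_algebra (isCycleAt_cycleBase hY c) (hexit _ (hY.1 _ c.2)) _)
    (ghostElt_mem_algebra K G _ _))

theorem lineCol_mul_pathElt (x : X) (p : G.LinePaths x.1) (c : Y) (q : G.CyclePaths c.1) :
    (lineUnits K hX).col x p * (cycleUnits K hY hexit).row c q = 0 := by
  change lineCol K p * pathElt K G q.1.start q.1.edges = 0
  rw [lineCol, mul_assoc, ghostElt_mul_pathElt_of_not_prefix p.1.isPath q.1.isPath fun hs =>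
    not_prefix_of_linePaths_of_cyclePaths (hX.1 _ x.2) (hexit _ (hY.1 _ c.2)) p q hs, mul_zero]

theorem ghostElt_mul_lineRow (c : Y) (q : G.CyclePaths c.1) (x : X) (p : G.LinePaths x.1) :
    (cycleUnits K hY hexit).col c q * (lineUnits K hX).row x p = 0 := by
  change ghostElt K G q.1.start q.1.edges * lineRow K p = 0
  rw [lineRow, ← mul_assoc, ghostElt_mul_pathElt_of_not_prefix q.1.isPath p.1.isPath fun hs =>
    (not_prefix_of_linePaths_of_cyclePaths (hX.1 _ x.2) (hexit _ (hY.1 _ c.2)) p q hs.symm).symm,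
    zero_mul]

/-- A path to `b` is cut where it enters the tree of `x`, and thereby becomes `row p` times the
unique path `r` from `x` to `b`. As `r r* = x`, the product `αβ*` is the matrix unit `row p * col
q`. -/
theorem covers_of_mem_tree (x : X)
    (h : ∀ p q a, (lineUnits K hX).elt x p q a ∈ S) {b : V} (hb : b ∈ G.tree x.1) :
    Covers S b := by
  intro s t l m hl hm
  obtain ⟨p, l', rfl, rfl, hl'⟩ := hl.exists_linePaths hb
  obtain ⟨q, m', rfl, rfl, hm'⟩ := hm.exists_linePaths hb
  have hx := hX.1 _ x.2
  have key : ∀ (p : G.LinePaths x.1) (l' : List E), G.IsPath p.1.finish l' b →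
      ∀ r, G.IsPath x.1 r b → pathElt K G p.1.start (p.1.edges ++ l') =
        lineRow K p * pathElt K G x.1 r := by
    intro p l' hl' r hr
    obtain rfl := hx.path_unique ((isPath_linePath p).append hl') hr
    rw [lineRow, mul_assoc, ghostElt_mul_pathElt_append (isPath_linePath p) hl',
      pathElt_append p.1.isPath hl']
  obtain ⟨r, hr⟩ := hb
  have h1 := key p l' hl' r hr
  have h2 : ghostElt K G q.1.start (q.1.edges ++ m') = ghostElt K G x.1 r * lineCol K q := by
    have := congrArg str (key q m' hm' r hr)
    rwa [str_mul, str_pathElt, str_pathElt, lineRow, str_mul, str_pathElt, str_ghostElt] at this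
  have h3 := h p q 1
  change lineRow K p * (Algebra.ofId K _ 1 * lineCol K q) ∈ S at h3
  rw [map_one, one_mul] at h3
  rw [h1, h2, mul_assoc, ← mul_assoc (pathElt K G x.1 r),
    pathElt_mul_ghostElt_self hr (hx.eq_of_src_eq hr), lineCol, ← mul_assoc (vt K G _),
    vt_mul_pathElt (isPath_linePath q)]
  exact h3

/-- Both paths are members of `Υ_c` followed by closed paths, and the latter are powers of the
cycle. -/
theorem covers_of_isCycleAt (c : Y)
    (h : ∀ p q a, (cycleUnits K hY hexit).elt c p q a ∈ S) {b : V} (hb : G.IsCycleAt b c.1) :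
    Covers S b := by
  intro s t l m hl hm
  have hb' := isCycleAt_cycleBase hY c
  obtain rfl := hb'.base_unique hb
  have hc := hexit _ (hY.1 _ c.2)
  obtain ⟨p, l', rfl, hp, rfl, hl'⟩ := hl.exists_cyclePaths hb
  obtain ⟨q, m', rfl, hq, rfl, hm'⟩ := hm.exists_cyclePaths hb
  obtain ⟨j, hj, -⟩ := pathElt_eq_cycleUnit_zpow K hb' hc hl'
  obtain ⟨k, -, hk⟩ := pathElt_eq_cycleUnit_zpow K hb' hc hm'
  have hp' := p.1.isPath
  have hq' := q.1.isPath
  rw [hp] at hp'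
  rw [hq] at hq'
  have hlen := List.length_pos_iff.2 hb'.1
  -- The closed parts contribute the `j`-th power of the cycle and, from the ghost path, its power
  -- `-k`.
  have h3 := h p q (laurentEquiv hlen (.single (j + -k) 1))
  have h4 : (cycleUnits K hY hexit).coef c
      (laurentEquiv hlen (.single (j + -k) 1)) =
      ((cycleUnit K hb' hc ^ (j + -k) : (Unital K G)ˣ) : Unital K G) := by
    change cycleHom K hb' hc ((laurentEquiv hlen).symm (laurentEquiv hlen _)) = _
    rw [AlgEquiv.symm_apply_apply, cycleHom_single, one_smul]
  rw [MatrixUnits.elt_apply, h4] at h3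
  change pathElt K G p.1.start p.1.edges * (_ * ghostElt K G q.1.start q.1.edges) ∈ S at h3
  rw [pathElt_append hp' hl', ghostElt_append hq' hm', hj, hk]
  convert h3 using 1
  have hcomm := (commute_vt_cycleUnit_zpow K hb' hc (-k)).eq
  have hgv := vt_mul_ghostElt (K := K) hq'
  have hidem := (isFamily_gen K G).idem (cycleBase hY c)
  rw [zpow_add, Units.val_mul, mul_assoc, mul_assoc, mul_assoc, mul_assoc, hgv,
    ← mul_assoc (vt K G _), hcomm, mul_assoc _ (vt K G _), hgv]

end Systems

end Leavitt

/-! ### The graded isomorphism and the equivalences -/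

namespace LeavittPathAlgebra

open Leavitt DirGraph

theorem gradedIso_of_graph_conditions {V : Type u} {E : Type v} {G : DirGraph V E} (K : Type w)
    [Field K] {X : Set V} (hX : G.IsLinePointReps X) {Y : Set (List E)} (hY : G.IsCycleReps Y)
    (hfin : G.RowFinite) (hexit : ∀ c, G.IsCycle c → ¬ G.HasExit c)
    (hinf : ∀ p, G.IsInfPath p →
      (∃ q, G.IsStraightLine q ∧ G.ContainsLinePoint q ∧ DirGraph.TailEquiv p q) ∨
      (∃ c q, G.IsCycle c ∧ DirGraph.IsInfPower c q ∧ DirGraph.TailEquiv p q)) :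
    GradedIso K (LeavittPathAlgebra K G)
      (MatrixSum K (fun x : X => G.LinePaths x.1) (fun c : Y => G.CyclePaths c.1)
        (fun c => c.1.length))
      (LeavittPathAlgebra.grading K G)
      (MatrixSum.grading K (fun x : X => G.LinePaths x.1) (fun c : Y => G.CyclePaths c.1)
        (fun c => c.1.length) (fun x => G.lineShift x.1) (fun c => G.cycleShift c.1)) := by
  let Φ := (lineUnits K hX).prodMap (cycleUnits K hY hexit) (lineCol_mul_pathElt hX hY hexit)
    (ghostElt_mul_lineRow hX hY hexit)
  refine gradedIso_of_injective K G Φ (MatrixUnits.prodMap_injective _ _) ?_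
    fun n b => MatrixUnits.prodMap_mem_iff _ _ mul_mem_homog
  apply Set.Subset.antisymm
  · rintro _ ⟨x, rfl⟩
    refine add_mem (S := NonUnitalSubalgebra K (Unital K G)) ?_ ?_
    · exact (lineUnits K hX).sumMap_induction (P := (· ∈ algebra K G)) (zero_mem _)
        (fun _ _ => add_mem) (lineUnits_elt_mem_algebra hX) x.1
    · exact (cycleUnits K hY hexit).sumMap_induction (P := (· ∈ algebra K G)) (zero_mem _)
        (fun _ _ => add_mem) (cycleUnits_elt_mem_algebra hY hexit) x.2
  · intro x hx
    -- The image as a subspace: it contains all matrix units, so covering passes from the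
    -- representatives to every vertex.
    let S : Submodule K (Unital K G) :=
      { carrier := Set.range Φ
        zero_mem' := ⟨0, map_zero Φ⟩
        add_mem' := by rintro _ _ ⟨x, rfl⟩ ⟨y, rfl⟩; exact ⟨x + y, map_add Φ x y⟩
        smul_mem' := by rintro k _ ⟨x, rfl⟩; exact ⟨k • x, map_smul Φ k x⟩ }
    exact algebra_le_of_covers (S := S)
      (Covers.of_graph_conditions hX hY hfin hexit hinf
        (fun x hx a ha => covers_of_mem_tree hX ⟨x, hx⟩
          (MatrixUnits.elt_mem_range_prodMap (lineCol_mul_pathElt hX hY hexit)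
            (ghostElt_mul_lineRow hX hY hexit) ⟨x, hx⟩) ha)
        (fun c hc a ha => covers_of_isCycleAt hY hexit ⟨c, hc⟩
          (MatrixUnits.elt_mem_range_prodMap' (lineCol_mul_pathElt hX hY hexit)
            (ghostElt_mul_lineRow hX hY hexit) ⟨c, hc⟩) ha)) hx

end LeavittPathAlgebra

theorem mainTheorem8 {V : Type u} {E : Type v} (G : DirGraph V E) (K : Type w) [Field K]
    (X : Set V) (hX : G.IsLinePointReps X) (Y : Set (List E)) (hY : G.IsCycleReps Y) :
    List.TFAE [
      -- graded left self-injective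
      GradedRingTheory.IsLeftSelfInjective fun n => (LeavittPathAlgebra.grading K G n).toAddSubgroup,
      -- graded right self-injective
      GradedRingTheory.IsRightSelfInjective fun n => (LeavittPathAlgebra.grading K G n).toAddSubgroup,
      -- the condition on the graph
      G.RowFinite ∧ (∀ c, G.IsCycle c → ¬ G.HasExit c) ∧
        ∀ p, G.IsInfPath p →
          (∃ q, G.IsStraightLine q ∧ G.ContainsLinePoint q ∧ DirGraph.TailEquiv p q) ∨
          (∃ c q, G.IsCycle c ∧ DirGraph.IsInfPower c q ∧ DirGraph.TailEquiv p q),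
      -- the decomposition with the index sets, shifts and exponents read off from the graph
      GradedIso K (LeavittPathAlgebra K G)
        (MatrixSum K (fun x : X => G.LinePaths x.1) (fun c : Y => G.CyclePaths c.1)
          (fun c => c.1.length))
        (LeavittPathAlgebra.grading K G)
        (MatrixSum.grading K (fun x : X => G.LinePaths x.1) (fun c : Y => G.CyclePaths c.1)
          (fun c => c.1.length) (fun x => G.lineShift x.1) (fun c => G.cycleShift c.1)),
      -- some decomposition of this kind
      ∃ (I : Type u) (J : Type v) (Λ : I → Type (max u v)) (Υ : J → Type (max u v))
        (t : J → ℕ) (δ : ∀ i, Λ i → ℤ) (ε : ∀ j, Υ j → ℤ), (∀ j, 0 < t j) ∧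
          GradedIso K (LeavittPathAlgebra K G) (MatrixSum K Λ Υ t)
            (LeavittPathAlgebra.grading K G) (MatrixSum.grading K Λ Υ t δ ε),
      -- graded semisimple
      GradedRingTheory.IsGradedSemisimple fun n => (LeavittPathAlgebra.grading K G n).toAddSubgroup] := by

  have hint := LeavittPathAlgebra.isInternal_grading K G
  tfae_have 1 ↔ 2 := (LeavittPathAlgebra.isRightSelfInjective_iff K G).symm
  tfae_have 1 → 3 := LeavittPathAlgebra.graph_conditions_of_isLeftSelfInjective
  tfae_have 3 → 4 := fun ⟨hfin, hexit, hinf⟩ =>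
    LeavittPathAlgebra.gradedIso_of_graph_conditions K hX hY hfin hexit hinf
  tfae_have 4 → 5 := fun h => ⟨X, Y, _, _, _, _, _, fun c => by
    obtain ⟨a, hc⟩ := hY.1 c.1 c.2
    exact List.length_pos_iff.2 hc.1, h⟩
  tfae_have 5 → 6 := fun ⟨I, J, Λ, Υ, t, δ, ε, ht, h⟩ =>
    (h.hasPrimitiveIdempotents (MatrixSum.hasPrimitiveIdempotents Λ Υ t ht δ ε)).isGradedSemisimple
      hint (LeavittPathAlgebra.grading_mul K G)
  tfae_have 6 → 1 := fun h => h.isLeftSelfInjective hint (LeavittPathAlgebra.grading_mul K G)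
    (LeavittPathAlgebra.closure_mul_eq_top K G)
  tfae_finish
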